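/- **Theorem 6.5.** Let $k$ be a field. For a coalgebra $C$ over $k$ and grouplike elements $g,h\in C$ let $\partial^n_{g,h}\colon C^{\otimes n}\to C^{\otimes(n+1)}$ be $$\partial^n_{g,h}=g\otimes \mathrm{Id}^{\otimes n}+\sum_{i=0}^{n-1}(-1)^{i+1}\,\mathrm{Id}^{\otimes i}\otimes\Delta\otimes \mathrm{Id}^{\otimes (n-i-1)}+(-1)^{n+1}\,\mathrm{Id}^{\otimes n}\otimes h ,\qquad \partial^0_{g,h}(1)=g-h,$$ and put $Z^n_{g,h}(C)=\ker\partial^n_{g,h}$, $B^n_{g,h}(C)=\operatorname{im}\partial^{n-1}_{g,h}$, $\mathfrak P^n_{g,h}(C)=Z^n_{g,h}(C)/B^n_{g,h}(C)$. The class of a cocycle $f$ is written $\overline f$. Let $H$ be a Hopf algebra over $k$ and $K\subseteq H$ a Hopf subalgebra such that $H=K[z;\sigma,\delta]$ is a Hopf Ore extension of $K$: $\sigma$ is an algebra automorphism of $K$, $\delta$ is a $k$-linear $\sigma$-derivation of $K$ (that is, $\delta(ab)=\sigma(a)\delta(b)+\delta(a)b$), $za=\sigma(a)z+\delta(a)$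 for all $a\in K$, every element of $H$ is uniquely a finite sum $\sum_i f_iz^i$ with $f_i\in K$, and $$\Delta(z)=z\otimes 1+e\otimes z+z_0$$ with $e\in K$ grouplike and $z_0\in K\otimes K$. Then $\sigma(e)=qe$ for a unique $q\in k^\times$ (so $ze=qez+\delta(e)$), and every grouplike element of $H$ lies in $K$. Let $\ell\ge 2$ be the order of $q$ if $q\ne 1$ is a root of unity, and $\ell=\infty$ if $q=1$ or $q$ is not a root of unity; conditions that involve $e^\ell$ are void when $\ell=\infty$. If $q$ is a root of unity (in particular if $q=1$), assume that $\operatorname{char}k=0$. For $g\in G(K)$, the set of grouplike elements of $K$, let $\phi^n_{g,1}\colon\mathfrak P^n_{g,1}(K)\to\mathfrak P^n_{g,1}(H)$ be the map induced by the inclusion. For $2\le\ell<\infty$ put $$[z]^\ell=\sum_{i=1}^{\ell-1}\frac{[\ell-1]_q!}{[i]_q!\,[\ell-i]_q!}\,e^{\ell-i}z^i\otimes z^{\ell-i},\qquad [n]_q=1+q+\dots+q^{n-1},\quad [n]_q!=[1]_q[2]_q\cdots[n]_q .$$ 1. $\phi^1_{g,1}$ is injective for every $g\in G(K)$. 2.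 The cokernel of $\phi^1_{g,1}$: * (2i) $\operatorname{coker}\phi^1_{g,1}=0$ for all $g\in G(K)$ with $g\ne e,e^\ell$. * (2ii) If $z_0\in B^2_{e,1}(K)$ and $f_0\in K$ satisfies $z_0=\partial^1_{e,1}(f_0)$, then $z+f_0\in Z^1_{e,1}(H)$ and $\operatorname{coker}\phi^1_{e,1}$ is one-dimensional, spanned by the class of $z+f_0$. If $z_0\notin B^2_{e,1}(K)$, then $\operatorname{coker}\phi^1_{e,1}=0$. * (2iii) If $\ell$ is finite, then $\dim\operatorname{coker}\phi^1_{e^\ell,1}\le 1$. If moreover $z_0=0$ and $ze=qez$, then $z^\ell\in Z^1_{e^\ell,1}(H)$ and $\operatorname{coker}\phi^1_{e^\ell,1}$ is one-dimensional, spanned by the class of $z^\ell$. 3. The kernel of $\phi^2_{g,1}$: * (3i) $\ker\phi^2_{g,1}=0$ for all $g\in G(K)$ with $g\neq e,e^\ell$. * (3ii) If $z_0\in B^2_{e,1}(K)$, then $\ker\phi^2_{e,1}=0$. If $z_0\notin B^2_{e,1}(K)$, then $z_0\in Z^2_{e,1}(K)$ and $\ker\phi^2_{e,1}=k\,\overline{z_0}$,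 which is one-dimensional. * (3iii) If $\ell$ is finite, then $\dim\ker\phi^2_{e^\ell,1}\le1$. If moreover $z_0=0$ and $ze=qez$, then $\ker\phi^2_{e^\ell,1}=0$. 4. The cokernel of $\phi^2_{g,1}$, for $g\in G(K)$: * (4a) Suppose that $q$ is $1$ or not a root of unity. If $a_0\in Z^1_{g,e}(K)$ and $f_0\in K\otimes K$ satisfy $\partial^2_{g,1}(f_0)=-a_0\otimes z_0$, then $f=a_0\otimes z+f_0$ lies in $Z^2_{g,1}(H)$, and its class in $\operatorname{coker}\phi^2_{g,1}$ is nonzero if and only if $\overline{a_0}\ne0$ in $\mathfrak P^1_{g,e}(K)$. Every nonzero element of $\operatorname{coker}\phi^2_{g,1}$ is the class of some $f=a_0\otimes z+f_0$ with $a_0\in Z^1_{g,e}(K)$ and $f_0\in K\otimes K$ such that (4i) $\overline{a_0}\neq0$ in $\mathfrak P^1_{g,e}(K)$ and $\overline{a_0\otimes z_0}=0$ in $\mathfrak P^3_{g,1}(K)$, and (4ii) $\partial^2_{g,1}(f_0)=-a_0\otimes z_0$. * (4b) Suppose that $q$ is a primitive $\ell$-th root of unity with $\ell\ge2$, $z_0=0$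 and $ze=qez$. Give $H$ the coalgebra grading in which $az^i$ has degree $i$ for $a\in K$, and $H\otimes H$ the total grading. Let $(\operatorname{coker}\phi^2_{g,1})_w$ be the space of classes of the cocycles in $Z^2_{g,1}(H)$ that are homogeneous of degree $w$. Then $\operatorname{coker}\phi^2_{g,1}=\bigoplus_{w\ge0}(\operatorname{coker}\phi^2_{g,1})_w$, and: (4iii) $(\operatorname{coker}\phi^2_{g,1})_1\cong\mathfrak P^1_{g,e}(K)\otimes kz$, where $\overline{a}\otimes z$ corresponds to the class of $a\otimes z$; (4iv) $(\operatorname{coker}\phi^2_{g,1})_\ell$ is isomorphic to $\bigl(\mathfrak P^1_{g,e^\ell}(K)\otimes kz^\ell\bigr)\oplus k[z]^\ell$ if $g=e^\ell$, and to $\mathfrak P^1_{g,e^\ell}(K)\otimes kz^\ell$ if $g\neq e^\ell$, where $\overline a\otimes z^\ell$ corresponds to the class of $a\otimes z^\ell$ and $[z]^\ell$ to its own class; (4v) $(\operatorname{coker}\phi^2_{g,1})_{\ell+1}$ is one-dimensional, spanned by the class of $e^\ell z\otimes z^\ell$, if $g=e^{\ell+1}$, and is $0$ if $g\ne e^{\ell+1}$;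 (4vi) $(\operatorname{coker}\phi^2_{g,1})_w=0$ for all $w\ne1,\ell,\ell+1$. -/

import Mathlib

open scoped TensorProduct

noncomputable section

/-! ### Cohomology of a three-term sequence of vector spaces -/

section Coh

variable {k : Type*} [Field k]
variable {U V W : Type*} [AddCommGroup U] [Module k U] [AddCommGroup V] [Module k V]
  [AddCommGroup W] [Module k W]
variable {U' V' W' : Type*} [AddCommGroup U'] [Module k U'] [AddCommGroup V'] [Module k V']
  [AddCommGroup W'] [Module k W']

/-- `ker d' / im d` for `d : U → V` and `d' : V → W`. -/
abbrev Coh (d : U →ₗ[k] V) (d' : V →ₗ[k] W) : Type _ :=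
  LinearMap.ker d' ⧸ (LinearMap.range d).submoduleOf (LinearMap.ker d')

/-- The map on `ker / im` induced by a morphism of three-term sequences. -/
def Coh.map {d : U →ₗ[k] V} {d' : V →ₗ[k] W} {D : U' →ₗ[k] V'} {D' : V' →ₗ[k] W'}
    (u : U →ₗ[k] U') (v : V →ₗ[k] V') (w : W →ₗ[k] W')
    (h : v ∘ₗ d = D ∘ₗ u) (h' : w ∘ₗ d' = D' ∘ₗ v) : Coh d d' →ₗ[k] Coh D D' :=
  Submodule.mapQ _ _
    (v.restrict (p := LinearMap.ker d') (q := LinearMap.ker D') (fun x hx => by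
      rw [LinearMap.mem_ker] at hx ⊢
      rw [← LinearMap.comp_apply, ← h', LinearMap.comp_apply, hx, map_zero]))
    (by
      rintro ⟨x, hx⟩ ⟨y, hy⟩
      exact ⟨u y, by
        rw [← LinearMap.comp_apply, ← h, LinearMap.comp_apply, hy]; rfl⟩)

end Coh

/-! ### Primitive cohomology of a coalgebra in low degrees

For elements `g h` of a coalgebra `C` (in applications they are grouplike) the maps
`∂ⁿ : C^{⊗ n} → C^{⊗ (n+1)}`,
`∂ⁿ = g ⊗ Id^{⊗ n} + ∑_{i<n} (-1)^{i+1} Id^{⊗ i} ⊗ Δ ⊗ Id^{⊗ (n-i-1)} + (-1)^{n+1} Id^{⊗ n} ⊗ h`,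
for `n = 0, 1, 2`; triple tensor products are bracketed to the right. -/

section PrimitiveCohomology

variable (k : Type*) [Field k]
variable {C : Type*} [AddCommGroup C] [Module k C] [Coalgebra k C]

/-- `∂⁰(1) = g - h`. -/
def primD0 (g h : C) : k →ₗ[k] C := LinearMap.toSpanSingleton k C (g - h)

/-- `∂¹(c) = g ⊗ c - Δ(c) + c ⊗ h`. -/
def primD1 (g h : C) : C →ₗ[k] C ⊗[k] C :=
  TensorProduct.mk k C C g - Coalgebra.comul + (TensorProduct.mk k C C).flip h

/-- `∂²(c ⊗ d) = g ⊗ c ⊗ d - Δ(c) ⊗ d + c ⊗ Δ(d) - c ⊗ d ⊗ h`. -/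
def primD2 (g h : C) : C ⊗[k] C →ₗ[k] C ⊗[k] (C ⊗[k] C) :=
  TensorProduct.mk k C (C ⊗[k] C) g
    - (TensorProduct.assoc k C C C).toLinearMap ∘ₗ LinearMap.rTensor C Coalgebra.comul
    + LinearMap.lTensor C Coalgebra.comul
    - LinearMap.lTensor C ((TensorProduct.mk k C C).flip h)

/-- `Z¹_{g,h}(C)`. -/
abbrev primZ1 (g h : C) : Submodule k C := LinearMap.ker (primD1 k g h)
/-- `Z²_{g,h}(C)`. -/
abbrev primZ2 (g h : C) : Submodule k (C ⊗[k] C) := LinearMap.ker (primD2 k g h)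
/-- `B¹_{g,h}(C)`. -/
abbrev primB1 (g h : C) : Submodule k C := LinearMap.range (primD0 k g h)
/-- `B²_{g,h}(C)`. -/
abbrev primB2 (g h : C) : Submodule k (C ⊗[k] C) := LinearMap.range (primD1 k g h)
/-- `B³_{g,h}(C)`. -/
abbrev primB3 (g h : C) : Submodule k (C ⊗[k] (C ⊗[k] C)) := LinearMap.range (primD2 k g h)

/-- The first primitive cohomology `Z¹_{g,h}(C) / B¹_{g,h}(C)`. -/
abbrev PrimCoh1 (g h : C) : Type _ := Coh (primD0 k g h) (primD1 k g h)

/-- The second primitive cohomology `Z²_{g,h}(C) / B²_{g,h}(C)`. -/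
abbrev PrimCoh2 (g h : C) : Type _ := Coh (primD1 k g h) (primD2 k g h)

variable {k}
variable {E : Type*} [AddCommGroup E] [Module k E] [Coalgebra k E]

theorem primD0_natural (f : C →ₗc[k] E) {g h : C} {g' h' : E} (hg : f g = g') (hh : f h = h') :
    f.toLinearMap ∘ₗ primD0 k g h = primD0 k g' h' ∘ₗ LinearMap.id := by
  ext; simp [primD0, ← hg, ← hh]

theorem primD1_natural (f : C →ₗc[k] E) {g h : C} {g' h' : E} (hg : f g = g') (hh : f h = h') :
    TensorProduct.map f.toLinearMap f.toLinearMap ∘ₗ primD1 k g h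
      = primD1 k g' h' ∘ₗ f.toLinearMap := by
  ext c
  simp [primD1, ← hg, ← hh]

theorem primD2_natural (f : C →ₗc[k] E) {g h : C} {g' h' : E} (hg : f g = g') (hh : f h = h') :
    TensorProduct.map f.toLinearMap (TensorProduct.map f.toLinearMap f.toLinearMap)
        ∘ₗ primD2 k g h
      = primD2 k g' h' ∘ₗ TensorProduct.map f.toLinearMap f.toLinearMap := by
  ext c d
  have hc := LinearMap.congr_fun f.map_comp_comul c
  simp only [LinearMap.comp_apply] at hc
  have key : ∀ t : C ⊗[k] C,
      TensorProduct.map f.toLinearMap (TensorProduct.map f.toLinearMap f.toLinearMap)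
        (TensorProduct.assoc k C C C (t ⊗ₜ d))
      = TensorProduct.assoc k E E E
        ((TensorProduct.map f.toLinearMap f.toLinearMap t) ⊗ₜ f d) := by
    intro t
    induction t using TensorProduct.induction_on with
    | zero => simp
    | tmul x y => simp
    | add x y hx hy => simp only [TensorProduct.add_tmul, map_add, hx, hy]
  have key' := key (Coalgebra.comul c)
  rw [hc] at key'
  simp only [CoalgHom.toLinearMap_eq_coe] at key'
  simpa [primD2, ← hg, ← hh] using key'

/-- The map on first primitive cohomology induced by a coalgebra map. -/
def PrimCoh1.map (f : C →ₗc[k] E) {g h : C} {g' h' : E} (hg : f g = g') (hh : f h = h') :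
    PrimCoh1 k g h →ₗ[k] PrimCoh1 k g' h' :=
  Coh.map _ _ _ (primD0_natural f hg hh) (primD1_natural f hg hh)

/-- The map on second primitive cohomology induced by a coalgebra map. -/
def PrimCoh2.map (f : C →ₗc[k] E) {g h : C} {g' h' : E} (hg : f g = g') (hh : f h = h') :
    PrimCoh2 k g h →ₗ[k] PrimCoh2 k g' h' :=
  Coh.map _ _ _ (primD1_natural f hg hh) (primD2_natural f hg hh)

end PrimitiveCohomology

/-! ### Gaussian integers and factorials -/

/-- `[n]_q = 1 + q + ⋯ + q^{n-1}`. -/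
def qInt {k : Type*} [Field k] (q : k) (n : ℕ) : k := ∑ j ∈ Finset.range n, q ^ j

/-- `[n]_q! = [1]_q [2]_q ⋯ [n]_q`. -/
def qFact {k : Type*} [Field k] (q : k) (n : ℕ) : k := ∏ i ∈ Finset.Icc 1 n, qInt q i

/-! ### Hopf Ore extensions -/

/-- The Hopf algebra `H` is a Hopf Ore extension `K[z; σ, δ]` of the Hopf algebra `K`, which is
embedded in `H` by `ι` (injectivity is part of `expand_bijective`). -/
structure HopfOreExt (k K H : Type*) [Field k] [Ring K] [HopfAlgebra k K]
    [Ring H] [HopfAlgebra k H] where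
  /-- the inclusion of `K` in `H` -/
  ι : K →ₐc[k] H
  /-- the automorphism of `K` -/
  σ : K ≃ₐ[k] K
  /-- the `σ`-derivation of `K` -/
  δ : K →ₗ[k] K
  δ_mul : ∀ a b : K, δ (a * b) = σ a * δ b + δ a * b
  /-- the new variable -/
  z : H
  z_mul : ∀ a : K, z * ι a = ι (σ a) * z + ι (δ a)
  /-- every element of `H` is uniquely of the form `∑ fᵢ zⁱ` with `fᵢ` in `K` -/
  expand_bijective :
    Function.Bijective (fun p : ℕ →₀ K => p.sum (fun i a => ι a * z ^ i))
  /-- the grouplike element in the comultiplication of `z` -/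
  e : K
  e_groupLike : IsGroupLikeElem k e
  /-- the tail in the comultiplication of `z` -/
  z₀ : K ⊗[k] K
  comul_z : Coalgebra.comul (R := k) z =
    z ⊗ₜ[k] (1 : H) + ι e ⊗ₜ[k] z
      + TensorProduct.map (ι : K →ₗc[k] H).toLinearMap (ι : K →ₗc[k] H).toLinearMap z₀

namespace HopfOreExt

variable {k K H : Type*} [Field k] [Ring K] [HopfAlgebra k K] [Ring H] [HopfAlgebra k H]
variable (X : HopfOreExt k K H)

/-- The scalar `q` with `σ(e) = q e`, obtained by applying the counit to `σ(e)`. -/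
def q : k := Coalgebra.counit (R := k) (X.σ X.e)

/-- The inclusion `K ⊗ K → H ⊗ H`. -/
def ι₂ : K ⊗[k] K →ₗ[k] H ⊗[k] H :=
  TensorProduct.map (X.ι : K →ₗc[k] H).toLinearMap (X.ι : K →ₗc[k] H).toLinearMap

/-- `φ¹_{g,1}`, induced by the inclusion of `K` in `H`. -/
def φ₁ (g : K) : PrimCoh1 k g (1 : K) →ₗ[k] PrimCoh1 k (X.ι g) (1 : H) :=
  PrimCoh1.map (X.ι : K →ₗc[k] H) (g' := X.ι g) (h' := 1) rfl (map_one X.ι)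

/-- `φ²_{g,1}`, induced by the inclusion of `K` in `H`. -/
def φ₂ (g : K) : PrimCoh2 k g (1 : K) →ₗ[k] PrimCoh2 k (X.ι g) (1 : H) :=
  PrimCoh2.map (X.ι : K →ₗc[k] H) (g' := X.ι g) (h' := 1) rfl (map_one X.ι)

/-- The cokernel of `φ¹_{g,1}`. -/
abbrev Coker₁ (g : K) : Type _ := PrimCoh1 k (X.ι g) (1 : H) ⧸ LinearMap.range (X.φ₁ g)

/-- The cokernel of `φ²_{g,1}`. -/
abbrev Coker₂ (g : K) : Type _ := PrimCoh2 k (X.ι g) (1 : H) ⧸ LinearMap.range (X.φ₂ g)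

/-- The class of a cocycle of `H` in the cokernel of `φ¹_{g,1}`. -/
def cl₁ (g : K) : primZ1 k (X.ι g) (1 : H) →ₗ[k] X.Coker₁ g :=
  (LinearMap.range (X.φ₁ g)).mkQ ∘ₗ Submodule.mkQ _

/-- The class of a cocycle of `H` in the cokernel of `φ²_{g,1}`. -/
def cl₂ (g : K) : primZ2 k (X.ι g) (1 : H) →ₗ[k] X.Coker₂ g :=
  (LinearMap.range (X.φ₂ g)).mkQ ∘ₗ Submodule.mkQ _

/-- The elements of `H ⊗ H` that are homogeneous of degree `w`, where `a zⁱ` has degree `i`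
for `a` in `K`. -/
def homog (w : ℕ) : Submodule k (H ⊗[k] H) :=
  Submodule.span k {x | ∃ (i j : ℕ) (a b : K), i + j = w ∧
    x = (X.ι a * X.z ^ i) ⊗ₜ[k] (X.ι b * X.z ^ j)}

/-- The subspace of the cokernel of `φ²_{g,1}` that consists of the classes of the cocycles
that are homogeneous of degree `w`. -/
def coker₂Deg (g : K) (w : ℕ) : Submodule k (X.Coker₂ g) :=
  ((X.homog w).comap (primZ2 k (X.ι g) (1 : H)).subtype).map (X.cl₂ g)

/-- The element
`[z]^ℓ = ∑_{0<i<ℓ} ([ℓ-1]_q! / ([i]_q! [ℓ-i]_q!)) e^{ℓ-i} zⁱ ⊗ z^{ℓ-i}` of `H ⊗ H`. -/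
def bracketZ (l : ℕ) : H ⊗[k] H :=
  ∑ i ∈ Finset.Ioo 0 l,
    (qFact X.q (l - 1) / (qFact X.q i * qFact X.q (l - i))) •
      ((X.ι X.e ^ (l - i) * X.z ^ i) ⊗ₜ[k] (X.z ^ (l - i)))

end HopfOreExt

end

/-! Filter `H` and its tensor powers by total degree in `z`. As `Δ(z) = z ⊗ 1 + e ⊗ z + z₀` and
`σ(e) = q e`, the coefficient of `zⁱ ⊗ zʲ` in `Δ(a z^w)`, for `i + j = w`, is `qChoose q i j` times
`Δ(a)(eʲ ⊗ 1)`; `δ` and `z₀` enter only in lower degrees (`coef₂_comul_z_pow`, `coef₂_comul_mon`).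
On components of top degree (symbols) the differentials are therefore those of `K`, twisted by
powers of `e` and weighted by Gaussian binomials.

Degree one. Let `∂¹x` lie in `K ⊗ K` and let `x` have degree `w ≥ 1`. The coefficient of `z^w ⊗ 1`
forces the leading coefficient of `x` to be a scalar, that of `1 ⊗ z^w` forces `g = e^w`, and the
others force all interior binomials of degree `w` to vanish. By the assumption on the characteristic
this leaves only `w = 1` and `w = ℓ` (`exists_qChoose_ne_zero`, `cases_of_primD1_mem`). The case
`∂¹x = 0` gives the cokernel of `φ¹`; the general case gives the kernel of `φ²`, since a class of
`K` dies in `H` when it is some `∂¹x`.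

Degree two. Modulo coboundaries, contractions with the counit bring the symbol of a cocycle of
degree at most `w` to the form `a ⊗ z^w + ∑ cᵢ e^{w-i} zⁱ ⊗ z^{w-i}`, where `a` is in
`Z¹_{g,e^w}(K)`, `c` is a two-cocycle of the `q`-divided power coalgebra, and `cᵢ (g - e^w)` plus a
binomial multiple of `a` is zero (`exists_isNormal`). For `w ≥ 2` other than `ℓ, ℓ + 1` the family
`c` is a multiple of the binomials (`IsQCocycle.exists_eq`), and the whole symbol is that of a
coboundary. In degree `1` the terms `a ⊗ z` survive. In degree `ℓ` the interior binomials vanish,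
and `a ⊗ z^ℓ` and `[z]^ℓ` survive. In degree `ℓ + 1` the interior binomials are `1` at both ends and
`0` between, and `e^ℓ z ⊗ z^ℓ` survives. If there is no `ℓ`, descent on the degree reduces every
cocycle to `a ⊗ z` plus an element of `K ⊗ K`. In the graded case a homogeneous cochain is its own
symbol, so each degree is computed separately. -/

open scoped TensorProduct

noncomputable section

/-! ### Gaussian binomials and their values at roots of unity -/

section GaussianBinomials

variable {k : Type*} [Field k] (q : k)

/-- The Gaussian binomial coefficient `(i + j choose j)_q`. -/
def qChoose (q : k) : ℕ → ℕ → k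
  | 0, _ => 1
  | _ + 1, 0 => 1
  | i + 1, j + 1 => q ^ (j + 1) * qChoose q i (j + 1) + qChoose q (i + 1) j

@[simp] theorem qChoose_zero_left (j : ℕ) : qChoose q 0 j = 1 := by
  rw [qChoose]

@[simp] theorem qChoose_zero_right (i : ℕ) : qChoose q i 0 = 1 := by
  cases i <;> rw [qChoose]

theorem qChoose_succ_succ (i j : ℕ) : qChoose q (i + 1) (j + 1) =
    q ^ (j + 1) * qChoose q i (j + 1) + qChoose q (i + 1) j := by
  rw [qChoose]

theorem qChoose_succ_succ' (i j : ℕ) : qChoose q (i + 1) (j + 1) =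
    qChoose q i (j + 1) + q ^ (i + 1) * qChoose q (i + 1) j := by
  induction i generalizing j with
  | zero =>
    induction j with
    | zero => simp [qChoose_succ_succ]; ring
    | succ j ih =>
      have h1 := qChoose_succ_succ q 0 (j + 1)
      have h2 := qChoose_succ_succ q 0 j
      simp only [qChoose_zero_left] at h1 h2 ih ⊢
      linear_combination h1 + ih - q * h2
  | succ i ih =>
    induction j with
    | zero =>
      have h1 := qChoose_succ_succ q (i + 1) 0
      have h2 := ih 0
      have h3 := qChoose_succ_succ q i 0
      simp only [qChoose_zero_right] at h1 h2 h3 ⊢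
      linear_combination h1 + q * h2 - h3
    | succ j ihj =>
      linear_combination qChoose_succ_succ q (i + 1) (j + 1) + q ^ (j + 2) * ih (j + 1) + ihj
        - qChoose_succ_succ q i (j + 1) - q ^ (i + 2) * qChoose_succ_succ q (i + 1) j

theorem qChoose_comm (i j : ℕ) : qChoose q i j = qChoose q j i := by
  induction i generalizing j with
  | zero => simp
  | succ i ih =>
    induction j with
    | zero => simp
    | succ j ihj => rw [qChoose_succ_succ, qChoose_succ_succ', ih, ihj]; ring

/-- Both sides are the Gaussian trinomial coefficient of `i, j, l`. The identity makes `i ↦ qChoose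
q i (w - i)` a two-cocycle. Induction with the Pascal rule avoids dividing by factorials, which may
vanish. -/
theorem qChoose_assoc (i j l : ℕ) :
    qChoose q i j * qChoose q (i + j) l = qChoose q j l * qChoose q i (j + l) := by
  induction i generalizing j l with
  | zero => simp
  | succ i ihi =>
    induction j generalizing l with
    | zero => simp
    | succ j ihj =>
      induction l with
      | zero => simp
      | succ l ihl =>
        have e1 := ihi (j + 1) (l + 1)
        have e2 := ihj (l + 1)
        have a1 : i + 1 + (j + 1) = (i + (j + 1)) + 1 := by ring
        have a2 : j + 1 + (l + 1) = (j + 1 + l) + 1 := by ring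
        have a3 : i + 1 + j = i + (j + 1) := by ring
        have a4 : j + 1 + l = j + (l + 1) := by ring
        rw [a3] at e2
        rw [a4] at ihl
        have h1 := qChoose_succ_succ q i j
        have h2 := qChoose_succ_succ q j l
        have h3 := qChoose_succ_succ q (i + (j + 1)) l
        have h4 := qChoose_succ_succ q i (j + 1 + l)
        rw [← a1] at h3
        rw [← a2, a4] at h4
        linear_combination qChoose q (i + 1) (j + 1) * h3 - qChoose q (j + 1) (l + 1) * h4
          + q ^ (j + 1 + (l + 1)) * e1 + q ^ (l + 1) * e2 + ihl
          + q ^ (l + 1) * qChoose q (i + (j + 1)) (l + 1) * h1 - qChoose q (i + 1) (j + (l + 1)) * h2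

theorem qInt_succ (n : ℕ) : qInt q (n + 1) = qInt q n + q ^ n := by
  simp [qInt, Finset.sum_range_succ]

@[simp] theorem qInt_zero : qInt q 0 = 0 := by simp [qInt]

@[simp] theorem qInt_one : qInt q 1 = 1 := by simp [qInt]

theorem qChoose_one_left (j : ℕ) : qChoose q 1 j = qInt q (j + 1) := by
  induction j with
  | zero => simp
  | succ j ih => rw [qChoose_succ_succ, ih, qInt_succ q (j + 1)]; simp; ring

theorem qChoose_one_right (i : ℕ) : qChoose q i 1 = qInt q (i + 1) := by
  rw [qChoose_comm, qChoose_one_left]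

theorem qInt_add (i j : ℕ) : qInt q (i + j) = qInt q j + q ^ j * qInt q i := by
  induction i with
  | zero => simp
  | succ i ih => rw [show i + 1 + j = (i + j) + 1 by ring, qInt_succ, ih, qInt_succ]; ring

theorem qFact_zero : qFact q 0 = 1 := by simp [qFact]

theorem qFact_succ (n : ℕ) : qFact q (n + 1) = qFact q n * qInt q (n + 1) := by
  simp [qFact, Finset.prod_Icc_succ_top]

theorem qChoose_mul_qFact (i j : ℕ) :
    qChoose q i j * (qFact q i * qFact q j) = qFact q (i + j) := by
  induction i generalizing j with
  | zero => simp [qFact_zero]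
  | succ i ihi =>
    induction j with
    | zero => simp [qFact_zero]
    | succ j ihj =>
      have h1 := ihi (j + 1)
      have h2 := ihj
      rw [show i + 1 + (j + 1) = (i + (j + 1)) + 1 by ring, qFact_succ q (i + (j + 1)),
        qChoose_succ_succ, show i + (j + 1) + 1 = (i + 1) + (j + 1) by ring, qInt_add]
      rw [show i + 1 + j = i + (j + 1) by ring] at h2
      rw [qFact_succ] at h1 h2 ⊢
      rw [qFact_succ q j]
      linear_combination q ^ (j + 1) * qInt q (i + 1) * h1 + qInt q (j + 1) * h2

/-- This is `qChoose_assoc` at `1, i, j`; it stays usable where the factorials vanish. -/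
theorem qChoose_absorb (i j : ℕ) :
    qInt q (i + 1) * qChoose q (i + 1) j = qInt q (i + 1 + j) * qChoose q i j := by
  have h := qChoose_assoc q 1 i j
  rw [qChoose_one_left, qChoose_one_left] at h
  rw [add_comm 1 i] at h
  rw [h, show i + 1 + j = i + j + 1 by ring]; ring

theorem qInt_mul_sub_one (n : ℕ) : qInt q n * (q - 1) = q ^ n - 1 := geom_sum_mul q n

variable {q}

theorem qInt_ne_zero_of_pow_ne_one {n : ℕ} (h : q ^ n ≠ 1) : qInt q n ≠ 0 := by
  intro h0
  have := qInt_mul_sub_one q n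
  rw [h0, zero_mul] at this
  exact h (sub_eq_zero.1 this.symm)

theorem qInt_eq_zero_iff {l : ℕ} (hl : 2 ≤ l) (hq : IsPrimitiveRoot q l) (n : ℕ) :
    qInt q n = 0 ↔ l ∣ n := by
  rw [← hq.pow_eq_one_iff_dvd]
  have h1 : q - 1 ≠ 0 := sub_ne_zero.2 (hq.ne_one (by omega))
  have h := qInt_mul_sub_one q n
  constructor
  · intro h0
    rw [h0, zero_mul] at h
    exact sub_eq_zero.1 h.symm
  · intro h0
    rw [h0, sub_self] at h
    exact (mul_eq_zero.1 h).resolve_right h1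

theorem qInt_ne_zero_of_lt {l : ℕ} (hl : 2 ≤ l) (hq : IsPrimitiveRoot q l) {n : ℕ} (hn : 1 ≤ n)
    (hnl : n < l) : qInt q n ≠ 0 := by
  rw [Ne, qInt_eq_zero_iff hl hq]
  exact fun h => absurd (Nat.le_of_dvd hn h) (by omega)

theorem qFact_ne_zero_of_lt {l : ℕ} (hl : 2 ≤ l) (hq : IsPrimitiveRoot q l) {n : ℕ}
    (hnl : n < l) : qFact q n ≠ 0 :=
  Finset.prod_ne_zero_iff.2 fun i hi => by
    rw [Finset.mem_Icc] at hi
    exact qInt_ne_zero_of_lt hl hq hi.1 (by omega)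

theorem qChoose_eq_zero {l : ℕ} (hl : 2 ≤ l) (hq : IsPrimitiveRoot q l) {i j : ℕ} (hi : 1 ≤ i)
    (hj : 1 ≤ j) (hij : i + j = l) : qChoose q i j = 0 := by
  have h := qChoose_mul_qFact q i j
  have h0 : qFact q (i + j) = 0 := by
    obtain ⟨m, rfl⟩ : ∃ m, l = m + 1 := ⟨l - 1, by omega⟩
    rw [hij, qFact_succ, (qInt_eq_zero_iff hl hq _).2 dvd_rfl, mul_zero]
  rw [h0] at h
  exact (mul_eq_zero.1 h).resolve_right
    (mul_ne_zero (qFact_ne_zero_of_lt hl hq (by omega)) (qFact_ne_zero_of_lt hl hq (by omega)))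

theorem qInt_add_of_eq_zero {m : ℕ} (n : ℕ)
    (h0 : qInt q m = 0) : qInt q (m + n) = qInt q n ∧ qInt q (n + m) = qInt q n := by
  rw [add_comm n m, qInt_add, h0, mul_zero, add_zero]
  exact ⟨rfl, rfl⟩

/-- A case of the `q`-Lucas theorem. Since `[i + 1 + l] = [i + 1]`, absorption shows that the value
does not change from `i` to `i + 1` unless `[i + 1] = 0`, that is, unless `l ∣ i + 1`; there the
Pascal rule adds `1`. -/
theorem qChoose_primitiveRoot {l : ℕ} (hl : 2 ≤ l) (hq : IsPrimitiveRoot q l) (i : ℕ) :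
    qChoose q i l = (i / l : ℕ) + 1 := by
  have hl0 : qInt q l = 0 := (qInt_eq_zero_iff hl hq _).2 dvd_rfl
  induction i with
  | zero => simp
  | succ i ih =>
    by_cases h : l ∣ i + 1
    -- Here `l ∣ i + 1`, so both factors in the absorption identity for the lower index equal `[j +
    -- 1]`, which is nonzero below `l`.
    · have key : ∀ j < l, qChoose q (i + 1) j = 1 := by
        intro j
        induction j with
        | zero => simp
        | succ j ihj =>
          intro hj
          have h1 := qChoose_absorb q j (i + 1)
          rw [qChoose_comm, qChoose_comm q j, ihj (by omega),
            (qInt_add_of_eq_zero _ ((qInt_eq_zero_iff hl hq _).2 h)).2] at h1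
          exact mul_left_cancel₀ (qInt_ne_zero_of_lt hl hq (by omega) hj) h1
      obtain ⟨m, rfl⟩ : ∃ m, l = m + 1 := ⟨l - 1, by omega⟩
      rw [qChoose_succ_succ, ih, hq.pow_eq_one, key m (by omega), Nat.succ_div, if_pos h]
      push_cast; ring
    · have h1 := qChoose_absorb q i l
      rw [(qInt_add_of_eq_zero _ hl0).2] at h1
      rw [Nat.succ_div, if_neg h, add_zero, ← ih]
      exact mul_left_cancel₀ (by rwa [Ne, qInt_eq_zero_iff hl hq]) h1

theorem qChoose_primitiveRoot_ne_zero [CharZero k] {l : ℕ} (hl : 2 ≤ l) (hq : IsPrimitiveRoot q l)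
    (i : ℕ) : qChoose q i l ≠ 0 := by
  rw [qChoose_primitiveRoot hl hq]
  exact Nat.cast_add_one_ne_zero _

/-- The two-cocycle condition for the divided power coalgebra in degree `w`, for a cochain
`∑ c i • zⁱ ⊗ z^{w-i}`. -/
def IsQCocycle (q : k) (w : ℕ) (c : ℕ → k) : Prop :=
  ∀ i j l, 1 ≤ i → 1 ≤ l → i + j + l = w → qChoose q i j * c (i + j) = qChoose q j l * c i

/-! ### Two-cocycles of the `q`-divided power coalgebra -/

namespace IsQCocycle

variable {w : ℕ} {c : ℕ → k}

theorem sub_qChoose (hc : IsQCocycle q w c) (r : k) :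
    IsQCocycle q w (fun i => c i - r * qChoose q i (w - i)) := by
  intro i j l hi hl h
  have h1 := hc i j l hi hl h
  have h2 := qChoose_assoc q i j l
  simp only [show w - (i + j) = l by omega, show w - i = j + l by omega]
  linear_combination h1 - r * h2

theorem step (hc : IsQCocycle q w c) {i : ℕ} (hi : 1 ≤ i) (hw : i + 2 ≤ w) :
    qInt q (i + 1) * c (i + 1) = qInt q (w - i) * c i := by
  have := hc i 1 (w - i - 1) hi (by omega) (by omega)
  rwa [qChoose_one_right, qChoose_one_left, show w - i - 1 + 1 = w - i by omega] at this

theorem eq_zero_of_one (hc : IsQCocycle q w c) (h1 : c 1 = 0) {n : ℕ}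
    (hn : ∀ m, 1 ≤ m → m ≤ n → qInt q m ≠ 0) {i : ℕ} (hi : 1 ≤ i) (hin : i ≤ n) (hiw : i < w) :
    c i = 0 := by
  induction i with
  | zero => omega
  | succ i ih =>
    rcases Nat.eq_zero_or_pos i with rfl | hi'
    · exact h1
    · have := hc.step hi' (by omega)
      rw [ih hi' (by omega) (by omega), mul_zero] at this
      exact (mul_eq_zero.1 this).resolve_left (hn _ (by omega) hin)

theorem exists_eq_of_qInt_ne_zero (hc : IsQCocycle q w c) (hw : 2 ≤ w)
    (hn : ∀ m, 1 ≤ m → m ≤ w → qInt q m ≠ 0) :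
    ∃ r, ∀ i, 1 ≤ i → i < w → c i = r * qChoose q i (w - i) := by
  -- Since `qChoose q 1 (w - 1) = [w]`, this multiple of the coboundary agrees with `c` at `1`.
  refine ⟨c 1 / qInt q w, fun i hi hiw => ?_⟩
  have h := (hc.sub_qChoose (c 1 / qInt q w)).eq_zero_of_one (n := w) ?_ hn hi hiw.le hiw
  · exact sub_eq_zero.1 h
  · rw [qChoose_one_left, show w - 1 + 1 = w by omega, div_mul_cancel₀ _ (hn w (by omega) le_rfl),
      sub_self]

/-- The condition at `i - l, l, w - i` determines `c i` from `c (i - l)`: its factor `qChoose q (i -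
l) l` is a positive integer, hence nonzero in characteristic zero. -/
theorem eq_zero_of_le [CharZero k] {l : ℕ} (hl : 2 ≤ l) (hq : IsPrimitiveRoot q l)
    (hc : IsQCocycle q w c) (h0 : ∀ i, 1 ≤ i → i ≤ l → i < w → c i = 0) {i : ℕ} (hi : 1 ≤ i)
    (hiw : i < w) : c i = 0 := by
  induction i using Nat.strong_induction_on with
  | _ i ih =>
    by_cases hil : i ≤ l
    · exact h0 i hi hil hiw
    · have := hc (i - l) l (w - i) (by omega) (by omega) (by omega)
      rw [ih (i - l) (by omega) (by omega) (by omega), mul_zero,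
        show i - l + l = i by omega] at this
      exact (mul_eq_zero.1 this).resolve_left (qChoose_primitiveRoot_ne_zero hl hq _)

/-- By `eq_zero_of_le` only the values up to `l` matter. The coboundary is normalised where its
coefficient is nonzero: at `l` if `l ∣ w`, because then `[w] = 0`, and at `1` otherwise. -/
theorem exists_eq_of_primitiveRoot [CharZero k] {l : ℕ} (hl : 2 ≤ l) (hq : IsPrimitiveRoot q l)
    (hc : IsQCocycle q w c) (hw : l + 2 ≤ w) :
    ∃ r, ∀ i, 1 ≤ i → i < w → c i = r * qChoose q i (w - i) := by
  suffices H : ∃ r, ∀ i, 1 ≤ i → i ≤ l → i < w → c i - r * qChoose q i (w - i) = 0 by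
    obtain ⟨r, hr⟩ := H
    exact ⟨r, fun i hi hiw => sub_eq_zero.1 ((hc.sub_qChoose r).eq_zero_of_le hl hq hr hi hiw)⟩
  by_cases hlw : l ∣ w
  · have hne : qChoose q l (w - l) ≠ 0 := by
      rw [qChoose_comm]
      exact qChoose_primitiveRoot_ne_zero hl hq _
    refine ⟨c l / qChoose q l (w - l), ?_⟩
    have hd := hc.sub_qChoose (c l / qChoose q l (w - l))
    generalize hd' : (fun i => c i - c l / qChoose q l (w - l) * qChoose q i (w - i)) = d at hd
    have hdl : d l = 0 := by
      rw [← hd']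
      simp only
      rw [div_mul_cancel₀ _ hne, sub_self]
    -- Descent from `l`: in `step` the factor of the lower value is `[w - l + m + 1] = [m + 1]`,
    -- which is nonzero.
    have key : ∀ m, m < l → d (l - m) = 0 := by
      intro m
      induction m with
      | zero => intro _; exact hdl
      | succ m ih =>
        intro hm
        have h := hd.step (i := l - (m + 1)) (by omega) (by omega)
        rw [show l - (m + 1) + 1 = l - m by omega, ih (by omega), mul_zero] at h
        refine (mul_eq_zero.1 h.symm).resolve_left ?_
        rw [show w - (l - (m + 1)) = (w - l) + (m + 1) by omega]
        have hd1 : l ∣ w - l := Nat.dvd_sub hlw dvd_rfl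
        rw [(qInt_add_of_eq_zero _ ((qInt_eq_zero_iff hl hq _).2 hd1)).1]
        exact qInt_ne_zero_of_lt hl hq (by omega) hm
    intro i hi hil _
    have := key (l - i) (by omega)
    rwa [show l - (l - i) = i by omega, ← hd'] at this
  · have hne : qInt q w ≠ 0 := by rwa [Ne, qInt_eq_zero_iff hl hq]
    refine ⟨c 1 / qInt q w, ?_⟩
    have hd := hc.sub_qChoose (c 1 / qInt q w)
    generalize hd' : (fun i => c i - c 1 / qInt q w * qChoose q i (w - i)) = d at hd
    have hd1 : d 1 = 0 := by
      rw [← hd']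
      simp only
      rw [qChoose_one_left, show w - 1 + 1 = w by omega, div_mul_cancel₀ _ hne, sub_self]
    have hlt : ∀ i, 1 ≤ i → i ≤ l - 1 → i < w → d i = 0 := fun i hi hil hiw =>
      hd.eq_zero_of_one hd1 (fun m hm hml => qInt_ne_zero_of_lt hl hq hm (by omega)) hi hil hiw
    intro i hi hil hiw
    suffices h : d i = 0 by rwa [← hd'] at h
    rcases Nat.lt_or_ge i l with h | h
    · exact hlt i hi (by omega) hiw
    · obtain rfl : i = l := le_antisymm hil h
      -- `step` into degree `l` has the factor `[l] = 0`. The value at `l + 1` is obtained from the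
      -- value at `1` instead, and `step` is then read backwards; this needs `l + 2 ≤ w`.
      have h1 := hd 1 i (w - i - 1) le_rfl (by omega) (by omega)
      rw [hd1, mul_zero] at h1
      have h2 : d (i + 1) = 0 := by
        rw [add_comm]
        refine (mul_eq_zero.1 h1).resolve_left ?_
        rw [qChoose_comm, qChoose_one_right]
        have := (qInt_add_of_eq_zero 1 ((qInt_eq_zero_iff hl hq i).2 dvd_rfl)).1
        rw [this, qInt_one]
        exact one_ne_zero
      have h3 := hd.step hi (by omega)
      rw [h2, mul_zero] at h3
      refine (mul_eq_zero.1 h3.symm).resolve_left ?_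
      rw [qInt_eq_zero_iff hl hq]
      exact fun h => hlw ((Nat.dvd_sub_iff_left hiw.le dvd_rfl).1 h)

/-- The condition at `1, i - 1, l - i` expresses `[i] c i` through `c 1`. So the cocycles of degree
`l` are the multiples of the coefficients of `[z]^l`. -/
theorem eq_of_primitiveRoot {l : ℕ} (hl : 2 ≤ l) (hq : IsPrimitiveRoot q l)
    (hc : IsQCocycle q l c) {i : ℕ} (hi : 1 ≤ i) (hil : i < l) :
    c i = c 1 * (qFact q (l - 1) / (qFact q i * qFact q (l - i))) := by
  have h := hc 1 (i - 1) (l - i) le_rfl (by omega) (by omega)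
  have h1 := qChoose_mul_qFact q (i - 1) (l - i)
  rw [qChoose_one_left, show i - 1 + 1 = i by omega, show 1 + (i - 1) = i by omega] at h
  rw [show i - 1 + (l - i) = l - 1 by omega] at h1
  have h2 := qFact_succ q (i - 1)
  rw [show i - 1 + 1 = i by omega] at h2
  have n1 := qFact_ne_zero_of_lt hl hq (n := i - 1) (by omega)
  have n2 := qFact_ne_zero_of_lt hl hq (n := l - i) (by omega)
  have n3 := qInt_ne_zero_of_lt hl hq hi hil
  rw [h2, ← h1]
  field_simp
  linear_combination h

/-- Strictly between `1` and `l` both the cocycle and the binomials vanish. The values at `1` and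
`l` are left, where the binomials equal `[l + 1] = 1`. -/
theorem exists_eq_of_primitiveRoot_succ {l : ℕ} (hl : 2 ≤ l) (hq : IsPrimitiveRoot q l)
    (hc : IsQCocycle q (l + 1) c) :
    ∃ r s, ∀ i, 1 ≤ i → i < l + 1 →
      c i = r * qChoose q i (l + 1 - i) + if i = 1 then s else 0 := by
  have hl0 := (qInt_eq_zero_iff hl hq l).2 dvd_rfl
  have hl1 : qInt q (l + 1) = 1 := by
    rw [(qInt_add_of_eq_zero 1 hl0).1, qInt_one]
  refine ⟨c l, c 1 - c l, fun i hi hil => ?_⟩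
  rcases eq_or_ne i 1 with rfl | hi1
  · rw [if_pos rfl, qChoose_one_left, show l + 1 - 1 + 1 = l + 1 by omega, hl1]; ring
  rw [if_neg hi1, add_zero]
  rcases Nat.lt_or_ge i l with h | h
  · have h1 : c i = 0 := by
      have := hc 1 (i - 1) (l + 1 - i) le_rfl (by omega) (by omega)
      rw [qChoose_eq_zero hl hq (i := i - 1) (by omega) (by omega) (by omega), zero_mul,
        qChoose_one_left, show i - 1 + 1 = i by omega, show 1 + (i - 1) = i by omega] at this
      exact (mul_eq_zero.1 this).resolve_left (qInt_ne_zero_of_lt hl hq hi h)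
    have h2 : qChoose q i (l + 1 - i) = 0 := by
      have := qChoose_absorb q (i - 1) (l + 1 - i)
      rw [show i - 1 + 1 = i by omega, qChoose_eq_zero hl hq (i := i - 1) (by omega) (by omega)
        (by omega), mul_zero] at this
      exact (mul_eq_zero.1 this).resolve_left (qInt_ne_zero_of_lt hl hq hi h)
    rw [h1, h2, mul_zero]
  · obtain rfl : i = l := by omega
    rw [show i + 1 - i = 1 by omega, qChoose_one_right, hl1, mul_one]

end IsQCocycle

theorem isQCocycle_qFact {l : ℕ} (hl : 2 ≤ l) (hq : IsPrimitiveRoot q l) :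
    IsQCocycle q l (fun i => qFact q (l - 1) / (qFact q i * qFact q (l - i))) := by
  intro i j m hi hm h
  have h1 := qChoose_mul_qFact q i j
  have h2 := qChoose_mul_qFact q j m
  have n1 := qFact_ne_zero_of_lt hl hq (n := i) (by omega)
  have n2 := qFact_ne_zero_of_lt hl hq (n := i + j) (by omega)
  have n3 := qFact_ne_zero_of_lt hl hq (n := j + m) (by omega)
  have n4 := qFact_ne_zero_of_lt hl hq (n := m) (by omega)
  have n5 := qFact_ne_zero_of_lt hl hq (n := j) (by omega)
  simp only
  rw [show l - (i + j) = m by omega, show l - i = j + m by omega]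
  field_simp
  apply mul_right_cancel₀ n5
  linear_combination qFact q (l - 1) * qFact q (j + m) * h1
    - qFact q (l - 1) * qFact q (i + j) * h2

/-- If `[w] ≠ 0`, then the binomial at `1, w - 1` is `[w]`. Otherwise the order `m` of `q` is a
proper divisor of `w`, and the binomial at `w - m, m` is a positive integer in characteristic zero.
-/
theorem exists_qChoose_ne_zero {w : ℕ} (hw : 2 ≤ w)
    (hchar : (∃ n : ℕ, 0 < n ∧ q ^ n = 1) → CharZero k) (hwq : ¬ IsPrimitiveRoot q w) :
    ∃ i j, 1 ≤ i ∧ 1 ≤ j ∧ i + j = w ∧ qChoose q i j ≠ 0 := by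
  by_cases h0 : qInt q w = 0
  · have hw1 : q ^ w = 1 := by
      by_contra h
      exact qInt_ne_zero_of_pow_ne_one h h0
    have := hchar ⟨w, by omega, hw1⟩
    have hq := IsPrimitiveRoot.orderOf q
    have hdvd := orderOf_dvd_of_pow_eq_one hw1
    have hpos : 0 < orderOf q := Nat.pos_of_dvd_of_pos hdvd (by omega)
    -- For `q = 1` one has `[w] = w`, which is nonzero in characteristic zero.
    have hne : orderOf q ≠ 1 := by
      intro h
      rw [orderOf_eq_one_iff] at h
      rw [h] at h0
      simp only [qInt, one_pow, Finset.sum_const, Finset.card_range, nsmul_eq_mul, mul_one,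
        Nat.cast_eq_zero] at h0
      omega
    have hnw : orderOf q ≠ w := fun h => hwq (h ▸ hq)
    have := Nat.le_of_dvd (by omega) hdvd
    exact ⟨w - orderOf q, orderOf q, by omega, by omega, by omega,
      qChoose_primitiveRoot_ne_zero (by omega) hq _⟩
  · exact ⟨1, w - 1, le_rfl, by omega, by omega, by
      rwa [qChoose_one_left, show w - 1 + 1 = w by omega]⟩

/-- If some `[m]` with `m ≤ w` vanishes, then `q` is a primitive root of some order `l ≤ w`, and the
excluded values leave `w ≥ l + 2`. -/
theorem IsQCocycle.exists_eq {w : ℕ} {c : ℕ → k} (hc : IsQCocycle q w c) (hw : 2 ≤ w)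
    (hchar : (∃ n : ℕ, 0 < n ∧ q ^ n = 1) → CharZero k)
    (hwq : ∀ l, 2 ≤ l → IsPrimitiveRoot q l → w ≠ l ∧ w ≠ l + 1) :
    ∃ r, ∀ i, 1 ≤ i → i < w → c i = r * qChoose q i (w - i) := by
  by_cases hn : ∀ m, 1 ≤ m → m ≤ w → qInt q m ≠ 0
  · exact hc.exists_eq_of_qInt_ne_zero hw hn
  · push Not at hn
    obtain ⟨m, hm, hmw, h0⟩ := hn
    have hm1 : q ^ m = 1 := by
      by_contra h
      exact qInt_ne_zero_of_pow_ne_one h h0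
    have := hchar ⟨m, by omega, hm1⟩
    have hq := IsPrimitiveRoot.orderOf q
    have hdvd := orderOf_dvd_of_pow_eq_one hm1
    have hpos : 0 < orderOf q := Nat.pos_of_dvd_of_pos hdvd (by omega)
    have hne : orderOf q ≠ 1 := by
      intro h
      rw [orderOf_eq_one_iff] at h
      rw [h] at h0
      simp only [qInt, one_pow, Finset.sum_const, Finset.card_range, nsmul_eq_mul, mul_one,
        Nat.cast_eq_zero] at h0
      omega
    have := Nat.le_of_dvd (by omega) hdvd
    have h2 := hwq _ (by omega) hq
    exact hc.exists_eq_of_primitiveRoot (by omega) hq (by omega)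

end GaussianBinomials

namespace HopfOreExt

variable {k K H : Type*} [Field k] [Ring K] [HopfAlgebra k K] [Ring H] [HopfAlgebra k H]
variable (X : HopfOreExt k K H)

/-! ### Coefficients -/

/-- The monomial `a zⁱ`. -/
def mon (i : ℕ) : K →ₗ[k] H :=
  LinearMap.mulRight k (X.z ^ i) ∘ₗ (X.ι : K →ₗc[k] H).toLinearMap

theorem mon_apply (i : ℕ) (a : K) : X.mon i a = X.ι a * X.z ^ i := rfl

theorem mon_zero (a : K) : X.mon 0 a = X.ι a := by simp [mon_apply]

theorem mon_zero_one : X.mon 0 (1 : K) = 1 := by simp [mon_apply]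

theorem mon_one_one : X.mon 1 (1 : K) = X.z := by simp [mon_apply]

theorem mon_one_right (i : ℕ) : X.mon i (1 : K) = X.z ^ i := by simp [mon_apply]

/-- The `K`-basis `(zⁱ)` of `H`. -/
def expand : (ℕ →₀ K) ≃ₗ[k] H :=
  LinearEquiv.ofBijective (Finsupp.lsum k X.mon) X.expand_bijective

theorem expand_single (i : ℕ) (a : K) : X.expand (Finsupp.single i a) = X.mon i a := by
  change Finsupp.lsum k X.mon (Finsupp.single i a) = _
  simp

/-- The coefficient of `zⁱ`. -/
def coef (i : ℕ) : H →ₗ[k] K := Finsupp.lapply i ∘ₗ X.expand.symm.toLinearMap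

theorem coef_mon (i j : ℕ) (a : K) : X.coef i (X.mon j a) = if j = i then a else 0 := by
  rw [← expand_single]
  simp [coef, Finsupp.single_apply]

@[elab_as_elim]
theorem induction_mon {p : H → Prop} (x : H) (zero : p 0) (mon : ∀ i a, p (X.mon i a))
    (add : ∀ x y, p x → p y → p (x + y)) : p x := by
  obtain ⟨f, rfl⟩ := X.expand.surjective x
  induction f using Finsupp.induction_linear with
  | zero => rwa [map_zero]
  | add f g hf hg => rw [map_add]; exact add _ _ hf hg
  | single i a => rw [expand_single]; exact mon i a

theorem coef_ext {x y : H} (h : ∀ i, X.coef i x = X.coef i y) : x = y :=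
  X.expand.symm.injective (Finsupp.ext h)

/-- The coefficient of `zⁱ ⊗ zʲ`. -/
def coef₂ (i j : ℕ) : H ⊗[k] H →ₗ[k] K ⊗[k] K := TensorProduct.map (X.coef i) (X.coef j)

/-- The coefficient of `zⁱ ⊗ zʲ ⊗ zˡ`. -/
def coef₃ (i j l : ℕ) : H ⊗[k] (H ⊗[k] H) →ₗ[k] K ⊗[k] (K ⊗[k] K) :=
  TensorProduct.map (X.coef i) (X.coef₂ j l)

@[simp] theorem coef₂_tmul (i j : ℕ) (x y : H) :
    X.coef₂ i j (x ⊗ₜ y) = X.coef i x ⊗ₜ X.coef j y := rfl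

@[simp] theorem coef₃_tmul (i j l : ℕ) (x : H) (u : H ⊗[k] H) :
    X.coef₃ i j l (x ⊗ₜ u) = X.coef i x ⊗ₜ X.coef₂ j l u := rfl

/-- `H ⊗ H` as a free module over `K ⊗ K`. -/
def expand₂ : H ⊗[k] H ≃ₗ[k] (ℕ × ℕ →₀ K ⊗[k] K) :=
  TensorProduct.congr X.expand.symm X.expand.symm ≪≫ₗ finsuppTensorFinsupp k k K K ℕ ℕ

theorem expand₂_apply (u : H ⊗[k] H) (i j : ℕ) : X.expand₂ u (i, j) = X.coef₂ i j u := by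
  induction u using TensorProduct.induction_on with
  | zero => simp
  | tmul x y => simp [expand₂, coef]
  | add x y hx hy => rw [map_add, map_add, Finsupp.add_apply, hx, hy]

/-- `H ⊗ H ⊗ H` as a free module over `K ⊗ K ⊗ K`. -/
def expand₃ : H ⊗[k] (H ⊗[k] H) ≃ₗ[k] (ℕ × (ℕ × ℕ) →₀ K ⊗[k] (K ⊗[k] K)) :=
  TensorProduct.congr X.expand.symm X.expand₂ ≪≫ₗ
    finsuppTensorFinsupp k k K (K ⊗[k] K) ℕ (ℕ × ℕ)

theorem expand₃_apply (u : H ⊗[k] (H ⊗[k] H)) (i j l : ℕ) :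
    X.expand₃ u (i, j, l) = X.coef₃ i j l u := by
  induction u using TensorProduct.induction_on with
  | zero => simp
  | tmul x y => simp [expand₃, coef, expand₂_apply]
  | add x y hx hy => rw [map_add, map_add, Finsupp.add_apply, hx, hy]

theorem coef₂_ext {u v : H ⊗[k] H} (h : ∀ i j, X.coef₂ i j u = X.coef₂ i j v) : u = v :=
  X.expand₂.injective (Finsupp.ext fun ⟨i, j⟩ => by simp only [expand₂_apply, h])

theorem coef₃_ext {u v : H ⊗[k] (H ⊗[k] H)} (h : ∀ i j l, X.coef₃ i j l u = X.coef₃ i j l v) :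
    u = v :=
  X.expand₃.injective (Finsupp.ext fun ⟨i, j, l⟩ => by simp only [expand₃_apply, h])

/-- The monomial `a zⁱ ⊗ b zʲ`. -/
def mon₂ (i j : ℕ) : K ⊗[k] K →ₗ[k] H ⊗[k] H := TensorProduct.map (X.mon i) (X.mon j)

@[simp] theorem mon₂_tmul (i j : ℕ) (a b : K) :
    X.mon₂ i j (a ⊗ₜ b) = X.mon i a ⊗ₜ X.mon j b := rfl

theorem coef₂_mon₂ (i j r s : ℕ) (t : K ⊗[k] K) :
    X.coef₂ i j (X.mon₂ r s t) = if r = i ∧ s = j then t else 0 := by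
  induction t using TensorProduct.induction_on with
  | zero => simp
  | tmul a b =>
    by_cases h1 : r = i <;> by_cases h2 : s = j <;> simp [coef_mon, h1, h2]
  | add x y hx hy => rw [map_add, map_add, hx, hy]; split_ifs <;> simp

theorem sum_mon₂ (u : H ⊗[k] H) :
    u = (X.expand₂ u).sum fun p t => X.mon₂ p.1 p.2 t := by
  apply X.coef₂_ext
  intro i j
  rw [Finsupp.sum, map_sum]
  simp only [coef₂_mon₂]
  rw [Finset.sum_eq_single (i, j)]
  · simp [expand₂_apply]
  · rintro ⟨r, s⟩ _ h
    rw [if_neg]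
    rintro ⟨rfl, rfl⟩
    exact h rfl
  · intro h
    simpa using h

/-- The elements of `H` that involve only the powers `zⁱ` with `P i`. -/
def degIn (P : ℕ → Prop) : Submodule k H where
  carrier := {x | ∀ i, ¬ P i → X.coef i x = 0}
  zero_mem' _ _ := map_zero _
  add_mem' hx hy i hi := by rw [map_add, hx i hi, hy i hi, add_zero]
  smul_mem' c x hx i hi := by rw [map_smul, hx i hi, smul_zero]

/-- The elements of `H ⊗ H` that involve only `zⁱ ⊗ zʲ` with `P (i + j)`. -/
def degIn₂ (P : ℕ → Prop) : Submodule k (H ⊗[k] H) where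
  carrier := {x | ∀ i j, ¬ P (i + j) → X.coef₂ i j x = 0}
  zero_mem' _ _ _ := map_zero _
  add_mem' hx hy i j hi := by rw [map_add, hx i j hi, hy i j hi, add_zero]
  smul_mem' c x hx i j hi := by rw [map_smul, hx i j hi, smul_zero]

/-- The elements of `H ⊗ H ⊗ H` that involve only `zⁱ ⊗ zʲ ⊗ zˡ` with `P (i + j + l)`. -/
def degIn₃ (P : ℕ → Prop) : Submodule k (H ⊗[k] (H ⊗[k] H)) where
  carrier := {x | ∀ i j l, ¬ P (i + j + l) → X.coef₃ i j l x = 0}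
  zero_mem' _ _ _ _ := map_zero _
  add_mem' hx hy i j l hi := by rw [map_add, hx i j l hi, hy i j l hi, add_zero]
  smul_mem' c x hx i j l hi := by rw [map_smul, hx i j l hi, smul_zero]

/-! ### Supports: `P` is `≤ w` for the filtration, `= w` for the grading, `≠ w` for a complement -/

variable {P : ℕ → Prop}

theorem mon_mem_degIn {i : ℕ} (hi : P i) (a : K) : X.mon i a ∈ X.degIn P := by
  intro j hj
  rw [coef_mon, if_neg]
  rintro rfl
  exact hj hi

theorem tmul_mem_degIn₂ {i : ℕ} {x y : H} (hx : x ∈ X.degIn (· = i))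
    (hy : y ∈ X.degIn fun j => P (i + j)) : x ⊗ₜ y ∈ X.degIn₂ P := by
  intro r s h
  rw [coef₂_tmul]
  by_cases hr : r = i
  · subst hr; rw [hy s h, TensorProduct.tmul_zero]
  · rw [hx r hr, TensorProduct.zero_tmul]

theorem tmul_mem_degIn₃ {i : ℕ} {x : H} {u : H ⊗[k] H} (hx : x ∈ X.degIn (· = i))
    (hu : u ∈ X.degIn₂ fun j => P (i + j)) : x ⊗ₜ u ∈ X.degIn₃ P := by
  intro r s t h
  rw [coef₃_tmul]
  by_cases hr : r = i
  · subst hr; rw [hu s t (by rwa [add_assoc] at h), TensorProduct.tmul_zero]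
  · rw [hx r hr, TensorProduct.zero_tmul]

theorem coef₃_assoc_tmul (i j l : ℕ) (u : H ⊗[k] H) (y : H) :
    X.coef₃ i j l (TensorProduct.assoc k H H H (u ⊗ₜ y))
      = TensorProduct.assoc k K K K (X.coef₂ i j u ⊗ₜ X.coef l y) := by
  induction u using TensorProduct.induction_on with
  | zero => simp
  | tmul a b => simp
  | add a b ha hb => simp only [TensorProduct.add_tmul, map_add, ha, hb]

theorem assoc_tmul_mem_degIn₃ {i : ℕ} {u : H ⊗[k] H} {y : H}
    (hu : u ∈ X.degIn₂ fun j => P (j + i)) (hy : y ∈ X.degIn (· = i)) :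
    TensorProduct.assoc k H H H (u ⊗ₜ y) ∈ X.degIn₃ P := by
  intro r s t h
  rw [coef₃_assoc_tmul]
  by_cases ht : t = i
  · subst ht; rw [hu r s h, TensorProduct.zero_tmul, map_zero]
  · rw [hy t ht, TensorProduct.tmul_zero, map_zero]

theorem mon₂_mem_degIn₂ {i j : ℕ} (h : P (i + j)) (t : K ⊗[k] K) : X.mon₂ i j t ∈ X.degIn₂ P := by
  intro r s hrs
  rw [coef₂_mon₂, if_neg]
  rintro ⟨rfl, rfl⟩
  exact hrs h

theorem degIn₂_induction {p : H ⊗[k] H → Prop} (zero : p 0)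
    (mon : ∀ i j a b, P (i + j) → p (X.mon i a ⊗ₜ X.mon j b))
    (add : ∀ x y, p x → p y → p (x + y)) {u : H ⊗[k] H} (hu : u ∈ X.degIn₂ P) : p u := by
  rw [X.sum_mon₂ u]
  refine Finset.sum_induction _ p add zero ?_
  rintro ⟨i, j⟩ hij
  rw [Finsupp.mem_support_iff, expand₂_apply] at hij
  have hP : P (i + j) := by
    by_contra h
    exact hij (hu i j h)
  simp only
  generalize X.expand₂ u (i, j) = t
  induction t using TensorProduct.induction_on with
  | zero => rwa [map_zero]
  | tmul a b => exact mon i j a b hP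
  | add x y hx hy => rw [map_add]; exact add _ _ hx hy

theorem homog_eq_degIn₂ (w : ℕ) : X.homog w = X.degIn₂ (· = w) := by
  apply le_antisymm
  · rw [homog, Submodule.span_le]
    rintro _ ⟨i, j, a, b, h, rfl⟩
    exact X.mon₂_mem_degIn₂ h (a ⊗ₜ b)
  · intro u hu
    exact X.degIn₂_induction (p := (· ∈ X.homog w)) (zero_mem _)
      (fun i j a b h => Submodule.subset_span ⟨i, j, a, b, h, rfl⟩)
      (fun x y hx hy => add_mem hx hy) hu

theorem exists_mem_degIn (x : H) : ∃ n, x ∈ X.degIn (· ≤ n) := by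
  refine ⟨(X.expand.symm x).support.sup id, fun i hi => ?_⟩
  by_contra h
  exact hi (Finset.le_sup (f := id) (Finsupp.mem_support_iff.2 h))

theorem exists_mem_degIn₂ (u : H ⊗[k] H) : ∃ n, u ∈ X.degIn₂ (· ≤ n) := by
  refine ⟨(X.expand₂ u).support.sup fun p => p.1 + p.2, fun i j hi => ?_⟩
  by_contra h
  refine hi (Finset.le_sup (f := fun p : ℕ × ℕ => p.1 + p.2) (b := (i, j))
    (Finsupp.mem_support_iff.2 ?_))
  rwa [expand₂_apply]

/-- The homogeneous component of degree `w`. -/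
def proj₂ (w : ℕ) : H ⊗[k] H →ₗ[k] H ⊗[k] H :=
  Finsupp.lsum k (fun p : ℕ × ℕ => if p.1 + p.2 = w then X.mon₂ p.1 p.2 else 0)
    ∘ₗ X.expand₂.toLinearMap

theorem coef₂_proj₂ (w i j : ℕ) (u : H ⊗[k] H) :
    X.coef₂ i j (X.proj₂ w u) = if i + j = w then X.coef₂ i j u else 0 := by
  have h : ∀ p : ℕ × ℕ, ∀ t, X.coef₂ i j
      ((if p.1 + p.2 = w then X.mon₂ p.1 p.2 else 0 : K ⊗[k] K →ₗ[k] H ⊗[k] H) t)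
      = if i + j = w then X.coef₂ i j (X.mon₂ p.1 p.2 t) else 0 := by
    rintro ⟨r, s⟩ t
    simp only
    by_cases h1 : r = i ∧ s = j
    · obtain ⟨rfl, rfl⟩ := h1
      split_ifs <;> simp
    · rw [coef₂_mon₂, if_neg h1]
      split_ifs <;> simp [coef₂_mon₂, h1]
  conv_rhs => rw [X.sum_mon₂ u]
  simp only [proj₂, LinearMap.comp_apply, LinearEquiv.coe_coe, Finsupp.lsum_apply, Finsupp.sum,
    map_sum, h]
  split_ifs <;> simp

theorem proj₂_mem (w : ℕ) (u : H ⊗[k] H) : X.proj₂ w u ∈ X.degIn₂ (· = w) := by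
  intro i j h
  rw [coef₂_proj₂, if_neg h]

theorem sub_proj₂_mem (w : ℕ) (u : H ⊗[k] H) : u - X.proj₂ w u ∈ X.degIn₂ (· ≠ w) := by
  intro i j h
  rw [map_sub, coef₂_proj₂, if_pos (not_not.1 h), sub_self]

theorem proj₂_of_mem {w : ℕ} {u : H ⊗[k] H} (hu : u ∈ X.degIn₂ (· = w)) : X.proj₂ w u = u := by
  apply X.coef₂_ext
  intro i j
  rw [coef₂_proj₂]
  split_ifs with h
  · rfl
  · rw [hu i j h]

theorem proj₂_of_mem_ne {w : ℕ} {u : H ⊗[k] H} (hu : u ∈ X.degIn₂ (· ≠ w)) : X.proj₂ w u = 0 := by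
  apply X.coef₂_ext
  intro i j
  rw [coef₂_proj₂, map_zero]
  split_ifs with h
  · exact hu i j (not_not.2 h)
  · rfl

theorem sum_proj₂ {n : ℕ} {u : H ⊗[k] H} (hu : u ∈ X.degIn₂ (· < n)) :
    ∑ w ∈ Finset.range n, X.proj₂ w u = u := by
  apply X.coef₂_ext
  intro i j
  rw [map_sum]
  simp only [coef₂_proj₂]
  rw [Finset.sum_ite_eq]
  split_ifs with h
  · rfl
  · rw [hu i j (by simpa using h)]

theorem ι₂_tmul (a b : K) : X.ι₂ (a ⊗ₜ b) = X.ι a ⊗ₜ X.ι b := rfl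

theorem ι₂_eq_mon₂ (t : K ⊗[k] K) : X.ι₂ t = X.mon₂ 0 0 t := by
  induction t using TensorProduct.induction_on with
  | zero => simp
  | tmul a b => simp [ι₂_tmul, mon_zero]
  | add x y hx hy => rw [map_add, map_add, hx, hy]

theorem coef₂_ι₂ (t : K ⊗[k] K) : X.coef₂ 0 0 (X.ι₂ t) = t := by
  rw [ι₂_eq_mon₂, coef₂_mon₂, if_pos ⟨rfl, rfl⟩]

theorem ι₂_injective : Function.Injective X.ι₂ :=
  Function.LeftInverse.injective X.coef₂_ι₂

theorem ι_injective : Function.Injective X.ι :=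
  Function.LeftInverse.injective (g := X.coef 0) fun a => by rw [← mon_zero, coef_mon, if_pos rfl]

theorem ι₂_mem_degIn₂ (t : K ⊗[k] K) : X.ι₂ t ∈ X.degIn₂ (· = 0) := by
  rw [ι₂_eq_mon₂]
  exact X.mon₂_mem_degIn₂ (P := (· = 0)) rfl t

theorem ι_mem_degIn (a : K) : X.ι a ∈ X.degIn (· = 0) := by
  rw [← mon_zero]
  exact X.mon_mem_degIn (P := (· = 0)) rfl a

theorem exists_ι_of_mem {x : H} (hx : x ∈ X.degIn (· ≤ 0)) : ∃ a, x = X.ι a := by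
  refine ⟨X.coef 0 x, X.coef_ext fun i => ?_⟩
  rw [← mon_zero, coef_mon]
  split_ifs with h
  · rw [h]
  · exact hx i (by omega)

theorem exists_ι₂_of_mem {u : H ⊗[k] H} (hu : u ∈ X.degIn₂ (· ≤ 0)) : ∃ t, u = X.ι₂ t := by
  refine ⟨X.coef₂ 0 0 u, X.coef₂_ext fun i j => ?_⟩
  rw [ι₂_eq_mon₂, coef₂_mon₂]
  split_ifs with h
  · obtain ⟨rfl, rfl⟩ := h; rfl
  · exact hu i j (by omega)

/-- The inclusion `K ⊗ K ⊗ K → H ⊗ H ⊗ H`. -/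
def ι₃ : K ⊗[k] (K ⊗[k] K) →ₗ[k] H ⊗[k] (H ⊗[k] H) :=
  TensorProduct.map (X.ι : K →ₗc[k] H).toLinearMap X.ι₂

theorem coef₃_ι₃ (t : K ⊗[k] (K ⊗[k] K)) : X.coef₃ 0 0 0 (X.ι₃ t) = t := by
  induction t using TensorProduct.induction_on with
  | zero => simp
  | tmul a b =>
    have : X.coef 0 (X.ι a) = a := by rw [← mon_zero, coef_mon, if_pos rfl]
    simp [ι₃, coef₂_ι₂, this]
  | add x y hx hy => rw [map_add, map_add, hx, hy]

theorem ι₃_injective : Function.Injective X.ι₃ :=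
  Function.LeftInverse.injective X.coef₃_ι₃

end HopfOreExt

/-- A functional that is nonzero at `v` contracts `v ⊗ w` to a nonzero multiple of `w`. -/
theorem tmul_eq_zero_imp {k V W : Type*} [Field k] [AddCommGroup V] [Module k V] [AddCommGroup W]
    [Module k W] {v : V} {w : W} (h : v ⊗ₜ[k] w = 0) : v = 0 ∨ w = 0 := by
  by_contra! h'
  obtain ⟨φ, hφ⟩ : ∃ φ : Module.Dual k V, φ v ≠ 0 := by
    by_contra! H
    exact h'.1 ((Module.forall_dual_apply_eq_zero_iff k v).1 H)
  have := congrArg ((TensorProduct.lid k W).toLinearMap ∘ₗ LinearMap.rTensor W φ) h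
  simp [hφ, h'.2] at this

namespace HopfOreExt

variable {k K H : Type*} [Field k] [Ring K] [HopfAlgebra k K] [Ring H] [HopfAlgebra k H]
variable (X : HopfOreExt k K H)

/-! ### The comultiplication in coefficients -/

open Coalgebra

theorem z_mul_mon (i : ℕ) (a : K) :
    X.z * X.mon i a = X.mon (i + 1) (X.σ a) + X.mon i (X.δ a) := by
  rw [mon_apply, ← mul_assoc, X.z_mul, add_mul, mon_apply, mon_apply, pow_succ', mul_assoc]

/-- The coefficient of `zⁱ` in `x z`. -/
def coefPred : ℕ → H →ₗ[k] K
  | 0 => 0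
  | i + 1 => X.coef i

@[simp] theorem coefPred_zero : X.coefPred 0 = 0 := rfl

@[simp] theorem coefPred_succ (i : ℕ) : X.coefPred (i + 1) = X.coef i := rfl

theorem coef_z_mul (i : ℕ) (x : H) :
    X.coef i (X.z * x) = X.σ (X.coefPred i x) + X.δ (X.coef i x) := by
  induction x using X.induction_mon with
  | zero => simp
  | mon j a =>
    rw [z_mul_mon, map_add, coef_mon, coef_mon, coef_mon]
    congr 1
    · cases i with
      | zero => simp
      | succ i => rw [coefPred_succ, coef_mon]; simp [apply_ite X.σ]
    · split_ifs <;> simp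
  | add x y hx hy => rw [mul_add, map_add, hx, hy]; simp only [map_add]; abel

theorem coef_ι_mul (i : ℕ) (a : K) (x : H) : X.coef i (X.ι a * x) = a * X.coef i x := by
  induction x using X.induction_mon with
  | zero => simp
  | mon j b =>
    have : X.ι a * X.mon j b = X.mon j (a * b) := by
      rw [mon_apply, mon_apply, map_mul, mul_assoc]
    rw [this, coef_mon, coef_mon]
    split_ifs <;> simp
  | add x y hx hy => rw [mul_add, map_add, hx, hy, map_add, mul_add]

theorem coef₂_ι₂_mul (i j : ℕ) (t : K ⊗[k] K) (u : H ⊗[k] H) :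
    X.coef₂ i j (X.ι₂ t * u) = t * X.coef₂ i j u := by
  induction t using TensorProduct.induction_on with
  | zero => simp
  | add x y hx hy => rw [map_add, add_mul, map_add, hx, hy, add_mul]
  | tmul a b =>
    induction u using TensorProduct.induction_on with
    | zero => simp
    | add x y hx hy => rw [mul_add, map_add, hx, hy, map_add, mul_add]
    | tmul x y =>
      rw [ι₂_tmul, Algebra.TensorProduct.tmul_mul_tmul, coef₂_tmul, coef_ι_mul, coef_ι_mul,
        coef₂_tmul, Algebra.TensorProduct.tmul_mul_tmul]

/-- Moving `z` past a coefficient, on the left for `z ⊗ 1` and on the right for `e ⊗ z`, produces a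
`σ` term that raises the degree and a `δ` term that does not; nor does `z₀`. Hence only `σ` and `e`
affect top degrees. -/
theorem coef₂_comul_z_mul (i j : ℕ) (u : H ⊗[k] H) :
    X.coef₂ i j (comul (R := k) X.z * u) =
      TensorProduct.map X.σ.toLinearMap LinearMap.id
        (TensorProduct.map (X.coefPred i) (X.coef j) u)
      + TensorProduct.map X.δ LinearMap.id (X.coef₂ i j u)
      + (X.e ⊗ₜ 1) * (TensorProduct.map LinearMap.id X.σ.toLinearMap
        (TensorProduct.map (X.coef i) (X.coefPred j) u)
          + TensorProduct.map LinearMap.id X.δ (X.coef₂ i j u))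
      + X.z₀ * X.coef₂ i j u := by
  have h : comul (R := k) X.z = X.z ⊗ₜ[k] (1 : H) + X.ι X.e ⊗ₜ[k] X.z + X.ι₂ X.z₀ := X.comul_z
  rw [h, add_mul, add_mul, map_add, map_add, coef₂_ι₂_mul]
  congr 1
  induction u using TensorProduct.induction_on with
  | zero => simp
  | add x y hx hy =>
    simp only [mul_add, map_add] at hx hy ⊢
    rw [add_add_add_comm, hx, hy]
    abel
  | tmul x y =>
    simp only [Algebra.TensorProduct.tmul_mul_tmul, coef₂_tmul, coef_z_mul, coef_ι_mul,
      TensorProduct.map_tmul, TensorProduct.add_tmul, TensorProduct.tmul_add, mul_add, one_mul,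
      LinearMap.id_apply, AlgEquiv.toLinearMap_apply]

theorem comul_ι (a : K) : comul (R := k) (X.ι a) = X.ι₂ (comul (R := k) a) := by
  have := LinearMap.congr_fun (X.ι : K →ₗc[k] H).map_comp_comul a
  exact this.symm

theorem counit_ι (a : K) : counit (R := k) (X.ι a) = counit (R := k) a :=
  CoalgHomClass.counit_comp_apply X.ι a

theorem δ_one : X.δ 1 = 0 := by
  have := X.δ_mul 1 1
  simpa using this

theorem map_coefPred_ι₂ (t : K ⊗[k] K) :
    TensorProduct.map (X.coefPred 1) (X.coef 0) (X.ι₂ t) = t := by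
  exact X.coef₂_ι₂ t

/-- Compare the coefficients of `z ⊗ 1` in `Δ(z) Δ(a) = Δ(σ(a) z + δ(a))`. -/
theorem comul_σ (a : K) : comul (R := k) (X.σ a) =
    TensorProduct.map X.σ.toLinearMap LinearMap.id (comul (R := k) a) := by
  have h := congrArg (fun x => X.coef₂ 1 0 (comul (R := k) x)) (X.z_mul a)
  simp only [Bialgebra.comul_mul, map_add, comul_ι, coef₂_comul_z_mul, coef₂_ι₂_mul] at h
  have h0 : ∀ t : K ⊗[k] K, X.coef₂ 1 0 (X.ι₂ t) = 0 := fun t =>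
    X.ι₂_mem_degIn₂ t 1 0 (by simp)
  have hz : comul (R := k) X.z = X.z ⊗ₜ[k] (1 : H) + X.ι X.e ⊗ₜ[k] X.z + X.ι₂ X.z₀ := X.comul_z
  have h1 : X.coef₂ 1 0 (comul (R := k) X.z) = 1 := by
    rw [hz, map_add, map_add, h0, ← X.mon_one_one, ← X.mon_zero_one, ← X.mon_zero]
    simp [coef_mon, Algebra.TensorProduct.one_def]
  rw [h0, h0, h1, map_coefPred_ι₂] at h
  simpa only [map_zero, mul_zero, add_zero, coefPred_zero, TensorProduct.map_zero_right,
    LinearMap.zero_apply, mul_one] using h.symm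

/-- By `comul_σ`, `Δ(σ(e)) = σ(e) ⊗ e`; apply the counit on the left. -/
theorem σ_e : X.σ X.e = X.q • X.e := by
  have h := X.comul_σ X.e
  rw [X.e_groupLike.comul_eq_tmul_self] at h
  have h1 := congrArg ((TensorProduct.lid k K).toLinearMap ∘ₗ LinearMap.rTensor K counit) h
  simp only [LinearMap.comp_apply] at h1
  rw [Coalgebra.rTensor_counit_comul] at h1
  simpa [q] using h1

theorem e_ne_zero : X.e ≠ 0 := X.e_groupLike.ne_zero

theorem q_ne_zero : X.q ≠ 0 := by
  intro h
  have h1 := X.σ_e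
  rw [h, zero_smul] at h1
  exact X.e_ne_zero (X.σ.injective (by rw [h1, map_zero]))

theorem σ_e_pow (n : ℕ) : X.σ (X.e ^ n) = X.q ^ n • X.e ^ n := by
  rw [map_pow, σ_e, smul_pow]

theorem e_pow_groupLike (n : ℕ) : IsGroupLikeElem k (X.e ^ n) := X.e_groupLike.pow

theorem q_pow_eq_of_e_pow_eq {m n : ℕ} (h : X.e ^ m = X.e ^ n) : X.q ^ m = X.q ^ n := by
  have h1 := X.σ_e_pow m
  rw [h, σ_e_pow] at h1
  exact (smul_left_injective k (X.e_pow_groupLike n).ne_zero h1).symm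

/-- The conditions under which `H` is graded by the powers of `z` as a coalgebra. -/
structure IsGraded : Prop where
  z₀_eq_zero : X.z₀ = 0
  δ_e : X.δ X.e = 0

variable {X} in
theorem IsGraded.δ_e_pow (h : X.IsGraded) (n : ℕ) : X.δ (X.e ^ n) = 0 := by
  induction n with
  | zero => rw [pow_zero, δ_one]
  | succ n ih => rw [pow_succ', X.δ_mul, ih, h.δ_e, mul_zero, zero_mul, add_zero]

theorem isGraded (h0 : X.z₀ = 0) (h : X.z * X.ι X.e = X.q • (X.ι X.e * X.z)) : X.IsGraded := by
  refine ⟨h0, X.ι_injective ?_⟩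
  rw [X.z_mul, σ_e, map_smul, smul_mul_assoc, add_eq_left] at h
  rw [h, map_zero]

/-- The `q`-binomial theorem for `z ⊗ 1` and `e ⊗ z`, valid in top degree for every Hopf Ore
extension. In the graded case there are no lower terms. -/
theorem coef₂_comul_z_pow (n : ℕ) :
    (∀ i j, n < i + j → X.coef₂ i j (comul (R := k) X.z ^ n) = 0) ∧
    (∀ i j, i + j = n → X.coef₂ i j (comul (R := k) X.z ^ n)
      = qChoose X.q i j • ((X.e ^ j) ⊗ₜ[k] (1 : K))) ∧
    (X.IsGraded → ∀ i j, i + j < n → X.coef₂ i j (comul (R := k) X.z ^ n) = 0) := by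
  induction n with
  | zero =>
    have h1 : (1 : H ⊗[k] H) = X.mon₂ 0 0 (1 ⊗ₜ 1) := by
      rw [mon₂_tmul, mon_zero_one, Algebra.TensorProduct.one_def]
    refine ⟨fun i j h => ?_, fun i j h => ?_, fun _ i j h => absurd h (Nat.not_lt_zero _)⟩
    · rw [pow_zero, h1, coef₂_mon₂, if_neg (by omega)]
    · obtain ⟨rfl, rfl⟩ : i = 0 ∧ j = 0 := by omega
      rw [pow_zero, h1, coef₂_mon₂]
      simp
  | succ n ih =>
    obtain ⟨ih1, ih2, ih3⟩ := ih
    rw [pow_succ']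
    generalize comul (R := k) X.z ^ n = D at ih1 ih2 ih3 ⊢
    have hD1 : ∀ i j, n + 1 < i + j → TensorProduct.map (X.coefPred i) (X.coef j) D = 0 := by
      rintro (_ | i) j h
      · simp
      · exact ih1 i j (by omega)
    have hD2 : ∀ i j, n + 1 < i + j → TensorProduct.map (X.coef i) (X.coefPred j) D = 0 := by
      rintro i (_ | j) h
      · simp
      · exact ih1 i j (by omega)
    refine ⟨fun i j h => ?_, fun i j h => ?_, fun hg i j h => ?_⟩
    · rw [coef₂_comul_z_mul, hD1 i j h, hD2 i j h, ih1 i j (by omega)]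
      simp
    · rw [coef₂_comul_z_mul, ih1 i j (by omega)]
      have hp : ∀ m, X.e ^ (m + 1) = X.e * X.e ^ m := fun m => pow_succ' _ _
      rcases i with _ | i <;> rcases j with _ | j
      · omega
      · have h1 := ih2 0 j (by omega)
        rw [coef₂] at h1
        simp [h1, hp]
      · have h1 := ih2 i 0 (by omega)
        rw [coef₂] at h1
        simp [h1]
      -- The two contributions are the two terms of the Pascal rule; the factor `q ^ (j + 1)` comes
      -- from `σ(e^{j+1})`.
      · have h1 := ih2 i (j + 1) (by omega)
        have h2 := ih2 (i + 1) j (by omega)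
        rw [coef₂] at h1 h2
        rw [coefPred_succ, coefPred_succ, h1, h2, qChoose_succ_succ]
        simp only [map_smul, TensorProduct.map_tmul, AlgEquiv.toLinearMap_apply, σ_e_pow,
          LinearMap.id_apply, map_one, map_zero, add_zero, mul_zero, mul_smul_comm,
          Algebra.TensorProduct.tmul_mul_tmul, one_mul, ← hp, add_smul]
        rw [TensorProduct.smul_tmul', smul_smul, mul_comm (X.q ^ (j + 1)),
          ← TensorProduct.smul_tmul']
    · have hD3 : TensorProduct.map (X.coefPred i) (X.coef j) D = 0 := by
        rcases i with _ | i
        · simp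
        · exact ih3 hg i j (by omega)
      have hD4 : TensorProduct.map (X.coef i) (X.coefPred j) D = 0 := by
        rcases j with _ | j
        · simp
        · exact ih3 hg i j (by omega)
      rw [coef₂_comul_z_mul, hD3, hD4, hg.z₀_eq_zero]
      -- Only degree `n` can still contribute, through `δ(e^j)` and `δ(1)`, and both are zero.
      rcases Nat.lt_succ_iff_lt_or_eq.1 h with h' | h'
      · rw [ih3 hg i j h']; simp
      · rw [ih2 i j h']; simp [hg.δ_e_pow, δ_one]

/-- The map `a ↦ Δ(a) (eʲ ⊗ 1)`. -/
def comulE (j : ℕ) : K →ₗ[k] K ⊗[k] K :=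
  LinearMap.mulRight k ((X.e ^ j) ⊗ₜ[k] (1 : K)) ∘ₗ comul

theorem comulE_apply (j : ℕ) (a : K) :
    X.comulE j a = comul (R := k) a * ((X.e ^ j) ⊗ₜ[k] (1 : K)) := rfl

theorem comulE_zero : X.comulE 0 = comul := by
  ext a
  rw [comulE_apply, pow_zero, ← Algebra.TensorProduct.one_def, mul_one]

theorem comulE_e_pow (j m : ℕ) : X.comulE j (X.e ^ m) = (X.e ^ (m + j)) ⊗ₜ (X.e ^ m) := by
  rw [comulE_apply, (X.e_pow_groupLike m).comul_eq_tmul_self,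
    Algebra.TensorProduct.tmul_mul_tmul, pow_add, mul_one]

theorem comulE_one (j : ℕ) : X.comulE j 1 = (X.e ^ j) ⊗ₜ 1 := by
  simpa using X.comulE_e_pow j 0

theorem lid_rTensor_comulE (j : ℕ) (a : K) :
    TensorProduct.lid k K (LinearMap.rTensor K counit (X.comulE j a)) = a := by
  have h : ∀ t : K ⊗[k] K, TensorProduct.lid k K (LinearMap.rTensor K counit
      (t * ((X.e ^ j) ⊗ₜ[k] (1 : K)))) = TensorProduct.lid k K (LinearMap.rTensor K counit t) := by
    intro t
    induction t using TensorProduct.induction_on with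
    | zero => simp
    | tmul a b => simp [(X.e_pow_groupLike j).counit_eq_one, Bialgebra.counit_mul]
    | add x y hx hy => rw [add_mul, map_add, map_add, hx, hy, map_add, map_add]
  rw [comulE_apply, h, Coalgebra.rTensor_counit_comul]
  simp

theorem rid_lTensor_comulE (j : ℕ) (a : K) :
    TensorProduct.rid k K (LinearMap.lTensor K counit (X.comulE j a)) = a * X.e ^ j := by
  have h : ∀ t : K ⊗[k] K, TensorProduct.rid k K (LinearMap.lTensor K counit
      (t * ((X.e ^ j) ⊗ₜ[k] (1 : K))))
        = TensorProduct.rid k K (LinearMap.lTensor K counit t) * X.e ^ j := by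
    intro t
    induction t using TensorProduct.induction_on with
    | zero => simp
    | tmul a b => simp
    | add x y hx hy => rw [add_mul, map_add, map_add, hx, hy, map_add, map_add, add_mul]
  rw [comulE_apply, h, Coalgebra.lTensor_counit_comul]
  simp

theorem comul_mon (r : ℕ) (a : K) :
    comul (R := k) (X.mon r a) = X.ι₂ (comul (R := k) a) * comul (R := k) X.z ^ r := by
  rw [mon_apply, Bialgebra.comul_mul, comul_ι, Bialgebra.comul_pow]

theorem coef₂_comul_mon {i j r : ℕ} (h : i + j = r) (a : K) :
    X.coef₂ i j (comul (R := k) (X.mon r a)) = qChoose X.q i j • X.comulE j a := by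
  rw [comul_mon, coef₂_ι₂_mul, (X.coef₂_comul_z_pow r).2.1 i j h, mul_smul_comm, comulE_apply]

theorem comul_mon_mem {P : ℕ → Prop} {r : ℕ} (h : ∀ m ≤ r, P m) (a : K) :
    comul (R := k) (X.mon r a) ∈ X.degIn₂ P := by
  intro i j hij
  rw [comul_mon, coef₂_ι₂_mul, (X.coef₂_comul_z_pow r).1 i j, mul_zero]
  by_contra h'
  exact hij (h _ (by omega))

variable {X} in
theorem IsGraded.comul_mon_mem (hg : X.IsGraded) {P : ℕ → Prop} {r : ℕ} (h : P r) (a : K) :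
    comul (R := k) (X.mon r a) ∈ X.degIn₂ P := by
  intro i j hij
  rw [comul_mon, coef₂_ι₂_mul]
  rcases lt_trichotomy (i + j) r with h' | h' | h'
  · rw [(X.coef₂_comul_z_pow r).2.2 hg i j h', mul_zero]
  · exact absurd (h' ▸ h) hij
  · rw [(X.coef₂_comul_z_pow r).1 i j h', mul_zero]

/-- The set of degrees `P` is stable under the comultiplication. -/
def Stable (P : ℕ → Prop) : Prop :=
  ∀ r, P r → ∀ a, comul (R := k) (X.mon r a) ∈ X.degIn₂ P

theorem stable_le (n : ℕ) : X.Stable (· ≤ n) := fun _ hr a =>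
  X.comul_mon_mem (fun _ hm => hm.trans hr) a

variable {X} in
theorem IsGraded.stable (hg : X.IsGraded) (P : ℕ → Prop) : X.Stable P := fun _ hr a =>
  hg.comul_mon_mem hr a

theorem coef₂_comul {i j w : ℕ} (h : i + j = w) {x : H} (hx : x ∈ X.degIn (· ≤ w)) :
    X.coef₂ i j (comul (R := k) x) = qChoose X.q i j • X.comulE j (X.coef w x) := by
  obtain ⟨f, rfl⟩ := X.expand.surjective x
  have hf : ∀ r, w < r → f r = 0 := by
    intro r hr
    have := hx r (by omega)
    simpa [coef] using this
  have hfw : X.coef w (X.expand f) = f w := by simp [coef]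
  rw [hfw, ← f.sum_single, Finsupp.sum, map_sum, map_sum, map_sum, Finset.sum_congr rfl
    (g := fun r => if r = w then qChoose X.q i j • X.comulE j (f w) else 0)]
  · rw [Finset.sum_ite_eq']
    split_ifs with hw
    · congr 2
      simp [Finsupp.single_apply]
    · rw [Finsupp.notMem_support_iff] at hw
      simp [Finsupp.single_apply, hw]
  · intro r hr
    rw [expand_single]
    split_ifs with hrw
    · subst hrw
      exact X.coef₂_comul_mon h _
    · have : r < w := by
        by_contra h'
        exact (Finsupp.mem_support_iff.1 hr) (hf r (by omega))
      exact X.comul_mon_mem (P := (· ≤ r)) (fun _ h => h) _ i j (by omega)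

/-- Every grouplike element of `H` comes from `K`. -/
theorem isGroupLikeElem_iff (x : H) :
    IsGroupLikeElem k x ↔ ∃ g : K, IsGroupLikeElem k g ∧ X.ι g = x := by
  constructor
  · intro hx
    suffices h : ∀ n, x ∈ X.degIn (· ≤ n) → x ∈ X.degIn (· ≤ 0) by
      obtain ⟨n, hn⟩ := X.exists_mem_degIn x
      obtain ⟨g, rfl⟩ := X.exists_ι_of_mem (h n hn)
      refine ⟨g, ⟨?_, ?_⟩, rfl⟩
      · rw [← counit_ι X, hx.counit_eq_one]
      · apply X.ι₂_injective
        rw [← comul_ι, hx.comul_eq_tmul_self, ι₂_tmul]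
    intro n
    induction n with
    | zero => exact id
    | succ n ih =>
      intro hn
      apply ih
      -- `Δ(x)` has degree at most `n + 1 < 2n + 2`, while for grouplike `x` this coefficient is the
      -- tensor square of the leading coefficient.
      have h1 : X.coef₂ (n + 1) (n + 1) (comul (R := k) x) = 0 := by
        have := X.coef₂_comul (i := n + 1) (j := n + 1) (w := n + 1 + (n + 1)) rfl (x := x)
          (fun i hi => hn i (by omega))
        rw [this, hn _ (by omega), map_zero, smul_zero]
      rw [hx.comul_eq_tmul_self, coef₂_tmul] at h1
      have h2 : X.coef (n + 1) x = 0 := by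
        exact (or_self_iff).1 (tmul_eq_zero_imp h1)
      intro i hi
      rcases eq_or_ne i (n + 1) with rfl | h
      · exact h2
      · exact hn i (by omega)
  · rintro ⟨g, hg, rfl⟩
    exact hg.map X.ι

end HopfOreExt

/-! ### Identities for the differentials of a coalgebra -/

section Coalgebra

open Coalgebra

variable {k C : Type*} [Field k] [AddCommGroup C] [Module k C] [Coalgebra k C]

theorem primD1_apply (g h c : C) :
    primD1 k g h c = g ⊗ₜ c - comul (R := k) c + c ⊗ₜ h := rfl

theorem primD2_apply (g h : C) (u : C ⊗[k] C) :
    primD2 k g h u = g ⊗ₜ u - TensorProduct.assoc k C C C (LinearMap.rTensor C comul u)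
      + LinearMap.lTensor C comul u
      - LinearMap.lTensor C ((TensorProduct.mk k C C).flip h) u := rfl

theorem assoc_tmul_eq_lTensor_flip {V : Type*} [AddCommGroup V] [Module k V] (t : V ⊗[k] V)
    (h : V) : TensorProduct.assoc k V V V (t ⊗ₜ h)
      = LinearMap.lTensor V ((TensorProduct.mk k V V).flip h) t := by
  induction t using TensorProduct.induction_on with
  | zero => simp
  | tmul x y => simp
  | add x y hx hy => rw [TensorProduct.add_tmul, map_add, hx, hy, map_add]

theorem primD2_primD1 {g h : C} (hg : IsGroupLikeElem k g) (hh : IsGroupLikeElem k h) (c : C) :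
    primD2 k g h (primD1 k g h c) = 0 := by
  have h1 : TensorProduct.assoc k C C C (LinearMap.rTensor C comul (comul (R := k) c))
      = LinearMap.lTensor C comul (comul (R := k) c) := Coalgebra.coassoc_apply c
  rw [primD2_apply, primD1_apply]
  simp only [map_add, map_sub, TensorProduct.tmul_add, TensorProduct.tmul_sub,
    LinearMap.rTensor_tmul, LinearMap.lTensor_tmul, hg.comul_eq_tmul_self, hh.comul_eq_tmul_self,
    h1, assoc_tmul_eq_lTensor_flip, LinearMap.flip_apply, TensorProduct.mk_apply]
  abel

/-- A signed Leibniz rule. The middle element `h` is arbitrary, as its two contributions `x ⊗ h ⊗ y`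
cancel. -/
theorem primD2_tmul (g h h' : C) (x y : C) :
    primD2 k g h' (x ⊗ₜ y) = TensorProduct.assoc k C C C (primD1 k g h x ⊗ₜ y)
      - x ⊗ₜ primD1 k h h' y := by
  rw [primD2_apply, primD1_apply, primD1_apply]
  simp only [TensorProduct.add_tmul, TensorProduct.sub_tmul, map_add, map_sub,
    TensorProduct.tmul_add, TensorProduct.tmul_sub, LinearMap.rTensor_tmul,
    LinearMap.lTensor_tmul, TensorProduct.assoc_tmul, LinearMap.flip_apply,
    TensorProduct.mk_apply]
  abel

theorem tmul_mem_primZ2 {g h h' : C} {x y : C} (hx : x ∈ primZ1 k g h) (hy : y ∈ primZ1 k h h') :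
    x ⊗ₜ y ∈ primZ2 k g h' := by
  rw [LinearMap.mem_ker] at hx hy ⊢
  rw [primD2_tmul g h h', hx, hy, TensorProduct.zero_tmul, TensorProduct.tmul_zero, map_zero,
    sub_zero]

end Coalgebra

namespace HopfOreExt

open Coalgebra

variable {k K H : Type*} [Field k] [Ring K] [HopfAlgebra k K] [Ring H] [HopfAlgebra k H]
variable (X : HopfOreExt k K H)

/-! ### The differentials in coefficients -/

theorem primD1_ι (g h a : K) : primD1 k (X.ι g) (X.ι h) (X.ι a) = X.ι₂ (primD1 k g h a) :=
  (LinearMap.congr_fun (primD1_natural (X.ι : K →ₗc[k] H) (g := g) (h := h) rfl rfl) a).symm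

theorem primD2_ι₂ (g h : K) (t : K ⊗[k] K) :
    primD2 k (X.ι g) (X.ι h) (X.ι₂ t) = X.ι₃ (primD2 k g h t) :=
  (LinearMap.congr_fun (primD2_natural (X.ι : K →ₗc[k] H) (g := g) (h := h) rfl rfl) t).symm

theorem primD1_ι_one (g a : K) : primD1 k (X.ι g) 1 (X.ι a) = X.ι₂ (primD1 k g 1 a) := by
  rw [← primD1_ι, map_one]

theorem primD2_ι₂_one (g : K) (t : K ⊗[k] K) :
    primD2 k (X.ι g) 1 (X.ι₂ t) = X.ι₃ (primD2 k g 1 t) := by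
  rw [← primD2_ι₂, map_one]

theorem primD1_z : primD1 k (X.ι X.e) 1 X.z = -X.ι₂ X.z₀ := by
  have hz : comul (R := k) X.z = X.z ⊗ₜ[k] (1 : H) + X.ι X.e ⊗ₜ[k] X.z + X.ι₂ X.z₀ := X.comul_z
  rw [primD1_apply, hz]
  abel

/-- In `H`, `z₀` is the coboundary of `-z`, and `K ⊗ K ⊗ K` embeds in `H ⊗ H ⊗ H`. -/
theorem z₀_mem : X.z₀ ∈ primZ2 k X.e (1 : K) := by
  rw [LinearMap.mem_ker]
  apply X.ι₃_injective
  have h := primD2_primD1 (k := k) (X.e_groupLike.map X.ι) IsGroupLikeElem.one X.z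
  rw [primD1_z, map_neg, neg_eq_zero] at h
  rw [← primD2_ι₂_one, h, map_zero]

variable {P : ℕ → Prop}

theorem degIn_induction {p : H → Prop} (zero : p 0) (mon : ∀ i a, P i → p (X.mon i a))
    (add : ∀ x y, p x → p y → p (x + y)) {x : H} (hx : x ∈ X.degIn P) : p x := by
  obtain ⟨f, rfl⟩ := X.expand.surjective x
  rw [← f.sum_single, Finsupp.sum, map_sum]
  refine Finset.sum_induction _ p add zero fun i hi => ?_
  rw [expand_single]
  refine mon _ _ ?_
  by_contra h
  exact (Finsupp.mem_support_iff.1 hi) (by simpa [coef] using hx i h)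

theorem mon_mem_degIn_eq (i : ℕ) (a : K) : X.mon i a ∈ X.degIn (· = i) :=
  X.mon_mem_degIn (P := (· = i)) rfl a

theorem primD1_mem (hP : X.Stable P) (g : K) {x : H} (hx : x ∈ X.degIn P) :
    primD1 k (X.ι g) 1 x ∈ X.degIn₂ P := by
  refine X.degIn_induction (p := fun x => primD1 k (X.ι g) 1 x ∈ X.degIn₂ P) ?_ ?_ ?_ hx
  · rw [map_zero]; exact zero_mem _
  · intro i a hi
    rw [primD1_apply]
    refine add_mem (sub_mem ?_ (hP i hi a)) ?_
    · refine X.tmul_mem_degIn₂ (X.ι_mem_degIn g) (X.mon_mem_degIn ?_ a)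
      rwa [zero_add]
    · refine X.tmul_mem_degIn₂ (X.mon_mem_degIn_eq i a) ?_
      rw [← X.mon_zero_one]
      exact X.mon_mem_degIn (P := fun j => P (i + j)) (show P (i + 0) from hi) 1
  · intro x y h1 h2
    rw [map_add]; exact add_mem h1 h2

variable {X} in
theorem IsGraded.primD2_mem (hg : X.IsGraded) (g : K) {u : H ⊗[k] H} (hu : u ∈ X.degIn₂ P) :
    primD2 k (X.ι g) 1 u ∈ X.degIn₃ P := by
  refine X.degIn₂_induction (p := fun u => primD2 k (X.ι g) 1 u ∈ X.degIn₃ P) ?_ ?_ ?_ hu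
  · rw [map_zero]; exact zero_mem _
  · intro i j a b hij
    rw [primD2_apply]
    refine sub_mem (add_mem (sub_mem ?_ ?_) ?_) ?_
    · refine X.tmul_mem_degIn₃ (X.ι_mem_degIn g) (X.mon₂_mem_degIn₂ ?_ (a ⊗ₜ b))
      rwa [zero_add]
    · exact X.assoc_tmul_mem_degIn₃ (hg.comul_mon_mem (P := fun m => P (m + j)) hij a) (X.mon_mem_degIn_eq j b)
    · exact X.tmul_mem_degIn₃ (X.mon_mem_degIn_eq i a) (hg.comul_mon_mem (P := fun m => P (i + m)) hij b)
    · refine X.tmul_mem_degIn₃ (X.mon_mem_degIn_eq i a) ?_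
      rw [LinearMap.flip_apply, TensorProduct.mk_apply, ← X.mon_zero_one]
      exact X.mon₂_mem_degIn₂ (P := fun m => P (i + m)) (by simpa using hij) (b ⊗ₜ 1)
  · intro x y h1 h2
    rw [map_add]; exact add_mem h1 h2

theorem coef_ι (i : ℕ) (a : K) : X.coef i (X.ι a) = if i = 0 then a else 0 := by
  rw [← mon_zero, coef_mon]
  simp [eq_comm]

theorem coef_one (i : ℕ) : X.coef i 1 = if i = 0 then 1 else 0 := by
  rw [← map_one X.ι, coef_ι]

theorem coef₂_primD1 (g : K) {i j w : ℕ} (h : i + j = w) {x : H} (hx : x ∈ X.degIn (· ≤ w)) :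
    X.coef₂ i j (primD1 k (X.ι g) 1 x) =
      (if i = 0 then g ⊗ₜ X.coef w x else 0) - qChoose X.q i j • X.comulE j (X.coef w x)
        + (if j = 0 then X.coef w x ⊗ₜ 1 else 0) := by
  rw [primD1_apply, map_add, map_sub, X.coef₂_comul h hx, coef₂_tmul, coef₂_tmul, coef_ι, coef_one]
  subst h
  congr 2
  · split_ifs with h
    · subst h; rw [zero_add]
    · simp
  · split_ifs with h
    · subst h; rfl
    · simp

theorem coef₃_primD2 (g : K) {i j l w : ℕ} (h : i + j + l = w) {u : H ⊗[k] H}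
    (hu : u ∈ X.degIn₂ (· ≤ w)) :
    X.coef₃ i j l (primD2 k (X.ι g) 1 u) =
      (if i = 0 then g ⊗ₜ X.coef₂ j l u else 0)
      - qChoose X.q i j • TensorProduct.assoc k K K K
          (LinearMap.rTensor K (X.comulE j) (X.coef₂ (i + j) l u))
      + qChoose X.q j l • LinearMap.lTensor K (X.comulE l) (X.coef₂ i (j + l) u)
      - (if l = 0 then
          LinearMap.lTensor K ((TensorProduct.mk k K K).flip 1) (X.coef₂ i j u) else 0) := by
  rw [primD2_apply, map_sub, map_add, map_sub]
  congr 1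
  congr 1
  congr 1
  · rw [coef₃_tmul, coef_ι]
    split_ifs <;> simp
  · refine X.degIn₂_induction (p := fun u => X.coef₃ i j l (TensorProduct.assoc k H H H
      (LinearMap.rTensor H comul u)) = qChoose X.q i j • TensorProduct.assoc k K K K
          (LinearMap.rTensor K (X.comulE j) (X.coef₂ (i + j) l u))) ?_ ?_ ?_ hu
    · simp
    · intro r s a b hrs
      rw [LinearMap.rTensor_tmul, coef₃_assoc_tmul, coef₂_tmul, LinearMap.rTensor_tmul]
      by_cases hs : s = l
      · rw [X.coef₂_comul rfl (X.mon_mem_degIn (P := (· ≤ i + j)) (by omega) a),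
          ← TensorProduct.smul_tmul', map_smul]
      · rw [coef_mon, if_neg hs]; simp
    · intro x y hx hy
      simp only [map_add, hx, hy, smul_add]
  · refine X.degIn₂_induction (p := fun u => X.coef₃ i j l (LinearMap.lTensor H comul u)
      = qChoose X.q j l • LinearMap.lTensor K (X.comulE l) (X.coef₂ i (j + l) u)) ?_ ?_ ?_ hu
    · simp
    · intro r s a b hrs
      rw [LinearMap.lTensor_tmul, coef₃_tmul, coef₂_tmul, LinearMap.lTensor_tmul]
      by_cases hr : r = i
      · rw [X.coef₂_comul rfl (X.mon_mem_degIn (P := (· ≤ j + l)) (by omega) b),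
          TensorProduct.tmul_smul]
      · rw [coef_mon, if_neg hr]; simp
    · intro x y hx hy
      simp only [map_add, hx, hy, smul_add]
  · clear hu
    induction u using TensorProduct.induction_on with
    | zero => simp
    | add x y hx hy =>
      simp only [map_add, hx, hy]
      split_ifs <;> simp
    | tmul x y =>
      rw [LinearMap.lTensor_tmul, LinearMap.flip_apply, TensorProduct.mk_apply, coef₃_tmul,
        coef₂_tmul, coef_one]
      split_ifs <;> simp

/-! ### Leading coefficients in degree one -/

theorem eq_smul_one_of_comul_eq {a : K} (h : comul (R := k) a = a ⊗ₜ 1) :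
    a = counit (R := k) a • 1 := by
  have h1 := congrArg ((TensorProduct.lid k K).toLinearMap ∘ₗ LinearMap.rTensor K counit) h
  simp only [LinearMap.comp_apply] at h1
  rw [Coalgebra.rTensor_counit_comul] at h1
  simpa using h1

/-- The term `g ⊗ x` does not reach `z^w ⊗ 1`, so the leading coefficient `a` satisfies `Δ(a) = a ⊗
1`. -/
theorem coef_eq_smul_one {g : K} {w : ℕ} (hw : 1 ≤ w) {x : H} (hx : x ∈ X.degIn (· ≤ w))
    (h : X.coef₂ w 0 (primD1 k (X.ι g) 1 x) = 0) :
    X.coef w x = counit (R := k) (X.coef w x) • 1 := by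
  rw [X.coef₂_primD1 g (add_zero w) hx, if_neg (by omega), if_pos rfl, qChoose_zero_right, one_smul,
    comulE_zero, zero_sub, neg_add_eq_zero] at h
  exact eq_smul_one_of_comul_eq h

/-- The symbol of the coboundary of an element whose leading coefficient is the scalar `c`. -/
theorem coef₂_primD1_of_scalar (g : K) {i j w : ℕ} (h : i + j = w) (hw : 1 ≤ w) {x : H}
    (hx : x ∈ X.degIn (· ≤ w)) {c : k} (hc : X.coef w x = c • 1) :
    X.coef₂ i j (primD1 k (X.ι g) 1 x) = c • (
      if i = 0 then (g - X.e ^ w) ⊗ₜ 1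
      else if j = 0 then 0 else -(qChoose X.q i j • (X.e ^ j) ⊗ₜ 1)) := by
  rw [X.coef₂_primD1 g h hx, hc, map_smul, comulE_one]
  subst h
  rcases Nat.eq_zero_or_pos i with rfl | hi
  · rw [if_neg (show j ≠ 0 by omega), if_pos rfl, if_pos rfl, zero_add, qChoose_zero_left, one_smul,
      add_zero, TensorProduct.sub_tmul, smul_sub, TensorProduct.tmul_smul]
  · rcases Nat.eq_zero_or_pos j with rfl | hj
    · simp only [if_neg hi.ne', if_true, qChoose_zero_right, pow_zero, one_smul, smul_zero, zero_sub,
        TensorProduct.smul_tmul', neg_add_cancel]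
    · simp only [if_neg hi.ne', if_neg hj.ne']
      rw [add_zero, zero_sub, smul_neg, smul_comm]

theorem tmul_one_injective {a b : K} (h : a ⊗ₜ[k] (1 : K) = b ⊗ₜ 1) : a = b := by
  have := congrArg ((TensorProduct.rid k K).toLinearMap ∘ₗ LinearMap.lTensor K counit) h
  simpa using this

theorem e_pow_tmul_one_ne_zero (j : ℕ) : (X.e ^ j) ⊗ₜ[k] (1 : K) ≠ 0 := fun h =>
  (X.e_pow_groupLike j).ne_zero (tmul_one_injective (k := k) (by rw [h, TensorProduct.zero_tmul]))

/-- The positions `(w, 0)`, `(0, w)` and the interior ones give, in turn, the scalar, the value of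
`g` and the vanishing of the binomials. -/
theorem coef_ne_zero_cases {g : K} {w : ℕ} (hw : 1 ≤ w) {x : H} (hx : x ∈ X.degIn (· ≤ w))
    (h : ∀ i j, i + j = w → X.coef₂ i j (primD1 k (X.ι g) 1 x) = 0) (h0 : X.coef w x ≠ 0) :
    ∃ c : k, c ≠ 0 ∧ X.coef w x = c • 1 ∧ g = X.e ^ w ∧
      ∀ i j, 1 ≤ i → 1 ≤ j → i + j = w → qChoose X.q i j = 0 := by
  have hc := X.coef_eq_smul_one hw hx (h w 0 (add_zero w))
  generalize counit (R := k) (X.coef w x) = c at hc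
  have hc0 : c ≠ 0 := by
    rintro rfl
    exact h0 (by rw [hc, zero_smul])
  refine ⟨c, hc0, hc, ?_, ?_⟩
  · have h1 := h 0 w (zero_add w)
    rw [X.coef₂_primD1_of_scalar g (zero_add w) hw hx hc, if_pos rfl] at h1
    have h2 := (smul_eq_zero.1 h1).resolve_left hc0
    rw [TensorProduct.sub_tmul, sub_eq_zero] at h2
    exact tmul_one_injective h2
  · intro i j hi hj hij
    have h1 := h i j hij
    rw [X.coef₂_primD1_of_scalar g hij hw hx hc, if_neg (by omega), if_neg (by omega)] at h1
    have h2 := (smul_eq_zero.1 h1).resolve_left hc0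
    rw [neg_eq_zero] at h2
    exact (smul_eq_zero.1 h2).resolve_right (X.e_pow_tmul_one_ne_zero j)

/-- An element of `H` whose coboundary lies in `K ⊗ K` lies in `K`, or has a scalar leading
coefficient in degree `1` or in degree the order of `q`. -/
theorem cases_of_primD1_mem (hchar : (∃ n : ℕ, 0 < n ∧ X.q ^ n = 1) → CharZero k) {g : K} {x : H}
    (h : primD1 k (X.ι g) 1 x ∈ X.degIn₂ (· ≤ 0)) :
    (∃ a, x = X.ι a) ∨ ∃ (w : ℕ) (c : k), 1 ≤ w ∧ x ∈ X.degIn (· ≤ w) ∧ c ≠ 0 ∧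
      X.coef w x = c • 1 ∧ g = X.e ^ w ∧ (w = 1 ∨ 2 ≤ w ∧ IsPrimitiveRoot X.q w) := by
  obtain ⟨n, hn⟩ := X.exists_mem_degIn x
  induction n with
  | zero => exact Or.inl (X.exists_ι_of_mem hn)
  | succ n ih =>
    by_cases h0 : X.coef (n + 1) x = 0
    · refine ih fun i hi => ?_
      rcases eq_or_ne i (n + 1) with rfl | h'
      · exact h0
      · exact hn i (by omega)
    · obtain ⟨c, hc0, hc, hg, hB⟩ := X.coef_ne_zero_cases (by omega) hn
        (fun i j hij => h i j (by omega)) h0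
      refine Or.inr ⟨n + 1, c, by omega, hn, hc0, hc, hg, ?_⟩
      rcases Nat.eq_zero_or_pos n with rfl | hn'
      · exact Or.inl rfl
      · refine Or.inr ⟨by omega, ?_⟩
        by_contra hq
        obtain ⟨i, j, hi, hj, hij, hne⟩ := exists_qChoose_ne_zero (by omega) hchar hq
        exact hne (hB i j hi hj hij)

end HopfOreExt

/-! ### Contractions with the counit -/

section Contraction

open Coalgebra

variable (k : Type*) [Field k] (V W C : Type*) [AddCommGroup V] [Module k V]
  [AddCommGroup W] [Module k W] [AddCommGroup C] [Module k C] [Coalgebra k C]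

/-- The counit applied to the left factor. -/
def counitL : C ⊗[k] V →ₗ[k] V := (TensorProduct.lid k V).toLinearMap ∘ₗ LinearMap.rTensor V counit

/-- The counit applied to the right factor. -/
def counitR : V ⊗[k] C →ₗ[k] V := (TensorProduct.rid k V).toLinearMap ∘ₗ LinearMap.lTensor V counit

variable {k V W C}

@[simp] theorem counitL_tmul (c : C) (v : V) :
    counitL k V C (c ⊗ₜ v) = counit (R := k) c • v := by simp [counitL]

@[simp] theorem counitR_tmul (v : V) (c : C) :
    counitR k V C (v ⊗ₜ c) = counit (R := k) c • v := by simp [counitR]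

@[simp] theorem counitL_comul (c : C) : counitL k C C (comul c) = c := by
  simp [counitL]

theorem counitL_lTensor (φ : V →ₗ[k] W) (t : C ⊗[k] V) :
    counitL k W C (LinearMap.lTensor C φ t) = φ (counitL k V C t) := by
  induction t using TensorProduct.induction_on with
  | zero => simp
  | tmul x y => simp
  | add x y hx hy => simp only [map_add, hx, hy]

theorem counitL_assoc (t : C ⊗[k] V) (w : W) :
    counitL k (V ⊗[k] W) C (TensorProduct.assoc k C V W (t ⊗ₜ w)) = counitL k V C t ⊗ₜ w := by
  induction t using TensorProduct.induction_on with
  | zero => simp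
  | tmul x y => simp [TensorProduct.smul_tmul']
  | add x y hx hy => simp only [TensorProduct.add_tmul, map_add, hx, hy]

theorem counitL_assoc_comul (t : C ⊗[k] V) :
    counitL k (C ⊗[k] V) C (TensorProduct.assoc k C C V (LinearMap.rTensor V comul t)) = t := by
  induction t using TensorProduct.induction_on with
  | zero => simp
  | tmul x y => rw [LinearMap.rTensor_tmul, counitL_assoc, counitL_comul]
  | add x y hx hy => simp only [map_add, hx, hy]

theorem lTensor_counitR_assoc (t : V ⊗[k] W) (c : C) :
    LinearMap.lTensor V (counitR k W C) (TensorProduct.assoc k V W C (t ⊗ₜ c))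
      = counit (R := k) c • t := by
  induction t using TensorProduct.induction_on with
  | zero => simp
  | tmul x y => simp
  | add x y hx hy => simp only [TensorProduct.add_tmul, map_add, hx, hy, smul_add]

/-- Apply the counit to the middle factor: the left side becomes `t` by the counit axiom. -/
theorem eq_counitR_tmul {h : C} {t : V ⊗[k] C}
    (ht : LinearMap.lTensor V comul t = LinearMap.lTensor V ((TensorProduct.mk k C C).flip h) t) :
    t = counitR k V C t ⊗ₜ h := by
  have h1 := congrArg (LinearMap.lTensor V (counitL k C C)) ht
  rw [← LinearMap.comp_apply, ← LinearMap.lTensor_comp] at h1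
  have h2 : counitL k C C ∘ₗ comul = LinearMap.id := by
    ext c; simp
  rw [h2, LinearMap.lTensor_id, LinearMap.id_apply] at h1
  refine h1.trans ?_
  clear h1 ht
  induction t using TensorProduct.induction_on with
  | zero => simp
  | tmul x y => simp [TensorProduct.smul_tmul]
  | add x y hx hy =>
    simp only [map_add, TensorProduct.add_tmul] at hx hy ⊢
    rw [← hx, ← hy]

end Contraction

namespace HopfOreExt

open Coalgebra

variable {k K H : Type*} [Field k] [Ring K] [HopfAlgebra k K] [Ring H] [HopfAlgebra k H]
variable (X : HopfOreExt k K H)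

theorem counitL_comulE (j : ℕ) (a : K) : counitL k K K (X.comulE j a) = a :=
  X.lid_rTensor_comulE j a

theorem counitR_comulE (j : ℕ) (a : K) : counitR k K K (X.comulE j a) = a * X.e ^ j :=
  X.rid_lTensor_comulE j a

/-! ### Symbols of cocycles in degree two -/

/-- The component of degree `w` vanishes. -/
def SymbolZero (w : ℕ) (u : H ⊗[k] H) : Prop := ∀ i j, i + j = w → X.coef₂ i j u = 0

variable {X} in
theorem SymbolZero.mem_lt {w : ℕ} {u : H ⊗[k] H} (h : X.SymbolZero (w + 1) u)
    (hu : u ∈ X.degIn₂ (· ≤ w + 1)) : u ∈ X.degIn₂ (· ≤ w) := by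
  intro i j hij
  by_cases h' : i + j = w + 1
  · exact h i j h'
  · exact hu i j (by omega)

variable {X} in
theorem SymbolZero.eq_zero {w : ℕ} {u : H ⊗[k] H} (h : X.SymbolZero w u)
    (hu : u ∈ X.degIn₂ (· = w)) : u = 0 := by
  apply X.coef₂_ext
  intro i j
  rw [map_zero]
  by_cases h' : i + j = w
  · exact h i j h'
  · exact hu i j h'

/-- The component of degree `w` of a cochain in normal form. -/
structure IsNormal (w : ℕ) (u : H ⊗[k] H) (a : K) (c : ℕ → k) : Prop where
  last : X.coef₂ w 0 u = 0
  first : X.coef₂ 0 w u = a ⊗ₜ 1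
  mid : ∀ i j, 1 ≤ i → 1 ≤ j → i + j = w → X.coef₂ i j u = c i • (X.e ^ j) ⊗ₜ 1

variable {w : ℕ} {g : K} {u : H ⊗[k] H}

/-- At `(w, 0, 0)` the equation involves only the coefficient `t` of `z^w ⊗ 1`. The counit on the
left gives `t = Δ(b) - b ⊗ 1` with `b = (ε ⊗ id)(t)`, which is minus the corresponding coefficient
of `∂¹(b z^w)`. -/
theorem exists_coef₂_last_eq_zero (hw : 1 ≤ w) (hu : u ∈ X.degIn₂ (· ≤ w))
    (h : X.coef₃ w 0 0 (primD2 k (X.ι g) 1 u) = 0) :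
    ∃ b : K, X.coef₂ w 0 (u + primD1 k (X.ι g) 1 (X.mon w b)) = 0 := by
  rw [X.coef₃_primD2 g (by omega) hu, if_neg (by omega), if_pos rfl, qChoose_zero_right,
    qChoose_zero_right, one_smul, one_smul, comulE_zero, add_zero, add_zero, zero_sub] at h
  have h1 := congrArg (counitL k (K ⊗[k] K) K) h
  rw [map_sub, map_add, map_neg, map_zero, counitL_assoc_comul, counitL_lTensor,
    counitL_lTensor] at h1
  refine ⟨counitL k K K (X.coef₂ w 0 u), ?_⟩
  rw [map_add, X.coef₂_primD1 g (add_zero w) (X.mon_mem_degIn (P := (· ≤ w)) le_rfl _),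
    if_neg (by omega), if_pos rfl, qChoose_zero_right, one_smul, comulE_zero, coef_mon, if_pos rfl]
  generalize X.coef₂ w 0 u = t at h1 ⊢
  rw [LinearMap.flip_apply, TensorProduct.mk_apply] at h1
  refine Eq.trans ?_ (neg_eq_zero.2 h1)
  abel

/-- Once the coefficient of `z^w ⊗ 1` is zero, the equation at `(i, j, 0)` says that `id ⊗ Δ` sends
this coefficient `t` to `t ⊗ 1`. -/
theorem coef₂_eq_tmul_one (hu : u ∈ X.degIn₂ (· ≤ w)) (hlast : X.coef₂ w 0 u = 0)
    {i j : ℕ} (hij : i + j = w)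
    (h : X.coef₃ i j 0 (primD2 k (X.ι g) 1 u) = 0) :
    X.coef₂ i j u = counitR k K K (X.coef₂ i j u) ⊗ₜ 1 := by
  have hg : (if i = 0 then g ⊗ₜ[k] X.coef₂ j 0 u else 0) = 0 := by
    split_ifs with hi
    · obtain rfl : j = w := by omega
      rw [hlast, TensorProduct.tmul_zero]
    · rfl
  rw [X.coef₃_primD2 g (by omega) hu, hg, if_pos rfl, qChoose_zero_right, one_smul, hij, hlast,
    map_zero, map_zero, smul_zero, comulE_zero, add_zero, sub_zero, zero_add, sub_eq_zero] at h
  exact eq_counitR_tmul h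

/-- For `l ≥ 1` every term at `(i, j, l)` ends in `⊗ 1`, which the counit removes; an equation in `K
⊗ K` remains. -/
theorem symbol_primD2 {a : ℕ → K} (hu : u ∈ X.degIn₂ (· ≤ w))
    (ha : ∀ i j, 1 ≤ j → i + j = w → X.coef₂ i j u = a i ⊗ₜ 1) {i j l : ℕ} (hl : 1 ≤ l)
    (hijl : i + j + l = w) (h : X.coef₃ i j l (primD2 k (X.ι g) 1 u) = 0) :
    (if i = 0 then g ⊗ₜ a j else 0) - qChoose X.q i j • X.comulE j (a (i + j))
      + qChoose X.q j l • a i ⊗ₜ[k] (X.e ^ l) = 0 := by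
  have hg : (if i = 0 then g ⊗ₜ[k] X.coef₂ j l u else 0)
      = if i = 0 then g ⊗ₜ[k] (a j ⊗ₜ[k] (1 : K)) else 0 := by
    split_ifs with hi
    · rw [ha j l hl (by omega)]
    · rfl
  rw [X.coef₃_primD2 g hijl hu, hg, if_neg (show l ≠ 0 by omega), ha (i + j) l hl hijl,
    ha i (j + l) (by omega) (by omega), LinearMap.rTensor_tmul, LinearMap.lTensor_tmul,
    comulE_one, sub_zero] at h
  have h1 := congrArg (LinearMap.lTensor K (counitR k K K)) h
  rw [map_add, map_sub, map_smul, map_smul, lTensor_counitR_assoc, apply_ite (LinearMap.lTensor K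
    (counitR k K K)), LinearMap.lTensor_tmul, LinearMap.lTensor_tmul, counitR_tmul, counitR_tmul,
    Bialgebra.counit_one, one_smul, one_smul, one_smul, map_zero] at h1
  exact h1

/-- The component of highest degree of a cocycle is normal up to a coboundary. -/
theorem exists_isNormal (hg : IsGroupLikeElem k g) (hw : 1 ≤ w) (hu : u ∈ X.degIn₂ (· ≤ w))
    (h : primD2 k (X.ι g) 1 u = 0) :
    ∃ (b a : K) (c : ℕ → k), X.IsNormal w (u + primD1 k (X.ι g) 1 (X.mon w b)) a c ∧
      a ∈ primZ1 k g (X.e ^ w) ∧ IsQCocycle X.q w c ∧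
      ∀ i j, 1 ≤ i → 1 ≤ j → i + j = w → c i • (g - X.e ^ w) + qChoose X.q i j • a = 0 := by
  obtain ⟨b, hb⟩ := X.exists_coef₂_last_eq_zero hw hu (by rw [h, map_zero])
  have hv : primD2 k (X.ι g) 1 (u + primD1 k (X.ι g) 1 (X.mon w b)) = 0 := by
    rw [map_add, h, primD2_primD1 (hg.map X.ι) IsGroupLikeElem.one, add_zero]
  have hvm : u + primD1 k (X.ι g) 1 (X.mon w b) ∈ X.degIn₂ (· ≤ w) :=
    add_mem hu (X.primD1_mem (X.stable_le w) g (X.mon_mem_degIn (P := (· ≤ w)) le_rfl b))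
  refine ⟨b, ?_⟩
  generalize u + primD1 k (X.ι g) 1 (X.mon w b) = v at hb hv hvm
  have hH : ∀ i j l, X.coef₃ i j l (primD2 k (X.ι g) 1 v) = 0 := fun i j l => by
    rw [hv, map_zero]
  obtain ⟨a, ha⟩ : ∃ a : ℕ → K, ∀ i j, 1 ≤ j → i + j = w → X.coef₂ i j v = a i ⊗ₜ 1 := by
    refine ⟨fun i => counitR k K K (X.coef₂ i (w - i) v), fun i j hj hij => ?_⟩
    simp only [show w - i = j by omega]
    exact X.coef₂_eq_tmul_one hvm hb hij (hH i j 0)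
  have hE := fun (i j l : ℕ) (hl : 1 ≤ l) (hijl : i + j + l = w) =>
    X.symbol_primD2 hvm ha hl hijl (hH i j l)
  have hmid : ∀ i j l, 1 ≤ i → 1 ≤ l → i + j + l = w →
      qChoose X.q i j • a (i + j) = qChoose X.q j l • counit (R := k) (a i) • X.e ^ l := by
    intro i j l hi hl hijl
    have h1 := congrArg (counitL k K K) (hE i j l hl hijl)
    rw [if_neg (by omega), zero_sub, map_add, map_neg, map_smul, map_smul, counitL_comulE,
      counitL_tmul, map_zero, neg_add_eq_zero] at h1
    exact h1
  -- With middle index `0` both binomials are `1`, so interior coefficients are scalar multiples of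
  -- powers of `e`.
  have hc : ∀ i l, 1 ≤ i → 1 ≤ l → i + l = w → a i = counit (R := k) (a i) • X.e ^ l := by
    intro i l hi hl hil
    have h1 := hmid i 0 l hi hl hil
    rwa [qChoose_zero_right, qChoose_zero_left, one_smul, one_smul, add_zero] at h1
  refine ⟨a 0, fun i => counit (R := k) (a i), ⟨hb, ha 0 w hw (zero_add w), ?_⟩, ?_, ?_, ?_⟩
  · intro i j hi hj hij
    rw [ha i j hj hij, TensorProduct.smul_tmul', ← hc i j hi hj hij]
  · rw [LinearMap.mem_ker, primD1_apply]
    -- Position `(0, 0, w)` is the one-cocycle condition for `a 0`.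
    have h1 := hE 0 0 w hw (by omega)
    rwa [if_pos rfl, qChoose_zero_right, qChoose_zero_left, one_smul, one_smul, comulE_zero] at h1
  · intro i j l hi hl hijl
    have h1 := congrArg (counit (R := k)) (hmid i j l hi hl hijl)
    rwa [map_smul, map_smul, map_smul, (X.e_pow_groupLike l).counit_eq_one, smul_eq_mul,
      smul_eq_mul, smul_eq_mul, mul_one] at h1
  · intro i j hi hj hij
    -- Positions `(0, i, j)` tie the interior scalars to `a 0`.
    have h1 := congrArg (counitR k K K) (hE 0 i j hj (by omega))
    rw [if_pos rfl, qChoose_zero_left, one_smul, zero_add, map_add, map_sub, map_smul,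
      counitR_comulE, counitR_tmul, counitR_tmul, (X.e_pow_groupLike j).counit_eq_one, one_smul,
      map_zero, hc i j hi hj hij, smul_mul_assoc, ← pow_add, add_comm j i, hij, map_smul,
      (X.e_pow_groupLike j).counit_eq_one, smul_eq_mul, mul_one, ← smul_sub] at h1
    exact h1

end HopfOreExt

/-! ### Normal forms and the removal of symbols by coboundaries -/

namespace HopfOreExt

open Coalgebra

variable {k K H : Type*} [Field k] [Ring K] [HopfAlgebra k K] [Ring H] [HopfAlgebra k H]
variable (X : HopfOreExt k K H)
variable {w : ℕ} {g : K} {u : H ⊗[k] H}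

variable {X} in
-- Only a scalar leading coefficient has a coboundary without a term at `z^w ⊗ 1`, so this is the
-- freedom left in a normal form.
theorem IsNormal.add_primD1 (hw : 1 ≤ w) {a : K} {c : ℕ → k} (h : X.IsNormal w u a c) (g : K)
    (r : k) : X.IsNormal w (u + primD1 k (X.ι g) 1 (X.mon w (r • 1)))
      (a + r • (g - X.e ^ w)) (fun i => c i - r * qChoose X.q i (w - i)) := by
  have hx : X.mon w (r • (1 : K)) ∈ X.degIn (· ≤ w) := X.mon_mem_degIn (P := (· ≤ w)) le_rfl _
  have hc : X.coef w (X.mon w (r • (1 : K))) = r • 1 := by rw [coef_mon, if_pos rfl]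
  refine ⟨?_, ?_, fun i j hi hj hij => ?_⟩
  · rw [map_add, h.last, X.coef₂_primD1_of_scalar g (add_zero w) hw hx hc, if_neg (by omega),
      if_pos rfl, smul_zero, add_zero]
  · rw [map_add, h.first, X.coef₂_primD1_of_scalar g (zero_add w) hw hx hc, if_pos rfl,
      TensorProduct.add_tmul, TensorProduct.smul_tmul']
  · rw [map_add, h.mid i j hi hj hij, X.coef₂_primD1_of_scalar g hij hw hx hc, if_neg (by omega),
      if_neg (by omega), show w - i = j by omega, sub_smul, mul_smul, smul_neg, sub_eq_add_neg]

variable {X} in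
theorem IsNormal.symbolZero_sub {a : K} {c : ℕ → k} (h : X.IsNormal w u a c) {v : H ⊗[k] H}
    (h' : X.IsNormal w v a c) : X.SymbolZero w (u - v) := by
  intro i j hij
  rw [map_sub, sub_eq_zero]
  rcases Nat.eq_zero_or_pos i with rfl | hi
  · obtain rfl : j = w := by omega
    rw [h.first, h'.first]
  rcases Nat.eq_zero_or_pos j with rfl | hj
  · obtain rfl : i = w := by omega
    rw [h.last, h'.last]
  rw [h.mid i j hi hj hij, h'.mid i j hi hj hij]

variable {X} in
theorem IsNormal.congr {a a' : K} {c c' : ℕ → k} (h : X.IsNormal w u a c) (ha : a = a')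
    (hc : ∀ i, 1 ≤ i → i < w → c i = c' i) : X.IsNormal w u a' c' :=
  ⟨h.last, ha ▸ h.first, fun i j hi hj hij => by
    rw [h.mid i j hi hj hij, hc i hi (by omega)]⟩

theorem isNormal_zero : X.IsNormal w 0 0 (fun _ => 0) :=
  ⟨map_zero _, by simp, fun i j _ _ _ => by simp⟩

theorem isNormal_tmul (hw : 1 ≤ w) (a : K) :
    X.IsNormal w (X.ι a ⊗ₜ (X.z ^ w)) a (fun _ => 0) := by
  rw [← mon_zero, ← mon_one_right]
  refine ⟨?_, ?_, fun i j hi hj hij => ?_⟩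
  · rw [coef₂_tmul, coef_mon, if_neg (by omega), TensorProduct.zero_tmul]
  · rw [coef₂_tmul, coef_mon, coef_mon, if_pos rfl, if_pos rfl]
  · rw [coef₂_tmul, coef_mon, if_neg (by omega), TensorProduct.zero_tmul, zero_smul]

variable {X} in
theorem IsNormal.add {a b : K} {c d : ℕ → k} {v : H ⊗[k] H} (h : X.IsNormal w u a c)
    (h' : X.IsNormal w v b d) : X.IsNormal w (u + v) (a + b) (c + d) :=
  ⟨by rw [map_add, h.last, h'.last, add_zero], by
    rw [map_add, h.first, h'.first, TensorProduct.add_tmul], fun i j hi hj hij => by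
    rw [map_add, h.mid i j hi hj hij, h'.mid i j hi hj hij, Pi.add_apply, add_smul]⟩

variable {X} in
theorem IsNormal.smul {a : K} {c : ℕ → k} (h : X.IsNormal w u a c) (r : k) :
    X.IsNormal w (r • u) (r • a) (r • c) :=
  ⟨by rw [map_smul, h.last, smul_zero], by
    rw [map_smul, h.first, TensorProduct.smul_tmul'], fun i j hi hj hij => by
    rw [map_smul, h.mid i j hi hj hij, Pi.smul_apply, smul_assoc]⟩

theorem bracketZ_eq (l : ℕ) : X.bracketZ l = ∑ i ∈ Finset.Ioo 0 l,
    (qFact X.q (l - 1) / (qFact X.q i * qFact X.q (l - i))) •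
      X.mon₂ i (l - i) ((X.e ^ (l - i)) ⊗ₜ 1) := by
  simp only [bracketZ, mon₂_tmul, mon_apply, map_pow, map_one, one_mul]

theorem bracketZ_mem (l : ℕ) : X.bracketZ l ∈ X.degIn₂ (· = l) := by
  rw [bracketZ_eq]
  refine sum_mem fun i hi => Submodule.smul_mem _ _ (X.mon₂_mem_degIn₂ ?_ _)
  rw [Finset.mem_Ioo] at hi
  omega

theorem isNormal_bracketZ (l : ℕ) : X.IsNormal l (X.bracketZ l) 0
    (fun i => qFact X.q (l - 1) / (qFact X.q i * qFact X.q (l - i))) := by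
  rw [bracketZ_eq]
  refine ⟨?_, ?_, fun i j hi hj hij => ?_⟩
  · rw [map_sum]
    refine Finset.sum_eq_zero fun i hi => ?_
    rw [Finset.mem_Ioo] at hi
    rw [map_smul, coef₂_mon₂, if_neg (by omega), smul_zero]
  · rw [map_sum, TensorProduct.zero_tmul]
    refine Finset.sum_eq_zero fun i hi => ?_
    rw [Finset.mem_Ioo] at hi
    rw [map_smul, coef₂_mon₂, if_neg (by omega), smul_zero]
  · rw [map_sum, Finset.sum_eq_single i]
    · rw [map_smul, coef₂_mon₂, if_pos (by omega), show l - i = j by omega]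
    · intro b hb hbi
      rw [map_smul, coef₂_mon₂, if_neg (by omega), smul_zero]
    · intro h
      rw [Finset.mem_Ioo] at h
      omega

theorem isNormal_e_pow_z_tmul {l : ℕ} (hl : 2 ≤ l) : X.IsNormal (l + 1)
    ((X.ι X.e ^ l * X.z) ⊗ₜ[k] (X.z ^ l)) 0 (fun i => if i = 1 then 1 else 0) := by
  have h : (X.ι X.e ^ l * X.z) ⊗ₜ[k] (X.z ^ l) = X.mon₂ 1 l ((X.e ^ l) ⊗ₜ 1) := by
    simp [mon_apply]
  rw [h]
  refine ⟨?_, ?_, fun i j hi hj hij => ?_⟩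
  · rw [coef₂_mon₂, if_neg (by omega)]
  · rw [coef₂_mon₂, if_neg (by omega), TensorProduct.zero_tmul]
  · rw [coef₂_mon₂]
    by_cases h1 : i = 1
    · rw [if_pos (by omega), if_pos h1, one_smul, show j = l by omega]
    · rw [if_neg (by omega), if_neg h1, zero_smul]

/-- Here `c` is `r` times the binomials, and the relation between `c` and `a` at a nonzero interior
binomial forces `a = -r (g - e^w)`. The same `∂¹(r z^w)` then removes both parts. -/
theorem exists_symbolZero (hchar : (∃ n : ℕ, 0 < n ∧ X.q ^ n = 1) → CharZero k)
    (hg : IsGroupLikeElem k g) (hw : 2 ≤ w)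
    (hwq : ∀ l, 2 ≤ l → IsPrimitiveRoot X.q l → w ≠ l ∧ w ≠ l + 1)
    (hu : u ∈ X.degIn₂ (· ≤ w)) (h : primD2 k (X.ι g) 1 u = 0) :
    ∃ b : K, X.SymbolZero w (u + primD1 k (X.ι g) 1 (X.mon w b)) := by
  obtain ⟨b, a, c, hn, _, hc, hB⟩ := X.exists_isNormal hg (by omega) hu h
  obtain ⟨r, hr⟩ := hc.exists_eq hw hchar hwq
  obtain ⟨i, j, hi, hj, hij, hne⟩ := exists_qChoose_ne_zero hw hchar
    (fun hq => (hwq w hw hq).1 rfl)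
  have ha : a + r • (g - X.e ^ w) = 0 := by
    have h1 := hB i j hi hj hij
    rw [hr i hi (by omega), show w - i = j by omega, mul_comm, mul_smul, ← smul_add] at h1
    rw [add_comm]
    exact (smul_eq_zero.1 h1).resolve_left hne
  refine ⟨b + r • 1, ?_⟩
  have h2 := ((hn.add_primD1 (by omega) g r).congr ha (c' := fun _ => 0) fun i hi hiw => by
    simp only [hr i hi hiw, sub_self]).symbolZero_sub X.isNormal_zero
  rwa [sub_zero, add_assoc, ← map_add, ← map_add] at h2

theorem exists_symbolZero_one (hg : IsGroupLikeElem k g) (hu : u ∈ X.degIn₂ (· ≤ 1))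
    (h : primD2 k (X.ι g) 1 u = 0) :
    ∃ b a : K, a ∈ primZ1 k g X.e ∧
      X.SymbolZero 1 (u + primD1 k (X.ι g) 1 (X.mon 1 b) - X.ι a ⊗ₜ X.z) := by
  obtain ⟨b, a, c, hn, ha, _, _⟩ := X.exists_isNormal hg le_rfl hu h
  rw [pow_one] at ha
  refine ⟨b, a, ha, ?_⟩
  have h2 := hn.symbolZero_sub ((X.isNormal_tmul le_rfl a).congr rfl fun i hi hiw => by omega)
  rwa [pow_one] at h2

/-- Interior binomials of degree `l` vanish, so the relation between `c` and `a` no longer contains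
`a` and becomes `c 1 • (g - e^l) = 0`. -/
theorem exists_symbolZero_order {l : ℕ} (hl : 2 ≤ l) (hq : IsPrimitiveRoot X.q l)
    (hg : IsGroupLikeElem k g) (hu : u ∈ X.degIn₂ (· ≤ l)) (h : primD2 k (X.ι g) 1 u = 0) :
    ∃ (b a : K) (s : k), a ∈ primZ1 k g (X.e ^ l) ∧ s • (g - X.e ^ l) = 0 ∧
      X.SymbolZero l (u + primD1 k (X.ι g) 1 (X.mon l b)
        - (X.ι a ⊗ₜ (X.z ^ l) + s • X.bracketZ l)) := by
  obtain ⟨b, a, c, hn, ha, hc, hB⟩ := X.exists_isNormal hg (by omega) hu h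
  refine ⟨b, a, c 1, ha, ?_, ?_⟩
  · have h1 := hB 1 (l - 1) le_rfl (by omega) (by omega)
    rwa [qChoose_eq_zero hl hq le_rfl (by omega) (by omega), zero_smul, add_zero] at h1
  · refine hn.symbolZero_sub (((X.isNormal_tmul (by omega) a).add
      ((X.isNormal_bracketZ l).smul (c 1))).congr ?_ fun i hi hil => ?_)
    · rw [smul_zero, add_zero]
    · rw [Pi.add_apply, Pi.smul_apply, zero_add, smul_eq_mul, ← hc.eq_of_primitiveRoot hl hq hi hil]

/-- The binomials at `(1, l)` and `(l, 1)` are both `1`. The relation at `(l, 1)` gives `a = -r (g -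
e^{l+1})`, and subtracting it from the one at `(1, l)` leaves the condition on `s`. -/
theorem exists_symbolZero_order_succ {l : ℕ} (hl : 2 ≤ l) (hq : IsPrimitiveRoot X.q l)
    (hg : IsGroupLikeElem k g) (hu : u ∈ X.degIn₂ (· ≤ l + 1)) (h : primD2 k (X.ι g) 1 u = 0) :
    ∃ (b : K) (s : k), s • (g - X.e ^ (l + 1)) = 0 ∧
      X.SymbolZero (l + 1) (u + primD1 k (X.ι g) 1 (X.mon (l + 1) b)
        - s • ((X.ι X.e ^ l * X.z) ⊗ₜ[k] (X.z ^ l))) := by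
  obtain ⟨b, a, c, hn, _, hc, hB⟩ := X.exists_isNormal hg (by omega) hu h
  obtain ⟨r, s, hrs⟩ := hc.exists_eq_of_primitiveRoot_succ hl hq
  have hl1 : qInt X.q (l + 1) = 1 := by
    rw [(qInt_add_of_eq_zero 1 ((qInt_eq_zero_iff hl hq l).2 dvd_rfl)).1, qInt_one]
  have h1 := hB 1 l le_rfl (by omega) (by omega)
  have h2 := hB l 1 (by omega) le_rfl rfl
  rw [hrs 1 le_rfl (by omega), if_pos rfl, show l + 1 - 1 = l by omega, qChoose_one_left, hl1,
    mul_one, one_smul] at h1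
  rw [hrs l (by omega) (by omega), if_neg (by omega), show l + 1 - l = 1 by omega,
    qChoose_one_right, hl1, mul_one, one_smul, add_zero] at h2
  refine ⟨b + r • 1, s, ?_, ?_⟩
  · rw [add_smul, add_assoc, add_comm (s • _), ← add_assoc, h2, zero_add] at h1
    exact h1
  · have h3 := ((hn.add_primD1 (by omega) g r).congr (a' := s • 0)
      (c' := s • fun i => if i = 1 then 1 else 0) (by rw [smul_zero, add_comm, h2])
      fun i hi hiw => ?_).symbolZero_sub ((X.isNormal_e_pow_z_tmul hl).smul s)
    · rwa [add_assoc, ← map_add, ← map_add] at h3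
    · simp only [hrs i hi hiw, Pi.smul_apply, smul_eq_mul, add_sub_cancel_left]
      split_ifs <;> simp

/-! ### Classes -/

/-- The coboundaries `r (g - 1)` already lie in `K`, and a cocycle of `H` that lies in `K` is a
cocycle of `K` because `K ⊗ K` embeds. -/
theorem cl₁_eq_zero_iff (g : K) (x : primZ1 k (X.ι g) (1 : H)) :
    X.cl₁ g x = 0 ↔ ∃ a, (x : H) = X.ι a := by
  rw [cl₁, LinearMap.comp_apply, Submodule.mkQ_apply, Submodule.Quotient.mk_eq_zero]
  constructor
  · rintro ⟨c, hc⟩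
    obtain ⟨⟨a, ha⟩, rfl⟩ := Submodule.Quotient.mk_surjective _ c
    have h1 := (Submodule.Quotient.eq _).1 hc
    obtain ⟨r, hr⟩ := h1
    refine ⟨a - r • (g - 1), ?_⟩
    have hr' : r • (X.ι g - 1) = X.ι a - (x : H) := hr
    rw [map_sub, map_smul, map_sub, map_one, hr']
    abel
  · rintro ⟨a, ha⟩
    have ham : a ∈ primZ1 k g (1 : K) := by
      rw [LinearMap.mem_ker]
      apply X.ι₂_injective
      rw [← primD1_ι_one, ← ha, map_zero]
      exact x.2
    refine ⟨Submodule.Quotient.mk ⟨a, ham⟩, ?_⟩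
    refine congrArg Submodule.Quotient.mk (Subtype.ext ?_)
    exact ha.symm

theorem cl₁_surjective (g : K) : Function.Surjective (X.cl₁ g) :=
  (Submodule.mkQ_surjective _).comp (Submodule.mkQ_surjective _)

/-- The element `t` need not be assumed a cocycle: this follows from `∂²∂¹ = 0`, for which `g` has
to be grouplike. -/
theorem cl₂_eq_zero_iff (g : K) (hg : IsGroupLikeElem k g) (u : primZ2 k (X.ι g) (1 : H)) :
    X.cl₂ g u = 0 ↔ ∃ f t, (u : H ⊗[k] H) = primD1 k (X.ι g) 1 f + X.ι₂ t := by
  rw [cl₂, LinearMap.comp_apply, Submodule.mkQ_apply, Submodule.Quotient.mk_eq_zero]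
  constructor
  · rintro ⟨c, hc⟩
    obtain ⟨⟨t, ht⟩, rfl⟩ := Submodule.Quotient.mk_surjective _ c
    obtain ⟨f, hf⟩ := (Submodule.Quotient.eq _).1 hc
    refine ⟨-f, t, ?_⟩
    have hf' : primD1 k (X.ι g) 1 f = X.ι₂ t - (u : H ⊗[k] H) := hf
    rw [map_neg, hf']
    abel
  · rintro ⟨f, t, h⟩
    have htm : t ∈ primZ2 k g (1 : K) := by
      rw [LinearMap.mem_ker]
      apply X.ι₃_injective
      have h1 : primD2 k (X.ι g) 1 (u : H ⊗[k] H) = 0 := u.2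
      rw [h, map_add, primD2_primD1 (hg.map X.ι) IsGroupLikeElem.one, zero_add] at h1
      rw [← primD2_ι₂_one, h1, map_zero]
    refine ⟨Submodule.Quotient.mk ⟨t, htm⟩, ?_⟩
    refine (Submodule.Quotient.eq _).2 ⟨-f, ?_⟩
    change primD1 k (X.ι g) 1 (-f) = X.ι₂ t - (u : H ⊗[k] H)
    rw [h, map_neg]
    abel

theorem cl₂_surjective (g : K) : Function.Surjective (X.cl₂ g) :=
  (Submodule.mkQ_surjective _).comp (Submodule.mkQ_surjective _)

theorem φ₁_injective (g : K) : Function.Injective (X.φ₁ g) := by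
  rw [← LinearMap.ker_eq_bot, eq_bot_iff]
  intro c hc
  obtain ⟨⟨a, ha⟩, rfl⟩ := Submodule.Quotient.mk_surjective _ c
  obtain ⟨r, hr⟩ := (Submodule.Quotient.mk_eq_zero _).1 (LinearMap.mem_ker.1 hc)
  refine (Submodule.Quotient.mk_eq_zero _).2 ⟨r, ?_⟩
  have hr' : r • (X.ι g - 1) = X.ι a := hr
  change r • (g - 1) = a
  apply X.ι_injective
  rw [← hr', map_smul, map_sub, map_one]

theorem mk_mem_ker_φ₂_iff (g : K) (t : primZ2 k g (1 : K)) :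
    (Submodule.Quotient.mk t : PrimCoh2 k g (1 : K)) ∈ LinearMap.ker (X.φ₂ g) ↔
      ∃ f, primD1 k (X.ι g) 1 f = X.ι₂ t := by
  rw [LinearMap.mem_ker]
  exact Submodule.Quotient.mk_eq_zero _

theorem primCoh2_mk_eq_zero_iff {C : Type*} [AddCommGroup C] [Module k C] [Coalgebra k C] (g h : C)
    (t : primZ2 k g h) :
    (Submodule.Quotient.mk t : PrimCoh2 k g h) = 0 ↔ (t : C ⊗[k] C) ∈ primB2 k g h :=
  Submodule.Quotient.mk_eq_zero _

theorem primCoh1_mk_eq_zero_iff {C : Type*} [AddCommGroup C] [Module k C] [Coalgebra k C] (g h : C)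
    (t : primZ1 k g h) :
    (Submodule.Quotient.mk t : PrimCoh1 k g h) = 0 ↔ (t : C) ∈ primB1 k g h :=
  Submodule.Quotient.mk_eq_zero _

end HopfOreExt

/-! ### Critical degrees and the cokernel in degree one -/

namespace HopfOreExt

open Coalgebra

variable {k K H : Type*} [Field k] [Ring K] [HopfAlgebra k K] [Ring H] [HopfAlgebra k H]
variable (X : HopfOreExt k K H)
variable {w : ℕ} {g : K}

/-- The degrees in which `H` has cocycles that do not come from `K`. -/
def IsCritical (w : ℕ) : Prop := w = 1 ∨ 2 ≤ w ∧ IsPrimitiveRoot X.q w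

variable {X}

theorem IsCritical.pos (h : X.IsCritical w) : 1 ≤ w := by
  rcases h with rfl | ⟨h, _⟩ <;> omega

/-- Applying `σ` gives `q^w = q^v`. This power is `1` in degree the order of `q`, but `q ≠ 1` in
degree one. -/
theorem IsCritical.unique {v : ℕ} (hw : X.IsCritical w) (hv : X.IsCritical v)
    (h : X.e ^ w = X.e ^ v) : w = v := by
  have hq := X.q_pow_eq_of_e_pow_eq h
  rcases hw with rfl | ⟨h1, hw⟩ <;> rcases hv with rfl | ⟨h2, hv⟩
  · rfl
  · rw [hv.pow_eq_one, pow_one] at hq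
    exact absurd hq (hv.ne_one (by omega))
  · rw [hw.pow_eq_one, pow_one] at hq
    exact absurd hq.symm (hw.ne_one (by omega))
  · exact hw.unique hv

variable (X)

theorem exists_eq_ι_of_ne (hchar : (∃ n : ℕ, 0 < n ∧ X.q ^ n = 1) → CharZero k)
    (hg : ∀ w, X.IsCritical w → g ≠ X.e ^ w) {x : H}
    (h : primD1 k (X.ι g) 1 x ∈ X.degIn₂ (· ≤ 0)) : ∃ a, x = X.ι a := by
  rcases X.cases_of_primD1_mem hchar h with h | ⟨w, c, _, _, _, _, hgw, hw⟩
  · exact h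
  · exact absurd hgw (hg w hw)

theorem exists_coef_eq_smul_one (hchar : (∃ n : ℕ, 0 < n ∧ X.q ^ n = 1) → CharZero k)
    (hw : X.IsCritical w) {x : H} (h : primD1 k (X.ι (X.e ^ w)) 1 x ∈ X.degIn₂ (· ≤ 0)) :
    ∃ c : k, X.coef w x = c • 1 := by
  rcases X.cases_of_primD1_mem hchar h with ⟨a, rfl⟩ | ⟨v, c, _, _, _, hc, hgv, hv⟩
  · exact ⟨0, by rw [coef_ι, if_neg (by have := hw.pos; omega), zero_smul]⟩
  · obtain rfl := hw.unique hv hgv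
    exact ⟨c, hc⟩

theorem exists_eq_ι_of_coef_eq_zero (hchar : (∃ n : ℕ, 0 < n ∧ X.q ^ n = 1) → CharZero k)
    (hw : X.IsCritical w) {x : H} (h : primD1 k (X.ι (X.e ^ w)) 1 x ∈ X.degIn₂ (· ≤ 0))
    (h0 : X.coef w x = 0) : ∃ a, x = X.ι a := by
  rcases X.cases_of_primD1_mem hchar h with h | ⟨v, c, _, _, hc0, hc, hgv, hv⟩
  · exact h
  · obtain rfl := hw.unique hv hgv
    rw [hc] at h0
    have : (1 : K) ≠ 0 := (IsGroupLikeElem.one (R := k) (A := K)).ne_zero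
    exact absurd h0 (smul_ne_zero hc0 this)

theorem coker₁_subsingleton (hchar : (∃ n : ℕ, 0 < n ∧ X.q ^ n = 1) → CharZero k)
    (hg : ∀ w, X.IsCritical w → g ≠ X.e ^ w) : Subsingleton (X.Coker₁ g) := by
  refine ⟨fun a b => ?_⟩
  suffices h : ∀ c : X.Coker₁ g, c = 0 by rw [h a, h b]
  intro c
  obtain ⟨x, rfl⟩ := X.cl₁_surjective g c
  rw [cl₁_eq_zero_iff]
  refine X.exists_eq_ι_of_ne hchar hg ?_
  rw [LinearMap.mem_ker.1 x.2]
  exact zero_mem _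

/-- The coefficient of `z^w` is scalar on cocycles and vanishes exactly on those from `K`, so one
cocycle with coefficient `1` spans the cokernel. -/
theorem span_cl₁_eq_top (hchar : (∃ n : ℕ, 0 < n ∧ X.q ^ n = 1) → CharZero k)
    (hw : X.IsCritical w) (y : primZ1 k (X.ι (X.e ^ w)) (1 : H)) (hy : X.coef w y = 1) :
    X.cl₁ (X.e ^ w) y ≠ 0 ∧ Submodule.span k {X.cl₁ (X.e ^ w) y} = ⊤ := by
  have hm : ∀ x : primZ1 k (X.ι (X.e ^ w)) (1 : H),
      primD1 k (X.ι (X.e ^ w)) 1 (x : H) ∈ X.degIn₂ (· ≤ 0) := fun x => by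
    rw [LinearMap.mem_ker.1 x.2]; exact zero_mem _
  constructor
  · rw [Ne, cl₁_eq_zero_iff]
    rintro ⟨a, ha⟩
    rw [ha, coef_ι, if_neg (by have := hw.pos; omega)] at hy
    exact (IsGroupLikeElem.one (R := k) (A := K)).ne_zero hy.symm
  · rw [eq_top_iff]
    rintro c -
    obtain ⟨x, rfl⟩ := X.cl₁_surjective _ c
    obtain ⟨r, hr⟩ := X.exists_coef_eq_smul_one hchar hw (hm x)
    rw [Submodule.mem_span_singleton]
    refine ⟨r, ?_⟩
    rw [eq_comm, ← sub_eq_zero, ← map_smul, ← map_sub, cl₁_eq_zero_iff]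
    refine X.exists_eq_ι_of_coef_eq_zero hchar hw (hm _) ?_
    rw [Submodule.coe_sub, Submodule.coe_smul, map_sub, map_smul, hr, hy, sub_self]

theorem coker₁_e_subsingleton (hchar : (∃ n : ℕ, 0 < n ∧ X.q ^ n = 1) → CharZero k)
    (hz : X.z₀ ∉ primB2 k X.e (1 : K)) : Subsingleton (X.Coker₁ X.e) := by
  refine ⟨fun a b => ?_⟩
  suffices h : ∀ c : X.Coker₁ X.e, c = 0 by rw [h a, h b]
  intro c
  obtain ⟨⟨x, hx⟩, rfl⟩ := X.cl₁_surjective _ c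
  rw [cl₁_eq_zero_iff]
  rw [LinearMap.mem_ker] at hx
  have hm : primD1 k (X.ι (X.e ^ 1)) 1 x ∈ X.degIn₂ (· ≤ 0) := by
    rw [pow_one, hx]; exact zero_mem _
  obtain ⟨r, hr⟩ := X.exists_coef_eq_smul_one hchar (Or.inl rfl) hm
  by_cases h0 : r = 0
  · exact X.exists_eq_ι_of_coef_eq_zero hchar (Or.inl rfl) hm (by rw [hr, h0, zero_smul])
  -- If `r ≠ 0`, then `x - r z` has no `z` term and its coboundary is `r z₀`. Hence it lies in `K`
  -- and exhibits `z₀` as a coboundary.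
  · exfalso
    have hd : primD1 k (X.ι X.e) 1 (x - r • X.z) = X.ι₂ (r • X.z₀) := by
      rw [map_sub, hx, map_smul, primD1_z, zero_sub, smul_neg, neg_neg, map_smul]
    obtain ⟨a, ha⟩ := X.exists_eq_ι_of_coef_eq_zero hchar (w := 1) (Or.inl rfl)
      (x := x - r • X.z) (by
        rw [pow_one, hd]
        exact fun i j hij => X.ι₂_mem_degIn₂ _ i j (by omega)) (by
        rw [map_sub, map_smul, hr, ← X.mon_one_one, coef_mon, if_pos rfl, sub_self])
    rw [ha, primD1_ι_one] at hd
    have := X.ι₂_injective hd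
    refine hz ⟨r⁻¹ • a, ?_⟩
    rw [map_smul, this, smul_smul, inv_mul_cancel₀ h0, one_smul]

theorem rank_coker₁_le_one (hchar : (∃ n : ℕ, 0 < n ∧ X.q ^ n = 1) → CharZero k)
    (hw : X.IsCritical w) : Module.rank k (X.Coker₁ (X.e ^ w)) ≤ 1 := by
  have hm : ∀ x : primZ1 k (X.ι (X.e ^ w)) (1 : H),
      primD1 k (X.ι (X.e ^ w)) 1 (x : H) ∈ X.degIn₂ (· ≤ 0) := fun x => by
    rw [LinearMap.mem_ker.1 x.2]; exact zero_mem _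
  rw [rank_le_one_iff]
  by_cases hall : ∀ x : primZ1 k (X.ι (X.e ^ w)) (1 : H), X.coef w x = 0
  · refine ⟨0, fun v => ⟨0, ?_⟩⟩
    obtain ⟨x, rfl⟩ := X.cl₁_surjective _ v
    rw [smul_zero, eq_comm, cl₁_eq_zero_iff]
    exact X.exists_eq_ι_of_coef_eq_zero hchar hw (hm x) (hall x)
  · push Not at hall
    obtain ⟨y, hy⟩ := hall
    obtain ⟨r, hr⟩ := X.exists_coef_eq_smul_one hchar hw (hm y)
    have hr0 : r ≠ 0 := by
      rintro rfl
      exact hy (by rw [hr, zero_smul])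
    have h1 := (X.span_cl₁_eq_top hchar hw (r⁻¹ • y) (by
      rw [Submodule.coe_smul, map_smul, hr, smul_smul, inv_mul_cancel₀ hr0, one_smul])).2
    refine ⟨X.cl₁ _ (r⁻¹ • y), fun v => ?_⟩
    rw [← Submodule.mem_span_singleton, h1]
    exact Submodule.mem_top

variable {X} in
-- The coboundary is homogeneous of degree `l`, and there `g - e^l` and all interior binomials are
-- zero.
theorem IsGraded.primD1_z_pow (hG : X.IsGraded) {l : ℕ} (hl : 2 ≤ l)
    (hq : IsPrimitiveRoot X.q l) : primD1 k (X.ι (X.e ^ l)) 1 (X.z ^ l) = 0 := by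
  rw [← mon_one_right]
  refine SymbolZero.eq_zero (w := l) ?_
    (X.primD1_mem (hG.stable _) (X.e ^ l) (X.mon_mem_degIn_eq l 1))
  intro i j hij
  have h := X.coef₂_primD1_of_scalar (X.e ^ l) hij (by omega)
    (X.mon_mem_degIn (P := (· ≤ l)) le_rfl 1) (c := 1) (by rw [coef_mon, if_pos rfl, one_smul])
  rw [h, one_smul, sub_self, TensorProduct.zero_tmul]
  split_ifs with h1 h2
  · rfl
  · rfl
  · rw [qChoose_eq_zero hl hq (by omega) (by omega) hij, zero_smul, neg_zero]

/-! ### The kernel in degree two -/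

theorem mk_eq_zero_of_primD1_ι {g : K} (t : primZ2 k g (1 : K)) {a : K}
    (h : primD1 k (X.ι g) 1 (X.ι a) = X.ι₂ t) :
    (Submodule.Quotient.mk t : PrimCoh2 k g (1 : K)) = 0 := by
  rw [primCoh2_mk_eq_zero_iff]
  exact ⟨a, X.ι₂_injective (by rw [← primD1_ι_one, h])⟩

theorem ker_φ₂_eq_bot (hchar : (∃ n : ℕ, 0 < n ∧ X.q ^ n = 1) → CharZero k)
    (hg : ∀ w, X.IsCritical w → g ≠ X.e ^ w) : LinearMap.ker (X.φ₂ g) = ⊥ := by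
  rw [eq_bot_iff]
  intro c hc
  obtain ⟨t, rfl⟩ := Submodule.Quotient.mk_surjective _ c
  obtain ⟨f, hf⟩ := (X.mk_mem_ker_φ₂_iff g t).1 hc
  obtain ⟨a, rfl⟩ := X.exists_eq_ι_of_ne hchar hg (x := f) (by
    rw [hf]
    exact fun i j hij => X.ι₂_mem_degIn₂ _ i j (by omega))
  exact X.mk_eq_zero_of_primD1_ι t hf

/-- Subtracting a multiple of the cocycle `y` moves a bounding cochain into `K` without changing its
coboundary. -/
theorem ker_φ₂_e_pow_eq_bot (hchar : (∃ n : ℕ, 0 < n ∧ X.q ^ n = 1) → CharZero k)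
    (hw : X.IsCritical w) {y : H} (hy : primD1 k (X.ι (X.e ^ w)) 1 y = 0)
    (hy1 : X.coef w y = 1) : LinearMap.ker (X.φ₂ (X.e ^ w)) = ⊥ := by
  rw [eq_bot_iff]
  intro c hc
  obtain ⟨t, rfl⟩ := Submodule.Quotient.mk_surjective _ c
  obtain ⟨f, hf⟩ := (X.mk_mem_ker_φ₂_iff _ t).1 hc
  have hm : X.ι₂ (t : K ⊗[k] K) ∈ X.degIn₂ (· ≤ 0) := fun i j hij =>
    X.ι₂_mem_degIn₂ _ i j (by omega)
  obtain ⟨r, hr⟩ := X.exists_coef_eq_smul_one hchar hw (x := f) (by rwa [hf])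
  have hd : primD1 k (X.ι (X.e ^ w)) 1 (f - r • y) = X.ι₂ t := by
    rw [map_sub, map_smul, hy, smul_zero, sub_zero, hf]
  obtain ⟨a, ha⟩ := X.exists_eq_ι_of_coef_eq_zero hchar hw (x := f - r • y) (by rwa [hd])
    (by rw [map_sub, map_smul, hr, hy1, sub_self])
  rw [ha] at hd
  exact X.mk_eq_zero_of_primD1_ι t hd

/-- If `∂¹f = t` and `r` is the coefficient of `z` in `f`, then `f - r z` lies in `K` and bounds `t
+ r z₀`. Conversely `-z` bounds `z₀`. -/
theorem ker_φ₂_e (hchar : (∃ n : ℕ, 0 < n ∧ X.q ^ n = 1) → CharZero k) :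
    LinearMap.ker (X.φ₂ X.e) = Submodule.span k
      {(Submodule.Quotient.mk ⟨X.z₀, X.z₀_mem⟩ : PrimCoh2 k X.e (1 : K))} := by
  apply le_antisymm
  · intro c hc
    obtain ⟨t, rfl⟩ := Submodule.Quotient.mk_surjective _ c
    obtain ⟨f, hf⟩ := (X.mk_mem_ker_φ₂_iff _ t).1 hc
    have hm : ∀ t, X.ι₂ t ∈ X.degIn₂ (· ≤ 0) := fun t i j hij =>
      X.ι₂_mem_degIn₂ _ i j (by omega)
    obtain ⟨r, hr⟩ := X.exists_coef_eq_smul_one hchar (w := 1) (Or.inl rfl) (x := f) (by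
      rw [pow_one, hf]; exact hm _)
    have hd : primD1 k (X.ι X.e) 1 (f - r • X.z) = X.ι₂ (t + r • X.z₀) := by
      rw [map_sub, hf, map_smul, primD1_z, smul_neg, sub_neg_eq_add, map_add, map_smul]
    obtain ⟨a, ha⟩ := X.exists_eq_ι_of_coef_eq_zero hchar (w := 1) (Or.inl rfl)
      (x := f - r • X.z) (by rw [pow_one, hd]; exact hm _) (by
        rw [map_sub, map_smul, hr, ← X.mon_one_one, coef_mon, if_pos rfl, sub_self])
    rw [ha] at hd
    have := X.mk_eq_zero_of_primD1_ι (t + r • ⟨X.z₀, X.z₀_mem⟩) hd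
    rw [Submodule.mem_span_singleton]
    refine ⟨-r, ?_⟩
    rw [Submodule.Quotient.mk_add, Submodule.Quotient.mk_smul] at this
    rw [neg_smul, neg_eq_iff_add_eq_zero, add_comm]
    exact this
  · rw [Submodule.span_le, Set.singleton_subset_iff]
    refine (X.mk_mem_ker_φ₂_iff _ _).2 ⟨-X.z, ?_⟩
    rw [map_neg, primD1_z, neg_neg]

theorem rank_ker_φ₂_le_one (hchar : (∃ n : ℕ, 0 < n ∧ X.q ^ n = 1) → CharZero k)
    (hw : X.IsCritical w) : Module.rank k (LinearMap.ker (X.φ₂ (X.e ^ w))) ≤ 1 := by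
  have hm : ∀ t, X.ι₂ t ∈ X.degIn₂ (· ≤ 0) := fun t i j hij =>
    X.ι₂_mem_degIn₂ _ i j (by omega)
  -- A combination of two bounding cochains cancels the scalar coefficients of `z^w`, hence lies in
  -- `K`.
  have key : ∀ (s t : primZ2 k (X.e ^ w) (1 : K)) (f f' : H),
      primD1 k (X.ι (X.e ^ w)) 1 f = X.ι₂ s → primD1 k (X.ι (X.e ^ w)) 1 f' = X.ι₂ t →
      X.coef w f ≠ 0 → ∃ r : k, r • (Submodule.Quotient.mk s : PrimCoh2 k (X.e ^ w) (1 : K))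
        = Submodule.Quotient.mk t := by
    intro s t f f' hf hf' h0
    obtain ⟨r, hr⟩ := X.exists_coef_eq_smul_one hchar hw (x := f) (by rw [hf]; exact hm _)
    obtain ⟨r', hr'⟩ := X.exists_coef_eq_smul_one hchar hw (x := f') (by rw [hf']; exact hm _)
    have hr0 : r ≠ 0 := by
      rintro rfl
      exact h0 (by rw [hr, zero_smul])
    have hd : primD1 k (X.ι (X.e ^ w)) 1 (f' - (r' / r) • f)
        = X.ι₂ ((t - (r' / r) • s : primZ2 k (X.e ^ w) (1 : K)) : K ⊗[k] K) := by
      rw [map_sub, map_smul, hf, hf', Submodule.coe_sub, Submodule.coe_smul, map_sub, map_smul]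
    obtain ⟨a, ha⟩ := X.exists_eq_ι_of_coef_eq_zero hchar hw (x := f' - (r' / r) • f)
      (by rw [hd]; exact hm _)
      (by rw [map_sub, map_smul, hr, hr', smul_smul, div_mul_cancel₀ _ hr0, sub_self])
    rw [ha] at hd
    have := X.mk_eq_zero_of_primD1_ι _ hd
    rw [Submodule.Quotient.mk_sub, Submodule.Quotient.mk_smul, sub_eq_zero] at this
    exact ⟨_, this.symm⟩
  rw [rank_le_one_iff]
  by_cases hall : ∀ (s : primZ2 k (X.e ^ w) (1 : K)) (f : H),
      primD1 k (X.ι (X.e ^ w)) 1 f = X.ι₂ s → X.coef w f = 0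
  · refine ⟨0, fun ⟨v, hv⟩ => ⟨0, Subtype.ext ?_⟩⟩
    obtain ⟨t, rfl⟩ := Submodule.Quotient.mk_surjective _ v
    obtain ⟨f, hf⟩ := (X.mk_mem_ker_φ₂_iff _ t).1 hv
    obtain ⟨a, rfl⟩ := X.exists_eq_ι_of_coef_eq_zero hchar hw (x := f) (by rw [hf]; exact hm _)
      (hall t f hf)
    rw [smul_zero]
    exact (X.mk_eq_zero_of_primD1_ι t hf).symm
  · push Not at hall
    obtain ⟨s, f, hf, h0⟩ := hall
    refine ⟨⟨Submodule.Quotient.mk s, (X.mk_mem_ker_φ₂_iff _ s).2 ⟨f, hf⟩⟩, fun ⟨v, hv⟩ => ?_⟩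
    obtain ⟨t, rfl⟩ := Submodule.Quotient.mk_surjective _ v
    obtain ⟨f', hf'⟩ := (X.mk_mem_ker_φ₂_iff _ t).1 hv
    obtain ⟨r, hr⟩ := key s t f f' hf hf' h0
    exact ⟨r, Subtype.ext hr⟩

/-! ### The cokernel in degree two, filtered case -/

theorem primD2_ι_tmul_z {a : K} (ha : a ∈ primZ1 k g X.e) :
    primD2 k (X.ι g) 1 (X.ι a ⊗ₜ X.z) = X.ι₃ (a ⊗ₜ X.z₀) := by
  rw [primD2_tmul (X.ι g) (X.ι X.e) 1, primD1_ι, LinearMap.mem_ker.1 ha, map_zero,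
    TensorProduct.zero_tmul, map_zero, primD1_z, TensorProduct.tmul_neg, zero_sub, neg_neg]
  rfl

theorem ι_tmul_z_add_mem {a : K} {t : K ⊗[k] K} (ha : a ∈ primZ1 k g X.e)
    (ht : primD2 k g 1 t = -(a ⊗ₜ X.z₀)) :
    X.ι a ⊗ₜ[k] X.z + X.ι₂ t ∈ primZ2 k (X.ι g) (1 : H) := by
  rw [LinearMap.mem_ker, map_add, X.primD2_ι_tmul_z ha, primD2_ι₂_one, ht, map_neg,
    add_neg_cancel]

/-- If the symbol of a cochain in normal form is that of a coboundary, then it is a multiple of the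
symbol of the coboundary of `z ^ w`. -/
theorem exists_of_symbolZero_sub_primD1 {u : H ⊗[k] H} (hw : 1 ≤ w) {a : K} {c : ℕ → k} {f : H}
    (hu : X.IsNormal w u a c) (hf : f ∈ X.degIn (· ≤ w))
    (h : X.SymbolZero w (u - primD1 k (X.ι g) 1 f)) :
    ∃ r : k, a = r • (g - X.e ^ w) ∧
      ∀ i j, 1 ≤ i → 1 ≤ j → i + j = w → c i = -(r * qChoose X.q i j) := by
  have h' : ∀ i j, i + j = w → X.coef₂ i j u = X.coef₂ i j (primD1 k (X.ι g) 1 f) := fun i j hij =>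
    sub_eq_zero.1 (by rw [← map_sub]; exact h i j hij)
  have hc := X.coef_eq_smul_one (g := g) hw hf (by rw [← h' w 0 (add_zero w), hu.last])
  generalize counit (R := k) (X.coef w f) = r at hc
  refine ⟨r, ?_, fun i j hi hj hij => ?_⟩
  · have h1 := h' 0 w (zero_add w)
    rw [hu.first, X.coef₂_primD1_of_scalar g (zero_add w) hw hf hc, if_pos rfl,
      TensorProduct.smul_tmul'] at h1
    exact tmul_one_injective h1
  · have h1 := h' i j hij
    rw [hu.mid i j hi hj hij, X.coef₂_primD1_of_scalar g hij hw hf hc, if_neg (by omega),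
      if_neg (by omega), ← neg_smul, smul_smul] at h1
    rw [smul_left_injective k (X.e_pow_tmul_one_ne_zero j) h1, mul_neg]

theorem mem_degIn_one_of_primD1_mem (hchar : (∃ n : ℕ, 0 < n ∧ X.q ^ n = 1) → CharZero k)
    (hq : ∀ l, 2 ≤ l → ¬ IsPrimitiveRoot X.q l) {f : H}
    (h : primD1 k (X.ι g) 1 f ∈ X.degIn₂ (· ≤ 1)) : f ∈ X.degIn (· ≤ 1) := by
  obtain ⟨n, hn⟩ := X.exists_mem_degIn f
  induction n with
  | zero => exact fun i hi => hn i (by omega)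
  | succ n ih =>
    rcases Nat.eq_zero_or_pos n with rfl | hn'
    · exact hn
    · refine ih fun i hi => ?_
      rcases eq_or_ne i (n + 1) with rfl | h'
      · by_contra h0
        obtain ⟨c, _, _, _, hB⟩ := X.coef_ne_zero_cases (by omega) hn
          (fun i j hij => h i j (by omega)) h0
        obtain ⟨i, j, hi, hj, hij, hne⟩ := exists_qChoose_ne_zero (by omega) hchar
          (hq (n + 1) (by omega))
        exact hne (hB i j hi hj hij)
      · exact hn i (by omega)

/-- A bounding cochain has degree at most `1`, since every higher degree has a nonzero interior
binomial; comparing symbols gives `a = r (g - e)`. Conversely `∂¹z = (g - e) ⊗ z - z₀`. -/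
theorem cl₂_ι_tmul_z_eq_zero_iff (hchar : (∃ n : ℕ, 0 < n ∧ X.q ^ n = 1) → CharZero k)
    (hq : ∀ l, 2 ≤ l → ¬ IsPrimitiveRoot X.q l) (hg : IsGroupLikeElem k g) {a : K} {t : K ⊗[k] K}
    (h : X.ι a ⊗ₜ[k] X.z + X.ι₂ t ∈ primZ2 k (X.ι g) (1 : H)) :
    X.cl₂ g ⟨X.ι a ⊗ₜ[k] X.z + X.ι₂ t, h⟩ = 0 ↔ a ∈ primB1 k g X.e := by
  rw [X.cl₂_eq_zero_iff g hg]
  have hN : X.IsNormal 1 (X.ι a ⊗ₜ[k] X.z) a (fun _ => 0) := by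
    simpa using X.isNormal_tmul le_rfl a
  have hm : ∀ (i j : ℕ) (s), i + j = 1 → X.coef₂ i j (X.ι₂ s) = 0 := fun i j s hij =>
    X.ι₂_mem_degIn₂ s i j (by omega)
  constructor
  · rintro ⟨f, s, hf⟩
    have hf' : primD1 k (X.ι g) 1 f = X.ι a ⊗ₜ[k] X.z + X.ι₂ t - X.ι₂ s := by
      rw [eq_sub_iff_add_eq]; exact hf.symm
    have hd : f ∈ X.degIn (· ≤ 1) := by
      refine X.mem_degIn_one_of_primD1_mem hchar hq (g := g) ?_
      rw [hf']
      refine sub_mem (add_mem ?_ fun i j hij => X.ι₂_mem_degIn₂ _ i j (by omega))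
        fun i j hij => X.ι₂_mem_degIn₂ _ i j (by omega)
      rw [← X.mon_zero, ← X.mon_one_one]
      exact X.mon₂_mem_degIn₂ (P := (· ≤ 1)) (i := 0) (j := 1) (by omega) (a ⊗ₜ 1)
    obtain ⟨r, hr, _⟩ := X.exists_of_symbolZero_sub_primD1 (g := g) le_rfl hN hd (fun i j hij => by
      rw [hf', map_sub, map_sub, map_add, hm i j _ hij, hm i j _ hij]
      abel)
    rw [pow_one] at hr
    exact ⟨r, hr.symm⟩
  · rintro ⟨r, hr⟩
    have hr' : r • (g - X.e) = a := hr
    refine ⟨r • X.z, t + r • X.z₀, ?_⟩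
    have h1 : primD1 k (X.ι g) 1 X.z = (X.ι g - X.ι X.e) ⊗ₜ X.z - X.ι₂ X.z₀ := by
      have h2 := X.primD1_z
      rw [primD1_apply] at h2 ⊢
      rw [sub_eq_add_neg _ (X.ι₂ X.z₀), ← h2, TensorProduct.sub_tmul]
      abel
    change X.ι a ⊗ₜ[k] X.z + X.ι₂ t = _
    rw [← hr', map_smul, map_smul, map_add, map_smul, map_sub, h1, ← TensorProduct.smul_tmul',
      smul_sub]
    abel

theorem exists_eq_ι_tmul_z (hchar : (∃ n : ℕ, 0 < n ∧ X.q ^ n = 1) → CharZero k)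
    (hq : ∀ l, 2 ≤ l → ¬ IsPrimitiveRoot X.q l) (hg : IsGroupLikeElem k g) {u : H ⊗[k] H}
    (hu : primD2 k (X.ι g) 1 u = 0) :
    ∃ (f : H) (a : K) (t : K ⊗[k] K), a ∈ primZ1 k g X.e ∧
      u = primD1 k (X.ι g) 1 f + (X.ι a ⊗ₜ[k] X.z + X.ι₂ t) := by
  -- The bound is written `n + 1` so that the descent stops in degree one, where `a ⊗ z` cannot be
  -- removed.
  obtain ⟨n, hn⟩ : ∃ n, u ∈ X.degIn₂ (· ≤ n + 1) := by
    obtain ⟨n, hn⟩ := X.exists_mem_degIn₂ u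
    exact ⟨n, fun i j hij => hn i j (by omega)⟩
  have hd : ∀ x, primD2 k (X.ι g) 1 (primD1 k (X.ι g) 1 x) = 0 :=
    primD2_primD1 (hg.map X.ι) IsGroupLikeElem.one
  have hm : ∀ n b, primD1 k (X.ι g) 1 (X.mon (n + 1) b) ∈ X.degIn₂ (· ≤ n + 1) := fun n b =>
    X.primD1_mem (X.stable_le _) g (X.mon_mem_degIn (P := (· ≤ n + 1)) le_rfl b)
  induction n generalizing u with
  | zero =>
    obtain ⟨b, a, ha, hs⟩ := X.exists_symbolZero_one hg hn hu
    have hm1 : X.ι a ⊗ₜ[k] X.z ∈ X.degIn₂ (· ≤ 1) := by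
      rw [← X.mon_zero, ← X.mon_one_one]
      exact X.mon₂_mem_degIn₂ (P := (· ≤ 1)) (i := 0) (j := 1) (by omega) (a ⊗ₜ 1)
    obtain ⟨t, ht⟩ := X.exists_ι₂_of_mem (hs.mem_lt (sub_mem (add_mem hn (hm 0 b)) hm1))
    refine ⟨-X.mon 1 b, a, t, ha, ?_⟩
    rw [← ht, map_neg]
    abel
  | succ n ih =>
    obtain ⟨b, hs⟩ := X.exists_symbolZero hchar hg (by omega)
      (fun l hl hl' => absurd hl' (hq l hl)) hn hu
    obtain ⟨f, a, t, ha, h⟩ := ih (by rw [map_add, hu, hd, add_zero])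
      (hs.mem_lt (add_mem hn (hm _ b)))
    refine ⟨f - X.mon (n + 1 + 1) b, a, t, ha, ?_⟩
    rw [map_sub, sub_add_eq_add_sub, ← h, add_sub_cancel_right]

theorem cl₂_eq_of_sub {u v : primZ2 k (X.ι g) (1 : H)} (hg : IsGroupLikeElem k g) {f : H}
    {t : K ⊗[k] K} (h : (u : H ⊗[k] H) - v = primD1 k (X.ι g) 1 f + X.ι₂ t) :
    X.cl₂ g u = X.cl₂ g v := by
  rw [← sub_eq_zero, ← map_sub, X.cl₂_eq_zero_iff g hg]
  exact ⟨f, t, h⟩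

theorem exists_eq_cl₂_ι_tmul_z (hchar : (∃ n : ℕ, 0 < n ∧ X.q ^ n = 1) → CharZero k)
    (hq : ∀ l, 2 ≤ l → ¬ IsPrimitiveRoot X.q l) (hg : IsGroupLikeElem k g) (c : X.Coker₂ g)
    (hc : c ≠ 0) :
    ∃ (a₀ : K) (f₀ : K ⊗[k] K), a₀ ∈ primZ1 k g X.e ∧
      a₀ ∉ primB1 k g X.e ∧ a₀ ⊗ₜ[k] X.z₀ ∈ primB3 k g (1 : K) ∧
      primD2 k g 1 f₀ = -(a₀ ⊗ₜ[k] X.z₀) ∧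
      ∃ h : X.ι a₀ ⊗ₜ[k] X.z + X.ι₂ f₀ ∈ primZ2 k (X.ι g) (1 : H),
        c = X.cl₂ g ⟨X.ι a₀ ⊗ₜ[k] X.z + X.ι₂ f₀, h⟩ := by
  obtain ⟨⟨u, hu⟩, rfl⟩ := X.cl₂_surjective g c
  obtain ⟨f, a, t, ha, h⟩ := X.exists_eq_ι_tmul_z hchar hq hg (LinearMap.mem_ker.1 hu)
  have hv : X.ι a ⊗ₜ[k] X.z + X.ι₂ t ∈ primZ2 k (X.ι g) (1 : H) := by
    rw [LinearMap.mem_ker, h, map_add, primD2_primD1 (hg.map X.ι) IsGroupLikeElem.one,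
      zero_add] at hu
    exact hu
  have heq : X.cl₂ g ⟨u, hu⟩ = X.cl₂ g ⟨_, hv⟩ :=
    X.cl₂_eq_of_sub hg (f := f) (t := 0) (by rw [map_zero, add_zero, sub_eq_iff_eq_add]; exact h)
  have ht : primD2 k g 1 t = -(a ⊗ₜ X.z₀) := by
    apply X.ι₃_injective
    have h1 := LinearMap.mem_ker.1 hv
    rw [map_add, X.primD2_ι_tmul_z ha, primD2_ι₂_one] at h1
    rw [map_neg]
    exact eq_neg_of_add_eq_zero_right h1
  refine ⟨a, t, ha, ?_, ⟨-t, by rw [map_neg, ht, neg_neg]⟩, ht, hv, heq⟩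
  rw [← X.cl₂_ι_tmul_z_eq_zero_iff hchar hq hg hv, ← heq]
  exact hc

end HopfOreExt

/-- The only nontrivial case is `i = 1`, `j ≥ 1`; there `j + m = l`, and the binomial vanishes. -/
theorem isQCocycle_indicator {k : Type*} [Field k] {q : k} {l : ℕ} (hl : 2 ≤ l)
    (hq : IsPrimitiveRoot q l) : IsQCocycle q (l + 1) (fun i => if i = 1 then 1 else 0) := by
  intro i j m hi hm h
  rcases Nat.eq_zero_or_pos j with rfl | hj
  · simp
  · simp only
    rw [if_neg (by omega), mul_zero]
    by_cases h1 : i = 1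
    · rw [qChoose_eq_zero hl hq hj hm (by omega), zero_mul]
    · rw [if_neg h1, mul_zero]

namespace HopfOreExt

open Coalgebra

variable {k K H : Type*} [Field k] [Ring K] [HopfAlgebra k K] [Ring H] [HopfAlgebra k H]
variable (X : HopfOreExt k K H)
variable {w : ℕ} {g : K}

/-! ### The cokernel in degree two, graded case -/

variable {X} in
-- A partial converse to `exists_isNormal`: a homogeneous cochain is its own symbol, and for `g =
-- e^w` and `a = 0` only the conditions on `c` remain.
theorem IsGraded.primD2_eq_zero (hG : X.IsGraded) (hw : 1 ≤ w) {u : H ⊗[k] H}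
    (hu : u ∈ X.degIn₂ (· = w)) {c : ℕ → k} (hn : X.IsNormal w u 0 c) (hc : IsQCocycle X.q w c) :
    primD2 k (X.ι (X.e ^ w)) 1 u = 0 := by
  apply X.coef₃_ext
  intro i j l
  rw [map_zero]
  by_cases hijl : i + j + l = w
  swap
  · exact hG.primD2_mem _ hu i j l hijl
  have hfirst : X.coef₂ 0 w u = 0 := by rw [hn.first, TensorProduct.zero_tmul]
  rw [X.coef₃_primD2 _ hijl (fun i j hij => hu i j (by omega))]
  rcases Nat.eq_zero_or_pos l with rfl | hl
  · have h1 : X.coef₂ (i + j) 0 u = 0 := by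
      obtain rfl : i + j = w := by omega
      exact hn.last
    have h2 : (if i = 0 then (X.e ^ w) ⊗ₜ[k] X.coef₂ j 0 u else 0) = 0 := by
      split_ifs with hi
      · subst hi
        rw [zero_add] at h1
        rw [h1, TensorProduct.tmul_zero]
      · rfl
    rw [h1, h2, if_pos rfl, map_zero, map_zero, smul_zero, zero_sub, neg_zero, zero_add,
      qChoose_zero_right, one_smul, add_zero]
    rcases Nat.eq_zero_or_pos j with rfl | hj
    · rw [add_zero] at h1
      rw [h1, map_zero, map_zero, sub_zero]
    rcases Nat.eq_zero_or_pos i with rfl | hi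
    · obtain rfl : j = w := by omega
      rw [hfirst, map_zero, map_zero, sub_zero]
    rw [hn.mid i j hi hj (by omega), map_smul, map_smul, LinearMap.lTensor_tmul,
      LinearMap.lTensor_tmul, comulE_one, pow_zero]
    exact sub_self _
  · rw [if_neg (show l ≠ 0 by omega), sub_zero]
    rcases Nat.eq_zero_or_pos i with rfl | hi
    · have h3 : X.coef₂ 0 (j + l) u = 0 := by
        obtain rfl : j + l = w := by omega
        exact hfirst
      rw [h3, map_zero, smul_zero, add_zero, if_pos rfl, qChoose_zero_left, one_smul, zero_add]
      rcases Nat.eq_zero_or_pos j with rfl | hj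
      · rw [zero_add] at h3
        rw [h3, map_zero, map_zero, TensorProduct.tmul_zero, sub_zero]
      · rw [hn.mid j l hj hl (by omega), map_smul, LinearMap.rTensor_tmul, comulE_e_pow, map_smul,
          TensorProduct.assoc_tmul, TensorProduct.tmul_smul, show l + j = w by omega, sub_self]
    · rw [if_neg (by omega), zero_sub, hn.mid (i + j) l (by omega) hl hijl,
        hn.mid i (j + l) hi (by omega) (by omega), map_smul, map_smul, map_smul,
        LinearMap.rTensor_tmul, LinearMap.lTensor_tmul, comulE_e_pow, comulE_one,
        TensorProduct.assoc_tmul, smul_smul, smul_smul, hc i j l hi hl hijl, add_comm l j]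
      exact neg_add_cancel _

theorem mem_coker₂Deg {c : X.Coker₂ g} : c ∈ X.coker₂Deg g w ↔
    ∃ u : primZ2 k (X.ι g) (1 : H), (u : H ⊗[k] H) ∈ X.degIn₂ (· = w) ∧ X.cl₂ g u = c := by
  rw [coker₂Deg, homog_eq_degIn₂]
  rfl

variable {X} in
theorem IsGraded.proj₂_mem_primZ2 (hG : X.IsGraded) (w : ℕ) {u : H ⊗[k] H}
    (hu : u ∈ primZ2 k (X.ι g) (1 : H)) : X.proj₂ w u ∈ primZ2 k (X.ι g) (1 : H) := by
  rw [LinearMap.mem_ker] at hu ⊢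
  apply X.coef₃_ext
  intro i j l
  rw [map_zero]
  by_cases h : i + j + l = w
  · have h1 := hG.primD2_mem g (X.sub_proj₂_mem w u) i j l (not_not.2 h)
    rw [map_sub, hu, zero_sub, map_neg, neg_eq_zero] at h1
    exact h1
  · exact hG.primD2_mem g (X.proj₂_mem w u) i j l h

/-- The homogeneous components of a cocycle. -/
def projZ (hG : X.IsGraded) (g : K) (w : ℕ) :
    primZ2 k (X.ι g) (1 : H) →ₗ[k] primZ2 k (X.ι g) (1 : H) :=
  (X.proj₂ w).restrict fun _ hu => hG.proj₂_mem_primZ2 w hu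

theorem projZ_coe (hG : X.IsGraded) (g : K) (w : ℕ) (u : primZ2 k (X.ι g) (1 : H)) :
    (X.projZ hG g w u : H ⊗[k] H) = X.proj₂ w u := rfl

variable {X} in
theorem IsGraded.proj₂_primD1 (hG : X.IsGraded) (g : K) (w : ℕ) (f : H) :
    X.proj₂ w (primD1 k (X.ι g) 1 f) = primD1 k (X.ι g) 1 (X.mon w (X.coef w f)) := by
  have h1 : f - X.mon w (X.coef w f) ∈ X.degIn (· ≠ w) := by
    intro i hi
    obtain rfl := not_not.1 hi
    rw [map_sub, coef_mon, if_pos rfl, sub_self]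
  have h2 := X.proj₂_of_mem_ne (X.primD1_mem (hG.stable _) g h1)
  rw [map_sub, map_sub, X.proj₂_of_mem (X.primD1_mem (hG.stable _) g (X.mon_mem_degIn_eq w _)),
    sub_eq_zero] at h2
  exact h2

theorem proj₂_ι₂ (w : ℕ) (t : K ⊗[k] K) : X.proj₂ w (X.ι₂ t) = if w = 0 then X.ι₂ t else 0 := by
  split_ifs with h
  · subst h; exact X.proj₂_of_mem (X.ι₂_mem_degIn₂ t)
  · exact X.proj₂_of_mem_ne fun i j hij => X.ι₂_mem_degIn₂ t i j fun h' => hij (by omega)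

variable {X} in
theorem IsGraded.cl₂_projZ (hG : X.IsGraded) (hg : IsGroupLikeElem k g) (w : ℕ)
    {u : primZ2 k (X.ι g) (1 : H)} (hu : X.cl₂ g u = 0) : X.cl₂ g (X.projZ hG g w u) = 0 := by
  rw [X.cl₂_eq_zero_iff g hg] at hu ⊢
  obtain ⟨f, t, h⟩ := hu
  refine ⟨X.mon w (X.coef w f), if w = 0 then t else 0, ?_⟩
  rw [projZ_coe, h, map_add, hG.proj₂_primD1, proj₂_ι₂]
  split_ifs <;> simp

/-- The homogeneous components of the classes in the cokernel. -/
def projCoker (hG : X.IsGraded) (hg : IsGroupLikeElem k g) (w : ℕ) : X.Coker₂ g →ₗ[k] X.Coker₂ g :=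
  (LinearMap.ker (X.cl₂ g)).liftQ (X.cl₂ g ∘ₗ X.projZ hG g w)
    (fun _ hu => hG.cl₂_projZ hg w hu) ∘ₗ
  ((X.cl₂ g).quotKerEquivOfSurjective (X.cl₂_surjective g)).symm.toLinearMap

theorem projCoker_cl₂ (hG : X.IsGraded) (hg : IsGroupLikeElem k g) (w : ℕ)
    (u : primZ2 k (X.ι g) (1 : H)) :
    X.projCoker hG hg w (X.cl₂ g u) = X.cl₂ g (X.projZ hG g w u) := by
  have : ((X.cl₂ g).quotKerEquivOfSurjective (X.cl₂_surjective g)).symm (X.cl₂ g u)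
      = Submodule.Quotient.mk u := by
    rw [LinearEquiv.symm_apply_eq]; rfl
  rw [projCoker, LinearMap.comp_apply, LinearEquiv.coe_coe, this]
  rfl

/-- `projCoker` in degree `w` fixes the classes of degree `w` and kills those of every other degree,
which gives independence. -/
theorem coker₂Deg_isInternal (hG : X.IsGraded) (hg : IsGroupLikeElem k g) :
    DirectSum.IsInternal (X.coker₂Deg g) := by
  refine DirectSum.isInternal_submodule_of_iSupIndep_of_iSup_eq_top ?_ ?_
  · intro w
    rw [Submodule.disjoint_def]
    intro c hc hc'
    obtain ⟨u, hu, rfl⟩ := X.mem_coker₂Deg.1 hc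
    have h1 : X.projCoker hG hg w (X.cl₂ g u) = X.cl₂ g u := by
      rw [projCoker_cl₂]
      exact congrArg _ (Subtype.ext (X.proj₂_of_mem hu))
    have h2 : (⨆ j, ⨆ (_ : j ≠ w), X.coker₂Deg g j) ≤ LinearMap.ker (X.projCoker hG hg w) := by
      refine iSup_le fun j => iSup_le fun hj => ?_
      intro d hd
      obtain ⟨v, hv, rfl⟩ := X.mem_coker₂Deg.1 hd
      rw [LinearMap.mem_ker, projCoker_cl₂]
      have h3 : X.projZ hG g w v = 0 := Subtype.ext (X.proj₂_of_mem_ne fun r s hrs =>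
        hv r s fun h => hrs (by omega))
      rw [h3, map_zero]
    rw [← h1]
    exact h2 hc'
  · rw [eq_top_iff]
    rintro c -
    obtain ⟨u, rfl⟩ := X.cl₂_surjective g c
    obtain ⟨n, hn⟩ := X.exists_mem_degIn₂ (u : H ⊗[k] H)
    have h : u = ∑ w ∈ Finset.range (n + 1), X.projZ hG g w u := by
      apply Subtype.ext
      rw [AddSubmonoidClass.coe_finsetSum]
      exact (X.sum_proj₂ fun i j hij => hn i j (by omega)).symm
    rw [h, map_sum]
    refine sum_mem fun w _ => Submodule.mem_iSup_of_mem w ?_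
    exact X.mem_coker₂Deg.2 ⟨_, X.proj₂_mem w _, rfl⟩

variable {X} in
theorem IsGraded.exists_eq_primD1_mon (hG : X.IsGraded) (hg : IsGroupLikeElem k g) (hw : 1 ≤ w)
    {u : primZ2 k (X.ι g) (1 : H)} (hu : (u : H ⊗[k] H) ∈ X.degIn₂ (· = w))
    (h : X.cl₂ g u = 0) : ∃ b, (u : H ⊗[k] H) = primD1 k (X.ι g) 1 (X.mon w b) := by
  obtain ⟨f, t, hf⟩ := (X.cl₂_eq_zero_iff g hg u).1 h
  refine ⟨X.coef w f, ?_⟩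
  have h1 := congrArg (X.proj₂ w) hf
  rwa [X.proj₂_of_mem hu, map_add, hG.proj₂_primD1, proj₂_ι₂, if_neg (by omega), add_zero] at h1

/-- If a homogeneous cocycle in normal form is a coboundary up to an element of `K ⊗ K`, then it is
the coboundary of a multiple of a power of `z`. -/
theorem exists_of_cl₂_eq_zero (hG : X.IsGraded) (hg : IsGroupLikeElem k g) (hw : 1 ≤ w)
    {u : primZ2 k (X.ι g) (1 : H)} (hu : (u : H ⊗[k] H) ∈ X.degIn₂ (· = w))
    {a : K} {c : ℕ → k} (hn : X.IsNormal w (u : H ⊗[k] H) a c) (h : X.cl₂ g u = 0) :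
    ∃ r : k, a = r • (g - X.e ^ w) ∧
      ∀ i j, 1 ≤ i → 1 ≤ j → i + j = w → c i = -(r * qChoose X.q i j) := by
  obtain ⟨b, hb⟩ := hG.exists_eq_primD1_mon hg hw hu h
  refine X.exists_of_symbolZero_sub_primD1 hw hn (X.mon_mem_degIn (P := (· ≤ w)) le_rfl b) fun i j _ => ?_
  rw [hb, sub_self, map_zero]

/-- Homogeneous cochains have nothing below their symbols, so an equality of symbols is an equality
of cochains. -/
theorem cl₂_eq_of_symbolZero (hG : X.IsGraded) (hg : IsGroupLikeElem k g)
    {u v : primZ2 k (X.ι g) (1 : H)} (hu : (u : H ⊗[k] H) ∈ X.degIn₂ (· = w))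
    (hv : (v : H ⊗[k] H) ∈ X.degIn₂ (· = w)) {b : K}
    (h : X.SymbolZero w ((u : H ⊗[k] H) + primD1 k (X.ι g) 1 (X.mon w b) - v)) :
    X.cl₂ g u = X.cl₂ g v := by
  have h1 := h.eq_zero (sub_mem (add_mem hu
    (X.primD1_mem (hG.stable _) g (X.mon_mem_degIn_eq w b))) hv)
  refine X.cl₂_eq_of_sub hg (f := -X.mon w b) (t := 0) ?_
  rw [map_neg, map_zero, add_zero, eq_neg_iff_add_eq_zero, ← h1]
  abel

theorem coker₂Deg_zero (hg : IsGroupLikeElem k g) : X.coker₂Deg g 0 = ⊥ := by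
  rw [eq_bot_iff]
  intro c hc
  obtain ⟨u, hu, rfl⟩ := X.mem_coker₂Deg.1 hc
  obtain ⟨t, ht⟩ := X.exists_ι₂_of_mem (u := (u : H ⊗[k] H)) fun i j hij => hu i j (by omega)
  rw [Submodule.mem_bot, X.cl₂_eq_zero_iff g hg]
  exact ⟨0, t, by rw [map_zero, zero_add, ht]⟩

theorem coker₂Deg_eq_bot (hchar : (∃ n : ℕ, 0 < n ∧ X.q ^ n = 1) → CharZero k)
    (hG : X.IsGraded) (hg : IsGroupLikeElem k g) (hw : w ≠ 1)
    (hwq : ∀ l, 2 ≤ l → IsPrimitiveRoot X.q l → w ≠ l ∧ w ≠ l + 1) : X.coker₂Deg g w = ⊥ := by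
  rcases Nat.eq_zero_or_pos w with rfl | hw0
  · exact X.coker₂Deg_zero hg
  rw [eq_bot_iff]
  intro c hc
  obtain ⟨u, hu, rfl⟩ := X.mem_coker₂Deg.1 hc
  obtain ⟨b, hb⟩ := X.exists_symbolZero hchar hg (by omega) hwq
    (fun i j hij => hu i j (by omega)) (LinearMap.mem_ker.1 u.2)
  rw [Submodule.mem_bot, X.cl₂_eq_of_symbolZero hG hg (v := 0) hu (zero_mem _) (b := b)
    (by rwa [Submodule.coe_zero, sub_zero]), map_zero]

variable {X} in
theorem IsGraded.z_mem (hG : X.IsGraded) : X.z ∈ primZ1 k (X.ι X.e) (1 : H) := by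
  rw [LinearMap.mem_ker, primD1_z, hG.z₀_eq_zero, map_zero, neg_zero]

theorem ι_mem_primZ1 {h a : K} (ha : a ∈ primZ1 k g h) : X.ι a ∈ primZ1 k (X.ι g) (X.ι h) := by
  rw [LinearMap.mem_ker] at ha ⊢
  rw [primD1_ι, ha, map_zero]

theorem ι_tmul_z_pow_mem_degIn₂ (a : K) (w : ℕ) : X.ι a ⊗ₜ[k] (X.z ^ w) ∈ X.degIn₂ (· = w) := by
  rw [← X.mon_zero, ← X.mon_one_right]
  exact X.mon₂_mem_degIn₂ (P := (· = w)) (zero_add w) (a ⊗ₜ 1)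

/-- Classes of cocycles that depend linearly on a parameter. -/
def familyMap {M : Type*} [AddCommGroup M] [Module k M] (g : K) (w : ℕ) (L : M →ₗ[k] H ⊗[k] H)
    (hL : ∀ m, L m ∈ primZ2 k (X.ι g) (1 : H)) (hL' : ∀ m, L m ∈ X.degIn₂ (· = w)) :
    M →ₗ[k] X.coker₂Deg g w :=
  (X.cl₂ g ∘ₗ L.codRestrict _ hL).codRestrict _ fun m => X.mem_coker₂Deg.2 ⟨⟨L m, hL m⟩, hL' m, rfl⟩

theorem familyMap_coe {M : Type*} [AddCommGroup M] [Module k M] (g : K) (w : ℕ)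
    (L : M →ₗ[k] H ⊗[k] H) (hL : ∀ m, L m ∈ primZ2 k (X.ι g) (1 : H))
    (hL' : ∀ m, L m ∈ X.degIn₂ (· = w)) (m : M) :
    (X.familyMap g w L hL hL' m : X.Coker₂ g) = X.cl₂ g ⟨L m, hL m⟩ := rfl

/-- The cocycles `a ⊗ z^w`. -/
def tmulZPow (g : K) (w : ℕ) : primZ1 k g (X.e ^ w) →ₗ[k] H ⊗[k] H :=
  (TensorProduct.mk k H H).flip (X.z ^ w) ∘ₗ (X.ι : K →ₗc[k] H).toLinearMap ∘ₗ Submodule.subtype _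

/-- The isomorphism of `𝔓¹_{g,e^w}(K)` with the classes of degree `w`, provided that every class of
degree `w` is represented by some `a ⊗ z^w`. -/
theorem exists_equiv (hG : X.IsGraded) (hg : IsGroupLikeElem k g) (hw : 1 ≤ w)
    (hz : X.z ^ w ∈ primZ1 k (X.ι (X.e ^ w)) (1 : H))
    (hsurj : ∀ u : primZ2 k (X.ι g) (1 : H), (u : H ⊗[k] H) ∈ X.degIn₂ (· = w) →
      ∃ b a : K, a ∈ primZ1 k g (X.e ^ w) ∧
        X.SymbolZero w ((u : H ⊗[k] H) + primD1 k (X.ι g) 1 (X.mon w b) - X.ι a ⊗ₜ (X.z ^ w))) :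
    ∃ Φ : PrimCoh1 k g (X.e ^ w) ≃ₗ[k] X.coker₂Deg g w,
      ∀ a : primZ1 k g (X.e ^ w),
        ∃ h : X.ι a ⊗ₜ[k] (X.z ^ w) ∈ primZ2 k (X.ι g) (1 : H),
          (Φ (Submodule.Quotient.mk a) : X.Coker₂ g) = X.cl₂ g ⟨X.ι a ⊗ₜ[k] (X.z ^ w), h⟩ := by
  have hL : ∀ a, X.tmulZPow g w a ∈ primZ2 k (X.ι g) (1 : H) := fun a =>
    tmul_mem_primZ2 (X.ι_mem_primZ1 a.2) hz
  have hL' : ∀ a, X.tmulZPow g w a ∈ X.degIn₂ (· = w) := fun a => X.ι_tmul_z_pow_mem_degIn₂ _ _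
  have hS : ∀ a : primZ1 k g (X.e ^ w), X.familyMap g w _ hL hL' a = 0 ↔
      (a : K) ∈ primB1 k g (X.e ^ w) := by
    intro a
    rw [← Submodule.coe_eq_zero, familyMap_coe]
    constructor
    · intro h
      obtain ⟨r, hr, _⟩ := X.exists_of_cl₂_eq_zero hG hg hw (hL' a) (X.isNormal_tmul hw (a : K)) h
      exact ⟨r, hr.symm⟩
    · rintro ⟨r, hr⟩
      have hr' : r • (g - X.e ^ w) = (a : K) := hr
      rw [X.cl₂_eq_zero_iff g hg]
      -- As `z^w` is a cocycle for `e^w`, its coboundary for `g` is `(g - e^w) ⊗ z^w`.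
      refine ⟨r • X.z ^ w, 0, ?_⟩
      have h1 := LinearMap.mem_ker.1 hz
      rw [primD1_apply] at h1
      change X.ι (a : K) ⊗ₜ (X.z ^ w) = _
      rw [← hr', map_zero, add_zero, map_smul, map_smul, primD1_apply, map_sub,
        ← TensorProduct.smul_tmul', TensorProduct.sub_tmul]
      congr 1
      rw [sub_eq_iff_eq_add, ← sub_eq_zero, ← neg_eq_zero, ← h1]
      abel
  let F := ((LinearMap.range (primD0 k g (X.e ^ w))).submoduleOf
    (LinearMap.ker (primD1 k g (X.e ^ w)))).liftQ (X.familyMap g w _ hL hL')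
      (fun a ha => (hS a).2 ha)
  have hF : Function.Bijective F := by
    constructor
    · rw [← LinearMap.ker_eq_bot, eq_bot_iff]
      intro c hc
      obtain ⟨a, rfl⟩ := Submodule.Quotient.mk_surjective _ c
      exact (primCoh1_mk_eq_zero_iff _ _ a).2 ((hS a).1 hc)
    · rintro ⟨c, hc⟩
      obtain ⟨u, hu, rfl⟩ := X.mem_coker₂Deg.1 hc
      obtain ⟨b, a, ha, hs⟩ := hsurj u hu
      refine ⟨Submodule.Quotient.mk ⟨a, ha⟩, Subtype.ext ?_⟩
      exact (X.cl₂_eq_of_symbolZero hG hg (v := ⟨_, hL ⟨a, ha⟩⟩) hu (hL' _) hs).symm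
  exact ⟨LinearEquiv.ofBijective F hF, fun a => ⟨hL a, rfl⟩⟩

theorem exists_equiv_one (hG : X.IsGraded) (hg : IsGroupLikeElem k g) :
    ∃ Φ : PrimCoh1 k g X.e ≃ₗ[k] X.coker₂Deg g 1,
      ∀ a : primZ1 k g X.e,
        ∃ h : X.ι a ⊗ₜ[k] X.z ∈ primZ2 k (X.ι g) (1 : H),
          (Φ (Submodule.Quotient.mk a) : X.Coker₂ g) = X.cl₂ g ⟨X.ι a ⊗ₜ[k] X.z, h⟩ := by
  have h := X.exists_equiv (w := 1) hG hg le_rfl (by simpa using hG.z_mem) (fun u hu => by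
    obtain ⟨b, a, ha, hs⟩ := X.exists_symbolZero_one hg (fun i j hij => hu i j (by omega))
      (LinearMap.mem_ker.1 u.2)
    exact ⟨b, a, by rwa [pow_one], by rwa [pow_one]⟩)
  rwa [pow_one, pow_one] at h

theorem exists_equiv_order_of_ne (hG : X.IsGraded) (hg : IsGroupLikeElem k g) {l : ℕ} (hl : 2 ≤ l)
    (hq : IsPrimitiveRoot X.q l) (hgl : g ≠ X.e ^ l) :
    ∃ Φ : PrimCoh1 k g (X.e ^ l) ≃ₗ[k] X.coker₂Deg g l,
      ∀ a : primZ1 k g (X.e ^ l),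
        ∃ h : X.ι a ⊗ₜ[k] (X.z ^ l) ∈ primZ2 k (X.ι g) (1 : H),
          (Φ (Submodule.Quotient.mk a) : X.Coker₂ g) = X.cl₂ g ⟨X.ι a ⊗ₜ[k] (X.z ^ l), h⟩ :=
  X.exists_equiv hG hg (by omega) (hG.primD1_z_pow hl hq) fun u hu => by
    obtain ⟨b, a, s, ha, hs0, hs⟩ := X.exists_symbolZero_order hl hq hg
      (fun i j hij => hu i j (by omega)) (LinearMap.mem_ker.1 u.2)
    rw [(smul_eq_zero.1 hs0).resolve_right (sub_ne_zero.2 hgl), zero_smul, add_zero] at hs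
    exact ⟨b, a, ha, hs⟩

set_option maxHeartbeats 1000000 in
-- Injectivity in the second component: coboundaries in normal form have no interior coefficients in
-- degree `l`, while that of `[z]^l` at `(1, l - 1)` is nonzero.
theorem exists_equiv_order (hG : X.IsGraded) {l : ℕ} (hl : 2 ≤ l)
    (hq : IsPrimitiveRoot X.q l) :
    ∃ Φ : (PrimCoh1 k (X.e ^ l) (X.e ^ l) × k) ≃ₗ[k] X.coker₂Deg (X.e ^ l) l,
      ∀ (a : primZ1 k (X.e ^ l) (X.e ^ l)) (b : k),
        ∃ h : X.ι a ⊗ₜ[k] (X.z ^ l) + b • X.bracketZ l ∈ primZ2 k (X.ι (X.e ^ l)) (1 : H),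
          (Φ (Submodule.Quotient.mk a, b) : X.Coker₂ (X.e ^ l))
            = X.cl₂ (X.e ^ l) ⟨X.ι a ⊗ₜ[k] (X.z ^ l) + b • X.bracketZ l, h⟩ := by
  have hg := X.e_pow_groupLike l
  have hl1 : 1 ≤ l := by omega
  obtain ⟨L, hLa⟩ : ∃ L : primZ1 k (X.e ^ l) (X.e ^ l) × k →ₗ[k] H ⊗[k] H,
      ∀ m, L m = X.ι (m.1 : K) ⊗ₜ (X.z ^ l) + m.2 • X.bracketZ l :=
    ⟨(X.tmulZPow (X.e ^ l) l).coprod (LinearMap.toSpanSingleton k _ (X.bracketZ l)), fun _ => rfl⟩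
  have hL : ∀ m, L m ∈ primZ2 k (X.ι (X.e ^ l)) (1 : H) := fun m => by
    rw [hLa]
    exact add_mem (tmul_mem_primZ2 (X.ι_mem_primZ1 m.1.2) (hG.primD1_z_pow hl hq))
      (Submodule.smul_mem _ _ (LinearMap.mem_ker.2 (hG.primD2_eq_zero hl1 (X.bracketZ_mem l)
        (X.isNormal_bracketZ l) (isQCocycle_qFact hl hq))))
  have hL' : ∀ m, L m ∈ X.degIn₂ (· = l) := fun m => by
    rw [hLa]
    exact add_mem (X.ι_tmul_z_pow_mem_degIn₂ _ _) (Submodule.smul_mem _ _ (X.bracketZ_mem l))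
  obtain ⟨G, hGc⟩ : ∃ G : primZ1 k (X.e ^ l) (X.e ^ l) × k →ₗ[k] X.coker₂Deg (X.e ^ l) l,
      ∀ m, (G m : X.Coker₂ (X.e ^ l)) = X.cl₂ (X.e ^ l) ⟨L m, hL m⟩ :=
    ⟨X.familyMap (X.e ^ l) l L hL hL', fun _ => rfl⟩
  have hG0 : ∀ m, G m = 0 → (m.1 : K) ∈ primB1 k (X.e ^ l) (X.e ^ l) ∧ m.2 = 0 := by
    intro m hm
    have h : X.cl₂ (X.e ^ l) ⟨L m, hL m⟩ = 0 := by
      rw [← hGc, hm]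
      exact Submodule.coe_zero
    have hn := (X.isNormal_tmul hl1 (m.1 : K)).add ((X.isNormal_bracketZ l).smul m.2)
    rw [← hLa] at hn
    obtain ⟨r, hr, hc⟩ := X.exists_of_cl₂_eq_zero hG hg hl1 (hL' m) hn h
    constructor
    · rw [smul_zero, add_zero] at hr
      exact ⟨r, hr.symm⟩
    · have h1 := hc 1 (l - 1) le_rfl (by omega) (by omega)
      rw [qChoose_eq_zero hl hq le_rfl (by omega) (by omega), mul_zero, neg_zero, Pi.add_apply,
        Pi.smul_apply, zero_add, smul_eq_mul, mul_eq_zero] at h1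
      refine h1.resolve_right (div_ne_zero (qFact_ne_zero_of_lt hl hq (by omega)) (mul_ne_zero
        (qFact_ne_zero_of_lt hl hq (by omega)) (qFact_ne_zero_of_lt hl hq (by omega))))
  -- Both grouplike elements are `e^l`, so there are no nonzero one-coboundaries.
  have hker : (LinearMap.range (primD0 k (X.e ^ l) (X.e ^ l))).submoduleOf
      (LinearMap.ker (primD1 k (X.e ^ l) (X.e ^ l))) ≤
        LinearMap.ker (G ∘ₗ LinearMap.inl k _ _) := by
    rintro ⟨a, ha⟩ ⟨r, hr⟩
    have hr' : r • (X.e ^ l - X.e ^ l) = a := hr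
    have ha0 : (⟨a, ha⟩ : primZ1 k (X.e ^ l) (X.e ^ l)) = 0 := by
      apply Subtype.ext
      exact hr'.symm.trans (by rw [sub_self, smul_zero]; rfl)
    rw [ha0]
    exact zero_mem _
  obtain ⟨F, hFG⟩ : ∃ F : (PrimCoh1 k (X.e ^ l) (X.e ^ l) × k) →ₗ[k] X.coker₂Deg (X.e ^ l) l,
      ∀ (a : primZ1 k (X.e ^ l) (X.e ^ l)) (b : k),
        F (Submodule.Quotient.mk a, b) = G (a, b) := by
    refine ⟨(Submodule.liftQ _ _ hker).coprod (G ∘ₗ LinearMap.inr k _ _), fun a b => ?_⟩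
    change G (a, 0) + G (0, b) = _
    rw [← map_add, Prod.mk_add_mk, add_zero, zero_add]
  have hF : Function.Bijective F := by
    constructor
    · rw [← LinearMap.ker_eq_bot, eq_bot_iff]
      rintro ⟨c, b⟩ hc
      obtain ⟨a, rfl⟩ := Submodule.Quotient.mk_surjective _ c
      rw [LinearMap.mem_ker, hFG] at hc
      obtain ⟨h1, rfl⟩ := hG0 _ hc
      rw [(primCoh1_mk_eq_zero_iff _ _ a).2 h1]
      exact zero_mem _
    · rintro ⟨c, hc⟩
      obtain ⟨u, hu, rfl⟩ := X.mem_coker₂Deg.1 hc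
      obtain ⟨b, a, s, ha, _, hs⟩ := X.exists_symbolZero_order hl hq hg
        (fun i j hij => hu i j (by omega)) (LinearMap.mem_ker.1 u.2)
      refine ⟨(Submodule.Quotient.mk ⟨a, ha⟩, s), ?_⟩
      have hs' := hLa (⟨a, ha⟩, s)
      rw [← hs'] at hs
      rw [hFG]
      refine Subtype.ext ?_
      rw [hGc]
      exact (X.cl₂_eq_of_symbolZero hG hg (v := ⟨_, hL (⟨a, ha⟩, s)⟩) hu (hL' _) hs).symm
  refine ⟨LinearEquiv.ofBijective F hF, fun a b => ⟨by rw [← hLa (a, b)]; exact hL (a, b), ?_⟩⟩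
  rw [LinearEquiv.ofBijective_apply, hFG, hGc]
  exact congrArg _ (Subtype.ext (hLa (a, b)))

theorem e_pow_z_tmul_mem_degIn₂ (l : ℕ) :
    (X.ι X.e ^ l * X.z) ⊗ₜ[k] (X.z ^ l) ∈ X.degIn₂ (· = l + 1) := by
  have h : (X.ι X.e ^ l * X.z) ⊗ₜ[k] (X.z ^ l) = X.mon₂ 1 l ((X.e ^ l) ⊗ₜ 1) := by
    simp [mon_apply]
  rw [h]
  exact X.mon₂_mem_degIn₂ (P := (· = l + 1)) (add_comm 1 l) _

theorem coker₂Deg_order_succ (hG : X.IsGraded) {l : ℕ} (hl : 2 ≤ l) (hq : IsPrimitiveRoot X.q l)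
    (hgl : g = X.e ^ (l + 1)) :
    ∃ h : (X.ι X.e ^ l * X.z) ⊗ₜ[k] (X.z ^ l) ∈ primZ2 k (X.ι g) (1 : H),
      X.cl₂ g ⟨(X.ι X.e ^ l * X.z) ⊗ₜ[k] (X.z ^ l), h⟩ ≠ 0 ∧
      X.coker₂Deg g (l + 1) =
        Submodule.span k {X.cl₂ g ⟨(X.ι X.e ^ l * X.z) ⊗ₜ[k] (X.z ^ l), h⟩} := by
  subst hgl
  have hg := X.e_pow_groupLike (l + 1)
  have hn := X.isNormal_e_pow_z_tmul hl
  have hd := X.e_pow_z_tmul_mem_degIn₂ l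
  have h := hG.primD2_eq_zero (by omega) hd hn (isQCocycle_indicator hl hq)
  have hl1 : qInt X.q (l + 1) = 1 := by
    rw [(qInt_add_of_eq_zero 1 ((qInt_eq_zero_iff hl hq l).2 dvd_rfl)).1, qInt_one]
  refine ⟨LinearMap.mem_ker.2 h, ?_, ?_⟩
  · intro h0
    obtain ⟨r, _, hc⟩ := X.exists_of_cl₂_eq_zero hG hg (by omega) hd hn h0
    -- A coboundary in normal form has equal coefficients at `(1, l)` and `(l, 1)`; those of `e^l z
    -- ⊗ z^l` are `1` and `0`.
    have h1 := hc 1 l le_rfl (by omega) (by omega)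
    have h2 := hc l 1 (by omega) le_rfl rfl
    rw [if_pos rfl, qChoose_one_left, hl1] at h1
    rw [if_neg (by omega), qChoose_one_right, hl1] at h2
    exact one_ne_zero (h1.trans h2.symm)
  · apply le_antisymm
    · intro c hc
      obtain ⟨u, hu, rfl⟩ := X.mem_coker₂Deg.1 hc
      obtain ⟨b, s, _, hs⟩ := X.exists_symbolZero_order_succ hl hq hg
        (fun i j hij => hu i j (by omega)) (LinearMap.mem_ker.1 u.2)
      rw [Submodule.mem_span_singleton]
      refine ⟨s, ?_⟩
      rw [← map_smul, eq_comm]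
      exact X.cl₂_eq_of_symbolZero hG hg hu (Submodule.smul_mem _ s hd) hs
    · rw [Submodule.span_le, Set.singleton_subset_iff]
      exact X.mem_coker₂Deg.2 ⟨_, hd, rfl⟩

theorem coker₂Deg_order_succ_of_ne (hG : X.IsGraded) (hg : IsGroupLikeElem k g) {l : ℕ}
    (hl : 2 ≤ l) (hq : IsPrimitiveRoot X.q l) (hgl : g ≠ X.e ^ (l + 1)) :
    X.coker₂Deg g (l + 1) = ⊥ := by
  rw [eq_bot_iff]
  intro c hc
  obtain ⟨u, hu, rfl⟩ := X.mem_coker₂Deg.1 hc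
  obtain ⟨b, s, hs0, hs⟩ := X.exists_symbolZero_order_succ hl hq hg
    (fun i j hij => hu i j (by omega)) (LinearMap.mem_ker.1 u.2)
  rw [(smul_eq_zero.1 hs0).resolve_right (sub_ne_zero.2 hgl), zero_smul] at hs
  rw [Submodule.mem_bot, X.cl₂_eq_of_symbolZero hG hg (v := 0) hu (zero_mem _) (b := b) hs, map_zero]

end HopfOreExt

end

/-! ### The theorem -/

theorem theorem6p5 {k K H : Type*} [Field k] [Ring K] [HopfAlgebra k K]
    [Ring H] [HopfAlgebra k H] (X : HopfOreExt k K H)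
    (hchar : (∃ n : ℕ, 0 < n ∧ X.q ^ n = 1) → CharZero k) :
    -- the scalar `q`, and the grouplike elements of `H`
    (X.q ≠ 0 ∧ X.σ X.e = X.q • X.e ∧
      X.z * X.ι X.e = X.q • (X.ι X.e * X.z) + X.ι (X.δ X.e) ∧
      ∀ x : H, IsGroupLikeElem k x ↔ ∃ g : K, IsGroupLikeElem k g ∧ X.ι g = x) ∧
    -- degree one: injectivity
    (∀ g : K, IsGroupLikeElem k g → Function.Injective (X.φ₁ g)) ∧
    -- degree one: the cokernel
    (∀ g : K, IsGroupLikeElem k g → g ≠ X.e →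
      (∀ l : ℕ, 2 ≤ l → IsPrimitiveRoot X.q l → g ≠ X.e ^ l) → Subsingleton (X.Coker₁ g)) ∧
    (∀ f₀ : K, primD1 k X.e 1 f₀ = X.z₀ →
      ∃ h : X.z + X.ι f₀ ∈ primZ1 k (X.ι X.e) (1 : H),
        X.cl₁ X.e ⟨X.z + X.ι f₀, h⟩ ≠ 0 ∧
        Submodule.span k {X.cl₁ X.e ⟨X.z + X.ι f₀, h⟩} = ⊤) ∧
    (X.z₀ ∉ primB2 k X.e (1 : K) → Subsingleton (X.Coker₁ X.e)) ∧
    (∀ l : ℕ, 2 ≤ l → IsPrimitiveRoot X.q l →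
      Module.rank k (X.Coker₁ (X.e ^ l)) ≤ 1 ∧
      (X.z₀ = 0 → X.z * X.ι X.e = X.q • (X.ι X.e * X.z) →
        ∃ h : X.z ^ l ∈ primZ1 k (X.ι (X.e ^ l)) (1 : H),
          X.cl₁ (X.e ^ l) ⟨X.z ^ l, h⟩ ≠ 0 ∧
          Submodule.span k {X.cl₁ (X.e ^ l) ⟨X.z ^ l, h⟩} = ⊤)) ∧
    -- degree two: the kernel
    (∀ g : K, IsGroupLikeElem k g → g ≠ X.e →
      (∀ l : ℕ, 2 ≤ l → IsPrimitiveRoot X.q l → g ≠ X.e ^ l) →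
      LinearMap.ker (X.φ₂ g) = ⊥) ∧
    (X.z₀ ∈ primB2 k X.e (1 : K) → LinearMap.ker (X.φ₂ X.e) = ⊥) ∧
    (X.z₀ ∉ primB2 k X.e (1 : K) →
      ∃ h : X.z₀ ∈ primZ2 k X.e (1 : K),
        (Submodule.Quotient.mk ⟨X.z₀, h⟩ : PrimCoh2 k X.e (1 : K)) ≠ 0 ∧
        LinearMap.ker (X.φ₂ X.e) =
          Submodule.span k {(Submodule.Quotient.mk ⟨X.z₀, h⟩ : PrimCoh2 k X.e (1 : K))}) ∧
    (∀ l : ℕ, 2 ≤ l → IsPrimitiveRoot X.q l →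
      Module.rank k (LinearMap.ker (X.φ₂ (X.e ^ l))) ≤ 1 ∧
      (X.z₀ = 0 → X.z * X.ι X.e = X.q • (X.ι X.e * X.z) →
        LinearMap.ker (X.φ₂ (X.e ^ l)) = ⊥)) ∧
    -- degree two: the cokernel if `q` is one or not a root of unity
    ((X.q = 1 ∨ ∀ n : ℕ, 0 < n → X.q ^ n ≠ 1) →
      ∀ g : K, IsGroupLikeElem k g →
        -- the classes of these elements are defined, and it is known when they vanish
        (∀ (a₀ : K) (f₀ : K ⊗[k] K), a₀ ∈ primZ1 k g X.e →
          primD2 k g 1 f₀ = -(a₀ ⊗ₜ[k] X.z₀) →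
          ∃ h : X.ι a₀ ⊗ₜ[k] X.z + X.ι₂ f₀ ∈ primZ2 k (X.ι g) (1 : H),
            (X.cl₂ g ⟨X.ι a₀ ⊗ₜ[k] X.z + X.ι₂ f₀, h⟩ ≠ 0 ↔ a₀ ∉ primB1 k g X.e)) ∧
        -- every nonzero element of the cokernel is such a class
        (∀ c : X.Coker₂ g, c ≠ 0 →
          ∃ (a₀ : K) (f₀ : K ⊗[k] K), a₀ ∈ primZ1 k g X.e ∧
            a₀ ∉ primB1 k g X.e ∧ a₀ ⊗ₜ[k] X.z₀ ∈ primB3 k g (1 : K) ∧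
            primD2 k g 1 f₀ = -(a₀ ⊗ₜ[k] X.z₀) ∧
            ∃ h : X.ι a₀ ⊗ₜ[k] X.z + X.ι₂ f₀ ∈ primZ2 k (X.ι g) (1 : H),
              c = X.cl₂ g ⟨X.ι a₀ ⊗ₜ[k] X.z + X.ι₂ f₀, h⟩)) ∧
    -- degree two: the graded cokernel if `q` is a primitive root of unity
    (∀ l : ℕ, 2 ≤ l → IsPrimitiveRoot X.q l → X.z₀ = 0 →
      X.z * X.ι X.e = X.q • (X.ι X.e * X.z) →
      ∀ g : K, IsGroupLikeElem k g →
        -- the grading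
        DirectSum.IsInternal (X.coker₂Deg g) ∧
        -- degree `1`
        (∃ Φ : PrimCoh1 k g X.e ≃ₗ[k] X.coker₂Deg g 1,
          ∀ a : primZ1 k g X.e,
            ∃ h : X.ι a ⊗ₜ[k] X.z ∈ primZ2 k (X.ι g) (1 : H),
              (Φ (Submodule.Quotient.mk a) : X.Coker₂ g) = X.cl₂ g ⟨X.ι a ⊗ₜ[k] X.z, h⟩) ∧
        -- degree `l`
        (g = X.e ^ l →
          ∃ Φ : (PrimCoh1 k g (X.e ^ l) × k) ≃ₗ[k] X.coker₂Deg g l,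
            ∀ (a : primZ1 k g (X.e ^ l)) (b : k),
              ∃ h : X.ι a ⊗ₜ[k] (X.z ^ l) + b • X.bracketZ l ∈ primZ2 k (X.ι g) (1 : H),
                (Φ (Submodule.Quotient.mk a, b) : X.Coker₂ g)
                  = X.cl₂ g ⟨X.ι a ⊗ₜ[k] (X.z ^ l) + b • X.bracketZ l, h⟩) ∧
        (g ≠ X.e ^ l →
          ∃ Φ : PrimCoh1 k g (X.e ^ l) ≃ₗ[k] X.coker₂Deg g l,
            ∀ a : primZ1 k g (X.e ^ l),
              ∃ h : X.ι a ⊗ₜ[k] (X.z ^ l) ∈ primZ2 k (X.ι g) (1 : H),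
                (Φ (Submodule.Quotient.mk a) : X.Coker₂ g)
                  = X.cl₂ g ⟨X.ι a ⊗ₜ[k] (X.z ^ l), h⟩) ∧
        -- degree `l + 1`
        (g = X.e ^ (l + 1) →
          ∃ h : (X.ι X.e ^ l * X.z) ⊗ₜ[k] (X.z ^ l) ∈ primZ2 k (X.ι g) (1 : H),
            X.cl₂ g ⟨(X.ι X.e ^ l * X.z) ⊗ₜ[k] (X.z ^ l), h⟩ ≠ 0 ∧
            X.coker₂Deg g (l + 1) =
              Submodule.span k {X.cl₂ g ⟨(X.ι X.e ^ l * X.z) ⊗ₜ[k] (X.z ^ l), h⟩}) ∧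
        (g ≠ X.e ^ (l + 1) → X.coker₂Deg g (l + 1) = ⊥) ∧
        -- all other degrees
        (∀ w : ℕ, w ≠ 1 → w ≠ l → w ≠ l + 1 → X.coker₂Deg g w = ⊥)) := by
  have hcrit : ∀ g : K, g ≠ X.e →
      (∀ l : ℕ, 2 ≤ l → IsPrimitiveRoot X.q l → g ≠ X.e ^ l) → ∀ w, X.IsCritical w → g ≠ X.e ^ w := by
    rintro g h1 h2 w (rfl | ⟨hw, hw'⟩)
    · rwa [pow_one]
    · exact h2 w hw hw'
  have h1 : X.IsCritical 1 := Or.inl rfl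
  refine ⟨⟨X.q_ne_zero, X.σ_e, ?_, X.isGroupLikeElem_iff⟩, fun g _ => X.φ₁_injective g,
    fun g _ hg hg' => X.coker₁_subsingleton hchar (hcrit g hg hg'), ?_,
    X.coker₁_e_subsingleton hchar, ?_, fun g _ hg hg' => X.ker_φ₂_eq_bot hchar (hcrit g hg hg'),
    ?_, ?_, ?_, ?_, ?_⟩
  · rw [X.z_mul, X.σ_e, map_smul, smul_mul_assoc]
  · intro f₀ hf
    have h : X.z + X.ι f₀ ∈ primZ1 k (X.ι X.e) (1 : H) := by
      rw [LinearMap.mem_ker, map_add, X.primD1_z, X.primD1_ι_one, hf, neg_add_cancel]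
    have hcoef : X.coef 1 (X.z + X.ι f₀) = 1 := by
      rw [map_add, ← X.mon_one_one, X.coef_mon, X.coef_ι, if_pos rfl, if_neg one_ne_zero, add_zero]
    have key := X.span_cl₁_eq_top hchar h1
    rw [pow_one] at key
    exact ⟨h, key ⟨_, h⟩ hcoef⟩
  · intro l hl hq
    have hl' : X.IsCritical l := Or.inr ⟨hl, hq⟩
    refine ⟨X.rank_coker₁_le_one hchar hl', fun h0 he => ?_⟩
    have h := (X.isGraded h0 he).primD1_z_pow hl hq
    have hc : X.coef l (X.z ^ l) = 1 := by rw [← X.mon_one_right, X.coef_mon, if_pos rfl]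
    exact ⟨h, X.span_cl₁_eq_top hchar hl' ⟨_, h⟩ hc⟩
  · rintro ⟨f₀, hf⟩
    have key := X.ker_φ₂_e_pow_eq_bot hchar h1 (y := X.z + X.ι f₀)
    rw [pow_one] at key
    refine key ?_ ?_
    · rw [map_add, X.primD1_z, X.primD1_ι_one, hf, neg_add_cancel]
    · rw [map_add, ← X.mon_one_one, X.coef_mon, X.coef_ι, if_pos rfl, if_neg one_ne_zero, add_zero]
  · intro hz
    exact ⟨X.z₀_mem, fun h => hz ((HopfOreExt.primCoh2_mk_eq_zero_iff _ _ _).1 h),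
      X.ker_φ₂_e hchar⟩
  · intro l hl hq
    have hl' : X.IsCritical l := Or.inr ⟨hl, hq⟩
    refine ⟨X.rank_ker_φ₂_le_one hchar hl', fun h0 he => ?_⟩
    exact X.ker_φ₂_e_pow_eq_bot hchar hl' ((X.isGraded h0 he).primD1_z_pow hl hq)
      (by rw [← X.mon_one_right, X.coef_mon, if_pos rfl])
  · intro hq g hg
    -- For these `q` the only critical degree is `1`.
    have hq' : ∀ l, 2 ≤ l → ¬ IsPrimitiveRoot X.q l := by
      intro l hl hql
      rcases hq with hq | hq
      · exact hql.ne_one (by omega) hq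
      · exact hq l (by omega) hql.pow_eq_one
    refine ⟨fun a₀ f₀ ha hf => ?_, X.exists_eq_cl₂_ι_tmul_z hchar hq' hg⟩
    have h := X.ι_tmul_z_add_mem ha hf
    exact ⟨h, (X.cl₂_ι_tmul_z_eq_zero_iff hchar hq' hg h).not⟩
  · intro l hl hq h0 he g hg
    have hG := X.isGraded h0 he
    refine ⟨X.coker₂Deg_isInternal hG hg, X.exists_equiv_one hG hg, ?_,
      X.exists_equiv_order_of_ne hG hg hl hq, X.coker₂Deg_order_succ hG hl hq,
      X.coker₂Deg_order_succ_of_ne hG hg hl hq, fun w hw1 hwl hwl1 =>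
        X.coker₂Deg_eq_bot hchar hG hg hw1 fun l' _ hq' => ?_⟩
    · rintro rfl
      exact X.exists_equiv_order hG hl hq
    · obtain rfl := hq'.unique hq
      exact ⟨hwl, hwl1⟩
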